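/- **Model and definitions.** In the $\mathsf{LOCAL}$ model the network is a connected graph $G=(V,E)$ with $n$ nodes; nodes have distinct identifiers from a space of size $n^{k}$ for a fixed $k$, know $n$ and their own identifier and input, and in each synchronous round every node sends one message of unbounded size to each of its neighbours (local computation is unbounded; algorithms are deterministic). For vertex covers $\alpha,\beta$ of $G$, an $\ell$-batch *reconfiguration schedule* from $\alpha$ to $\beta$ is a sequence $V_0=\alpha,V_1,\dots,V_\ell=\beta$ of vertex covers of $G$ such that $V_i\oplus V_{i+1}$ is an independent set of $G$ for all $0\le i<\ell$ (here $\oplus$ is the symmetric difference). It is an $(\eta,c)$-*approximation* if $|V_i\cup V_{i+1}|\le \eta\max\{|\alpha|,|\beta|\}+c$ for all $0\le i<\ell$. An algorithm computes the schedule if each node, initially knowing whether it is in $\alpha$ and whether it is in $\beta$, outputs its membership in each $V_i$. A *cactus* is a (not necessarily connected) graph each of whose edges belongs to at most one cycle. $\log^* n$ is the number of times $\log_2$ must be applied to $n$ until the result is at most $1$. **Theorem 4 (Cactus Reconfiguration).** There is an absolute constant $B$, and for each $k$ a constant $C$, such that for every $\varepsilon>0$ there is a deterministic $\mathsf{LOCAL}$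 algorithm with the following property. On every connected $n$-node graph $G$ with distinct identifiers from $\{0,\dots,n^{k}-1\}$, and for all vertex covers $\alpha,\beta$ of $G$ such that the induced subgraph $G[\alpha\oplus\beta]$ is a cactus, it computes within $C\cdot\log^*(n)/\varepsilon$ rounds an $\ell$-batch $(1+\varepsilon,3)$-approximation reconfiguration schedule from $\alpha$ to $\beta$ for some $\ell\le B\lceil 1/\varepsilon\rceil$. -/

import Mathlib

open scoped symmDiff

/-- A graph is a cactus if each of its edges belongs to at most one cycle, i.e. any two cycles
that share an edge are the same subgraph. (Connectedness is not required.) -/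
def SimpleGraph.IsCactus {V : Type*} (G : SimpleGraph V) : Prop :=
  ∀ ⦃u v : V⦄ (p : G.Walk u u) (q : G.Walk v v), p.IsCycle → q.IsCycle →
    ∀ e : Sym2 V, e ∈ p.edges → e ∈ q.edges → p.toSubgraph = q.toSubgraph

/-- `S 0, S 1, …, S ℓ` is a vertex cover reconfiguration schedule of length `ℓ` (that is, with
`ℓ` batches `S i ∆ S (i + 1)`) from `α` to `β`, of cost at most `s`. -/
structure IsReconfigurationSchedule {V : Type*} [DecidableEq V] (G : SimpleGraph V)
    (α β : Finset V) (ℓ : ℕ) (s : ℝ) (S : ℕ → Finset V) : Prop where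
  isVertexCover : ∀ i ≤ ℓ, G.IsVertexCover (S i : Set V)
  first : S 0 = α
  last : S ℓ = β
  card_le : ∀ i < ℓ, ((S i ∪ S (i + 1)).card : ℝ) ≤ s
  isIndepSet : ∀ i < ℓ, G.IsIndepSet ((S i ∆ S (i + 1) : Finset V) : Set V)

/-- An `ℓ`-batch reconfiguration schedule that is an `(η, c)`-approximation: its cost is at most
`η * max |α| |β| + c`. -/
def IsApproxSchedule {V : Type*} [DecidableEq V] (G : SimpleGraph V)
    (α β : Finset V) (ℓ : ℕ) (η c : ℝ) (S : ℕ → Finset V) : Prop :=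
  IsReconfigurationSchedule G α β ℓ (η * (max α.card β.card : ℕ) + c) S

/-- The iterated logarithm `log* n`: how often `log₂` has to be applied to `n` until the value is
at most `1`. Rounding the intermediate values up does not change this number, because for a
natural number `m` one has `log₂ x ≤ m ↔ x ≤ 2 ^ m ↔ ⌈log₂ x⌉ ≤ m`. -/
def logStar (n : ℕ) : ℕ :=
  if h : n ≤ 1 then 0 else logStar (Nat.clog 2 n) + 1
termination_by n
decreasing_by
  have h1 : n ≤ 2 ^ (n - 1) := by
    have := (n - 1).lt_two_pow_self
    omega
  have h2 := Nat.clog_le_of_le_pow h1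
  omega

/-- A deterministic algorithm in the LOCAL model. Local computations are arbitrary functions and
messages have unbounded size. Initially a node knows the number `n` of nodes of the network, its
own identifier and its own input.

In each round a node sends one message to each of its neighbours, and receives the messages that
its neighbours sent to it. `send σ j` is the message that a node in state `σ` sends to its
neighbour with identifier `j`; `receive σ M` is the new state of a node that was in state `σ` and
received the messages `M`, where `(j, m) ∈ M` means that `m` came from the neighbour with
identifier `j`. (As a node can put its identifier into its messages, and can send the whole
function `send σ` for the receiver to evaluate, addressing by identifiers gives no additional
power.) After `rounds n` rounds, every node produces its output from its state. -/
structure LocalAlgorithm (Input Output : Type) where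
  State : Type
  Message : Type
  init : (n : ℕ) → (ident : ℕ) → Input → State
  send : State → ℕ → Message
  receive : State → Set (ℕ × Message) → State
  rounds : ℕ → ℕ
  output : State → Output

namespace LocalAlgorithm

variable {Input Output : Type} (A : LocalAlgorithm Input Output)
  {V : Type*} [Fintype V] (G : SimpleGraph V) (ident : V → ℕ) (x : V → Input)

/-- The state of node `v` after `t` rounds on the network `G` with identifiers `ident` and
inputs `x`. -/
def stateAfter : ℕ → V → A.State
  | 0, v => A.init (Fintype.card V) (ident v) (x v)
  | t + 1, v => A.receive (stateAfter t v)
      {jm | ∃ u, G.Adj v u ∧ jm = (ident u, A.send (stateAfter t u) (ident v))}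

/-- The output of node `v` when the algorithm is run on `G`. -/
def run (v : V) : Output :=
  A.output (A.stateAfter G ident x (A.rounds (Fintype.card V)) v)

end LocalAlgorithm

/-- The local input of a node: whether it belongs to `α`, and whether it belongs to `β`. -/
def coverInput {V : Type*} [DecidableEq V] (α β : Finset V) (v : V) : Bool × Bool :=
  (decide (v ∈ α), decide (v ∈ β))

/-- The `i`-th set described by the local outputs: node `v` outputs a list of bits, and its `i`-th
bit (counted from `0`) tells whether `v` belongs to the `i`-th set. -/
def outputSets {V : Type*} [Fintype V] (out : V → List Bool) (i : ℕ) : Finset V :=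
  Finset.univ.filter fun v => (out v)[i]? = some true

/-- With identifiers `ident`, the algorithm `A` computes an `ℓ`-batch `(η, c)`-approximation
schedule from `α` to `β` on `G`: each node outputs its membership in each of the `ℓ + 1` sets of
such a schedule. -/
def LocalAlgorithm.ComputesSchedule (A : LocalAlgorithm (Bool × Bool) (List Bool))
    {V : Type*} [Fintype V] [DecidableEq V] (G : SimpleGraph V) (ident : V → ℕ)
    (α β : Finset V) (ℓ : ℕ) (η c : ℝ) : Prop :=
  (∀ v, (A.run G ident (coverInput α β) v).length = ℓ + 1) ∧
    IsApproxSchedule G α β ℓ η c (outputSets (A.run G ident (coverInput α β)))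

/-! Write M for the larger of the two covers. Both `α \ β` and `β \ α` are independent, so a batch
that only adds vertices of `β \ α` or only removes vertices of `α \ β` is legal, as long as a vertex
leaves only after its neighbours on the other side are present.

The sequential core is `HasCommonDetours.fillable`: in a cactus between disjoint sets A and B with
|B| ≤ |A|, the vertices of B can be added one by one so that their number never exceeds the number
of vertices of A thereby freed by more than two. A minimal nonempty B' ⊆ B that frees at least |B'|
vertices either contains a single vertex that frees something, or spans with the freed vertices a
graph of minimum degree two. In the latter case a cactus has a part attached at one vertex with all
degrees at most two (`HasCommonDetours.exists_pendant`), and B can be filled along that part.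
Cutting the order into q blocks exchanges A for B in 2q batches with excess at most 3 + |B|/q. If
|B| > |A|, the opposite exchange is run backwards.

For the distributed version the vertices are divided into classes of radius O(s), with s of order
1/ε, each exchanged on its own. Classes that do not grow go first and growing ones afterwards, so
the class sizes add up to at most M plus the excesses. Edges of the difference graph between classes
are made harmless by adding their ends in `β \ α` in an initial batch (`crossingSet`). It remains to
have few classes and few crossing edges. Clusters of the difference graph with at least s vertices
number at most 2M/s, and contracting a cactus leaves at most two crossing edges per cluster
(`HasCommonDetours.card_le_of_crossing`). Smaller clusters are whole components without crossing
edges, but there may be many; they are grouped by a clustering of `nearGraph`, which is connected on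
`α ∪ β`. So there are at most 2M/s groups or only one, and this one group is responsible for the
additive 3.

Clusters are grown by doubling: each phase reduces colours along pointers between small clusters by
log* n Cole–Vishkin steps and merges them towards local colour maxima (`exists_local_clustering`).
Phase i works at scale 2^i, so the radii form a geometric sum. That everything is a LOCAL algorithm
follows because each output depends only on the ball around the node (`LocalAlgorithm.run_ofLocal`,
`mem_schedule_iff_of_agree`). -/

namespace SimpleGraph

/-! ### Balls and agreement of graphs on balls -/

variable {V : Type*}

/-- The vertices that a walk of length at most `r` joins to `v`. -/
def walkBall (Γ : SimpleGraph V) (v : V) (r : ℕ) : Set V :=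
  {u | ∃ p : Γ.Walk v u, p.length ≤ r}

variable {Γ Γ' : SimpleGraph V}

theorem self_mem_walkBall (v : V) (r : ℕ) : v ∈ Γ.walkBall v r :=
  ⟨Walk.nil, by simp⟩

theorem walkBall_mono {v : V} {r s : ℕ} (h : r ≤ s) : Γ.walkBall v r ⊆ Γ.walkBall v s :=
  fun _ ⟨p, hp⟩ => ⟨p, hp.trans h⟩

theorem mem_walkBall_trans {u v w : V} {r s : ℕ} (hu : u ∈ Γ.walkBall v r)
    (hw : w ∈ Γ.walkBall u s) : w ∈ Γ.walkBall v (r + s) := by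
  obtain ⟨p, hp⟩ := hu
  obtain ⟨q, hq⟩ := hw
  exact ⟨p.append q, by rw [Walk.length_append]; omega⟩

theorem mem_walkBall_symm {u v : V} {r : ℕ} (hu : u ∈ Γ.walkBall v r) : v ∈ Γ.walkBall u r := by
  obtain ⟨p, hp⟩ := hu
  exact ⟨p.reverse, by rwa [Walk.length_reverse]⟩

theorem Adj.mem_walkBall_one {u v : V} (h : Γ.Adj v u) : u ∈ Γ.walkBall v 1 :=
  ⟨h.toWalk, by simp⟩

theorem mem_walkBall_zero {u v : V} : u ∈ Γ.walkBall v 0 ↔ u = v := by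
  constructor
  · rintro ⟨p, hp⟩
    exact (Walk.eq_of_length_eq_zero (Nat.le_zero.mp hp)).symm
  · rintro rfl
    exact self_mem_walkBall _ _

theorem mem_walkBall_succ {u v : V} {r : ℕ} :
    u ∈ Γ.walkBall v (r + 1) ↔ u = v ∨ ∃ w, Γ.Adj v w ∧ u ∈ Γ.walkBall w r := by
  constructor
  · rintro ⟨p, hp⟩
    cases p with
    | nil => exact Or.inl rfl
    | cons h p => exact Or.inr ⟨_, h, p, by simpa using hp⟩
  · rintro (rfl | ⟨w, h, p, hp⟩)
    · exact self_mem_walkBall _ _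
    · exact ⟨Walk.cons h p, by simpa using hp⟩

theorem mem_walkBall_succ' {u v : V} {r : ℕ} :
    u ∈ Γ.walkBall v (r + 1) ↔ u = v ∨ ∃ w ∈ Γ.walkBall v r, Γ.Adj w u := by
  constructor
  · intro h
    rcases mem_walkBall_succ.mp (mem_walkBall_symm h) with h | ⟨w, hw, h⟩
    · exact Or.inl h.symm
    · exact Or.inr ⟨w, mem_walkBall_symm h, hw.symm⟩
  · rintro (rfl | ⟨w, h, hw⟩)
    · exact self_mem_walkBall _ _
    · exact mem_walkBall_trans h hw.mem_walkBall_one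

theorem mem_walkBall_of_le {H : SimpleGraph V} (h : H ≤ Γ) {u v : V} {r : ℕ}
    (hu : u ∈ H.walkBall v r) : u ∈ Γ.walkBall v r := by
  obtain ⟨p, hp⟩ := hu
  exact ⟨p.mapLe h, by simpa using hp⟩

theorem mem_walkBall_mul {H : SimpleGraph V} {a : ℕ}
    (h : ∀ u w, H.Adj u w → w ∈ Γ.walkBall u a) {u v : V} {r : ℕ}
    (hu : u ∈ H.walkBall v r) : u ∈ Γ.walkBall v (a * r) := by
  induction r generalizing u with
  | zero =>
    rw [mem_walkBall_zero] at hu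
    exact hu ▸ self_mem_walkBall _ _
  | succ r ih =>
    rcases mem_walkBall_succ'.mp hu with rfl | ⟨w, hw, hwu⟩
    · exact self_mem_walkBall _ _
    · exact mem_walkBall_trans (ih hw) (h _ _ hwu)

/-- The two graphs have the same edges at the vertices of the ball of radius `r` around `v`. -/
def AgreeOn (Γ Γ' : SimpleGraph V) (v : V) (r : ℕ) : Prop :=
  ∀ u ∈ Γ.walkBall v r, ∀ w, Γ.Adj u w ↔ Γ'.Adj u w

namespace AgreeOn

theorem mono {v : V} {r s : ℕ} (h : AgreeOn Γ Γ' v s) (hrs : r ≤ s) : AgreeOn Γ Γ' v r :=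
  fun u hu w => h u (walkBall_mono hrs hu) w

theorem shift {u v : V} {d r s : ℕ} (h : AgreeOn Γ Γ' v s) (hu : u ∈ Γ.walkBall v d)
    (hs : d + r ≤ s) : AgreeOn Γ Γ' u r :=
  fun _ hw x => h _ (walkBall_mono hs (mem_walkBall_trans hu hw)) x

/-- Every edge of a walk of length at most `r + 1` starts in the ball of radius `r`, hence the gain
of one in the radius. -/
theorem mem_walkBall {v u : V} {r : ℕ} (h : AgreeOn Γ Γ' v r) (hu : u ∈ Γ.walkBall v (r + 1)) :
    u ∈ Γ'.walkBall v (r + 1) := by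
  suffices ∀ s ≤ r + 1, ∀ u ∈ Γ.walkBall v s, u ∈ Γ'.walkBall v s from this _ le_rfl u hu
  intro s
  induction s with
  | zero => intro _ u hu; rw [mem_walkBall_zero] at hu ⊢; exact hu
  | succ s ih =>
    intro hs u hu
    rcases mem_walkBall_succ'.mp hu with rfl | ⟨w, hw, hwu⟩
    · exact self_mem_walkBall _ _
    · exact mem_walkBall_succ'.mpr (Or.inr ⟨w, ih (by omega) w hw,
        (h w (walkBall_mono (by omega) hw) u).mp hwu⟩)

theorem mem_walkBall_of_mem {v u : V} {r : ℕ} (h : AgreeOn Γ Γ' v r)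
    (hu : u ∈ Γ'.walkBall v (r + 1)) : u ∈ Γ.walkBall v (r + 1) := by
  suffices ∀ s ≤ r + 1, ∀ u ∈ Γ'.walkBall v s, u ∈ Γ.walkBall v s from this _ le_rfl u hu
  intro s
  induction s with
  | zero => intro _ u hu; rw [mem_walkBall_zero] at hu ⊢; exact hu
  | succ s ih =>
    intro hs u hu
    rcases mem_walkBall_succ'.mp hu with rfl | ⟨w, hw, hwu⟩
    · exact self_mem_walkBall _ _
    · have hw' := ih (by omega) w hw
      exact mem_walkBall_succ'.mpr (Or.inr ⟨w, hw',
        (h w (walkBall_mono (by omega) hw') u).mpr hwu⟩)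

theorem mem_walkBall_iff {v u : V} {r s : ℕ} (h : AgreeOn Γ Γ' v r) (hs : s ≤ r + 1) :
    u ∈ Γ.walkBall v s ↔ u ∈ Γ'.walkBall v s := by
  cases s with
  | zero => rw [mem_walkBall_zero, mem_walkBall_zero]
  | succ s =>
    have h' := h.mono (show s ≤ r by omega)
    exact ⟨h'.mem_walkBall, h'.mem_walkBall_of_mem⟩

theorem symm {v : V} {r : ℕ} (h : AgreeOn Γ Γ' v r) : AgreeOn Γ' Γ v r :=
  fun u hu w => (h u ((h.mem_walkBall_iff (by omega)).mpr hu) w).symm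

end AgreeOn

end SimpleGraph

/-! ### Local views and the full-information algorithm -/

/-- The identifiers and inputs in the ball of radius `r` around `v`. -/
def knownInputs {I : Type} (Γ : SimpleGraph ℕ) (x : ℕ → I) (v r : ℕ) : Set (ℕ × I) :=
  {p | p.1 ∈ Γ.walkBall v r ∧ p.2 = x p.1}

/-- The edges at the vertices at distance less than `r` from `v`. -/
def knownEdges (Γ : SimpleGraph ℕ) (v r : ℕ) : Set (ℕ × ℕ) :=
  {e | ∃ s, s + 1 ≤ r ∧ e.1 ∈ Γ.walkBall v s ∧ Γ.Adj e.1 e.2}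

theorem knownInputs_succ {I : Type} (Γ : SimpleGraph ℕ) (x : ℕ → I) (v r : ℕ) :
    knownInputs Γ x v (r + 1) =
      knownInputs Γ x v r ∪ {p | ∃ w, Γ.Adj v w ∧ p ∈ knownInputs Γ x w r} := by
  ext p
  simp only [knownInputs, Set.mem_ofPred_eq, Set.mem_union]
  constructor
  · rintro ⟨h, hp⟩
    rcases SimpleGraph.mem_walkBall_succ.mp h with h | ⟨w, hw, h⟩
    · exact Or.inl ⟨h ▸ SimpleGraph.self_mem_walkBall _ _, hp⟩
    · exact Or.inr ⟨w, hw, h, hp⟩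
  · rintro (⟨h, hp⟩ | ⟨w, hw, h, hp⟩)
    · exact ⟨SimpleGraph.walkBall_mono (by omega) h, hp⟩
    · exact ⟨SimpleGraph.mem_walkBall_succ.mpr (Or.inr ⟨w, hw, h⟩), hp⟩

theorem knownEdges_succ (Γ : SimpleGraph ℕ) (v r : ℕ) :
    knownEdges Γ v (r + 1) =
      knownEdges Γ v r ∪ {e | ∃ w, Γ.Adj v w ∧ e ∈ knownEdges Γ w r} ∪
        {e | ∃ w, Γ.Adj v w ∧ e = (v, w)} := by
  ext ⟨a, b⟩
  simp only [knownEdges, Set.mem_ofPred_eq, Set.mem_union, Prod.mk.injEq]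
  constructor
  · rintro ⟨s, hs, ha, hab⟩
    cases s with
    | zero =>
      rw [SimpleGraph.mem_walkBall_zero] at ha
      subst ha
      exact Or.inr ⟨b, hab, rfl, rfl⟩
    | succ s =>
      rcases SimpleGraph.mem_walkBall_succ.mp ha with rfl | ⟨w, hw, h⟩
      · exact Or.inr ⟨b, hab, rfl, rfl⟩
      · exact Or.inl (Or.inr ⟨w, hw, s, by omega, h, hab⟩)
  · rintro ((⟨s, hs, ha, hab⟩ | ⟨w, hw, s, hs, ha, hab⟩) | ⟨w, hw, rfl, rfl⟩)
    · exact ⟨s, by omega, ha, hab⟩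
    · exact ⟨s + 1, by omega, SimpleGraph.mem_walkBall_succ.mpr (Or.inr ⟨w, hw, ha⟩), hab⟩
    · exact ⟨0, by omega, SimpleGraph.self_mem_walkBall _ _, hw⟩

/-- One round is lost: an edge becomes known only once information from one of its ends has arrived,
so `r + 1` rounds are needed to see all edges at distance `r`. -/
theorem agreeOn_of_knownEdges_eq {Γ Γ' : SimpleGraph ℕ} {v r : ℕ}
    (h : knownEdges Γ v (r + 1) = knownEdges Γ' v (r + 1)) : SimpleGraph.AgreeOn Γ Γ' v r := by
  have key : ∀ {Γ Γ' : SimpleGraph ℕ}, knownEdges Γ v (r + 1) = knownEdges Γ' v (r + 1) →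
      ∀ u ∈ Γ.walkBall v r, ∀ w, Γ.Adj u w → Γ'.Adj u w := by
    intro Γ Γ' h u hu w huw
    have : (u, w) ∈ knownEdges Γ v (r + 1) := ⟨r, le_rfl, hu, huw⟩
    rw [h] at this
    exact this.choose_spec.2.2
  intro u hu w
  refine ⟨key h u hu w, key h.symm u ?_ w⟩
  suffices ∀ s ≤ r, ∀ u ∈ Γ.walkBall v s, u ∈ Γ'.walkBall v s from this _ le_rfl u hu
  intro s
  induction s with
  | zero => intro _ u hu; rw [SimpleGraph.mem_walkBall_zero] at hu ⊢; exact hu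
  | succ s ih =>
    intro hs u hu
    rcases SimpleGraph.mem_walkBall_succ'.mp hu with rfl | ⟨w, hw, hwu⟩
    · exact SimpleGraph.self_mem_walkBall _ _
    · exact SimpleGraph.mem_walkBall_succ'.mpr (Or.inr ⟨w, ih (by omega) w hw,
        key h w (SimpleGraph.walkBall_mono (by omega) hw) u hwu⟩)

theorem input_eq_of_knownInputs_eq {I : Type} {Γ Γ' : SimpleGraph ℕ} {x x' : ℕ → I} {v r : ℕ}
    (h : knownInputs Γ x v r = knownInputs Γ' x' v r) :
    ∀ u ∈ Γ.walkBall v r, x u = x' u := by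
  intro u hu
  have : (u, x u) ∈ knownInputs Γ x v r := ⟨hu, rfl⟩
  rw [h] at this
  exact this.2

namespace LocalAlgorithm

variable {I O : Type} [Inhabited O]

open Classical in
/-- The algorithm that collects all information within distance `r n` and then evaluates `F` on
some network of the class `P` that looks like the one observed. -/
noncomputable def ofLocal (r : ℕ → ℕ) (P : ℕ → SimpleGraph ℕ → (ℕ → I) → Prop)
    (F : ℕ → SimpleGraph ℕ → (ℕ → I) → ℕ → O) : LocalAlgorithm I O where
  State := ℕ × ℕ × Set (ℕ × I) × Set (ℕ × ℕ)
  Message := ℕ × ℕ × Set (ℕ × I) × Set (ℕ × ℕ)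
  init n i x := (n, i, {(i, x)}, ∅)
  send σ _ := σ
  receive σ M := (σ.1, σ.2.1, σ.2.2.1 ∪ {p | ∃ m ∈ M, p ∈ m.2.2.2.1},
    σ.2.2.2 ∪ {e | ∃ m ∈ M, e ∈ m.2.2.2.2} ∪ {e | ∃ m ∈ M, e = (σ.2.1, m.1)})
  rounds := r
  -- The default is irrelevant on networks of the class, where the actual network fits the view.
  output σ := if h : ∃ X : SimpleGraph ℕ × (ℕ → I), P σ.1 X.1 X.2 ∧
      knownInputs X.1 X.2 σ.2.1 (r σ.1) = σ.2.2.1 ∧ knownEdges X.1 σ.2.1 (r σ.1) = σ.2.2.2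
    then F σ.1 h.choose.1 h.choose.2 σ.2.1 else default

/-- Nodes are replaced by their identifiers, which puts all networks on the vertex set ℕ and makes
views in different networks comparable. The recursions for the known inputs and edges mirror one
round of `receive`. -/
theorem stateAfter_ofLocal (r : ℕ → ℕ) (P : ℕ → SimpleGraph ℕ → (ℕ → I) → Prop)
    (F : ℕ → SimpleGraph ℕ → (ℕ → I) → ℕ → O) {V : Type*} [Fintype V] (G : SimpleGraph V)
    (ident : V ↪ ℕ) (x : ℕ → I) (t : ℕ) (v : V) :
    (ofLocal r P F).stateAfter G ident (fun v => x (ident v)) t v =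
      (Fintype.card V, ident v, knownInputs (G.map ident) x (ident v) t,
        knownEdges (G.map ident) (ident v) t) := by
  have adj : ∀ v j, (G.map ident).Adj (ident v) j ↔ ∃ u, G.Adj v u ∧ j = ident u := by
    intro v j
    rw [SimpleGraph.map_adj]
    constructor
    · rintro ⟨a, b, h, ha, rfl⟩
      exact ⟨b, ident.injective ha ▸ h, rfl⟩
    · rintro ⟨u, h, rfl⟩
      exact ⟨v, u, h, rfl, rfl⟩
  induction t generalizing v with
  | zero =>
    simp only [stateAfter, ofLocal, Prod.mk.injEq, true_and]
    constructor
    · ext ⟨a, b⟩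
      simp only [knownInputs, Set.mem_ofPred_eq, SimpleGraph.mem_walkBall_zero,
        Set.mem_singleton_iff, Prod.mk.injEq]
      constructor
      · rintro ⟨rfl, rfl⟩; exact ⟨rfl, rfl⟩
      · rintro ⟨rfl, rfl⟩; exact ⟨rfl, rfl⟩
    · ext e
      simp [knownEdges]
  | succ t ih =>
    rw [stateAfter]
    simp only [ih]
    rw [knownInputs_succ, knownEdges_succ]
    simp only [ofLocal, Prod.mk.injEq, true_and]
    constructor
    · congr 1
      ext p
      simp only [Set.mem_ofPred_eq, adj]
      constructor
      · rintro ⟨m, ⟨u, hu, rfl⟩, hp⟩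
        exact ⟨_, ⟨u, hu, rfl⟩, hp⟩
      · rintro ⟨_, ⟨u, hu, rfl⟩, hp⟩
        exact ⟨_, ⟨u, hu, rfl⟩, hp⟩
    · congr 1
      · congr 1
        ext p
        simp only [Set.mem_ofPred_eq, adj]
        constructor
        · rintro ⟨m, ⟨u, hu, rfl⟩, hp⟩
          exact ⟨_, ⟨u, hu, rfl⟩, hp⟩
        · rintro ⟨_, ⟨u, hu, rfl⟩, hp⟩
          exact ⟨_, ⟨u, hu, rfl⟩, hp⟩
      · ext p
        simp only [Set.mem_ofPred_eq, adj]
        constructor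
        · rintro ⟨m, ⟨u, hu, rfl⟩, hp⟩
          exact ⟨_, ⟨u, hu, rfl⟩, hp⟩
        · rintro ⟨_, ⟨u, hu, rfl⟩, hp⟩
          exact ⟨_, ⟨u, hu, rfl⟩, hp⟩

/-- If `F` is determined on the class `P` by the information within distance `r n`, then the
full-information algorithm computes `F`. -/
theorem run_ofLocal {r : ℕ → ℕ} {P : ℕ → SimpleGraph ℕ → (ℕ → I) → Prop}
    {F : ℕ → SimpleGraph ℕ → (ℕ → I) → ℕ → O} {V : Type*} [Fintype V]
    (hF : ∀ Γ x Γ' x' v, P (Fintype.card V) Γ x → P (Fintype.card V) Γ' x' →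
      knownInputs Γ x v (r (Fintype.card V)) = knownInputs Γ' x' v (r (Fintype.card V)) →
      knownEdges Γ v (r (Fintype.card V)) = knownEdges Γ' v (r (Fintype.card V)) →
      F (Fintype.card V) Γ x v = F (Fintype.card V) Γ' x' v)
    (G : SimpleGraph V) (ident : V ↪ ℕ) (x : ℕ → I)
    (hP : P (Fintype.card V) (G.map ident) x) (v : V) :
    (ofLocal r P F).run G ident (fun v => x (ident v)) v =
      F (Fintype.card V) (G.map ident) x (ident v) := by
  have h : ∃ X : SimpleGraph ℕ × (ℕ → I), P (Fintype.card V) X.1 X.2 ∧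
      knownInputs X.1 X.2 (ident v) (r (Fintype.card V)) =
        knownInputs (G.map ident) x (ident v) (r (Fintype.card V)) ∧
      knownEdges X.1 (ident v) (r (Fintype.card V)) =
        knownEdges (G.map ident) (ident v) (r (Fintype.card V)) := ⟨(_, _), hP, rfl, rfl⟩
  rw [run, stateAfter_ofLocal]
  simp only [ofLocal]
  rw [dif_pos h]
  exact hF _ _ _ _ _ h.choose_spec.1 hP h.choose_spec.2.1 h.choose_spec.2.2

end LocalAlgorithm

/-! ### Clusterings with connected clusters -/

namespace SimpleGraph

variable {V : Type*}

/-- The edges of `Γ` inside the classes of `L`. -/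
def intra {ι : Type*} (Γ : SimpleGraph V) (L : V → ι) : SimpleGraph V where
  Adj u w := Γ.Adj u w ∧ L u = L w
  symm := ⟨fun _ _ h => ⟨h.1.symm, h.2.symm⟩⟩
  loopless := ⟨fun _ h => Γ.loopless.irrefl _ h.1⟩

theorem intra_le {ι : Type*} (Γ : SimpleGraph V) (L : V → ι) : Γ.intra L ≤ Γ := fun _ _ h => h.1

theorem eq_of_reachable_intra {ι : Type*} {Γ : SimpleGraph V} {L : V → ι} {u w : V}
    (h : (Γ.intra L).Reachable u w) : L u = L w := by
  obtain ⟨p⟩ := h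
  induction p with
  | nil => rfl
  | cons h _ ih => exact h.2.trans ih

/-- `L` sends every vertex to the leader of its cluster, and the clusters are connected. -/
structure IsClustering (Γ : SimpleGraph V) (L : V → V) : Prop where
  idem : ∀ v, L (L v) = L v
  reach : ∀ v, (Γ.intra L).Reachable v (L v)

namespace IsClustering

variable {Γ : SimpleGraph V} {L : V → V}

theorem reachable (hL : Γ.IsClustering L) {u w : V} (h : L u = L w) :
    (Γ.intra L).Reachable u w :=
  (hL.reach u).trans (h ▸ (hL.reach w).symm)

/-- A path inside the cluster that is longer than `M` would have `M` distinct vertices in the ball.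
Only vertices inside the ball are counted, so the lemma applies before the whole cluster is known to
be small. -/
theorem mem_walkBall_of_encard_lt (hL : Γ.IsClustering L) {v u : V} {M : ℕ}
    (hM : ({w | L w = L v} ∩ Γ.walkBall v M).encard < M) (hu : L u = L v) :
    u ∈ Γ.walkBall v M := by
  classical
  obtain ⟨p⟩ := hL.reachable hu.symm
  by_cases hp : p.toPath.1.length ≤ M
  · exact mem_walkBall_of_le (Γ.intra_le L) ⟨_, hp⟩
  · exfalso
    have hinj := p.toPath.2.getVert_injOn
    set q := p.toPath.1
    have hsub : ((Finset.range M).image q.getVert : Set V) ⊆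
        {w | L w = L v} ∩ Γ.walkBall v M := by
      intro w hw
      simp only [Finset.coe_image, Finset.coe_range, Set.mem_image, Set.mem_Iio] at hw
      obtain ⟨i, hi, rfl⟩ := hw
      refine ⟨(eq_of_reachable_intra ⟨q.take i⟩).symm, mem_walkBall_of_le (Γ.intra_le L)
        ⟨q.take i, ?_⟩⟩
      rw [Walk.take_length]
      omega
    have hcard : ((Finset.range M).image q.getVert).card = M := by
      rw [Finset.card_image_of_injOn, Finset.card_range]
      intro i hi j hj hij
      simp only [Finset.coe_range, Set.mem_Iio] at hi hj
      exact hinj (by simp; omega) (by simp; omega) hij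
    have := Set.encard_le_encard hsub
    rw [Set.encard_coe_eq_coe_finsetCard, hcard] at this
    exact absurd hM (not_lt.mpr this)

theorem mem_walkBall_of_encard_lt' (hL : Γ.IsClustering L) {v u : V} {M : ℕ}
    (hM : {w | L w = L v}.encard < M) (hu : L u = L v) : u ∈ Γ.walkBall v M :=
  hL.mem_walkBall_of_encard_lt ((Set.encard_le_encard Set.inter_subset_left).trans_lt hM) hu

end IsClustering

end SimpleGraph

/-! ### Cole–Vishkin colour reduction -/

/-- The Cole–Vishkin step: the first position where `a` differs from `b`, and the bit of `a`
there. -/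
noncomputable def coleVishkin (a b : ℕ) : ℕ :=
  2 * sInf {i | a.testBit i ≠ b.testBit i} + (a.testBit (sInf {i | a.testBit i ≠ b.testBit i})).toNat

/-- Equal values would mean the same position and the same bit there, but `a` and `b` differ at that
position. Nothing is needed about `c`, so the end of a pointer path may use any successor colour. -/
theorem coleVishkin_ne {a b c : ℕ} (hab : a ≠ b) : coleVishkin a b ≠ coleVishkin b c := by
  intro h
  have hne : {i | a.testBit i ≠ b.testBit i}.Nonempty := Nat.exists_testBit_ne_of_ne hab
  have hmem := Nat.sInf_mem hne
  unfold coleVishkin at h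
  set i := sInf {i | a.testBit i ≠ b.testBit i}
  set j := sInf {i | b.testBit i ≠ c.testBit i}
  have hi := Bool.toNat_le (a.testBit i)
  have hj := Bool.toNat_le (b.testBit j)
  have hij : i = j := by omega
  rw [← hij] at h
  have : (a.testBit i).toNat = (b.testBit i).toNat := by omega
  exact hmem (by cases h1 : a.testBit i <;> cases h2 : b.testBit i <;> simp_all)

theorem coleVishkin_lt {a b m : ℕ} (hab : a ≠ b) (ha : a < 2 ^ m) (hb : b < 2 ^ m) :
    coleVishkin a b < 2 ^ Nat.clog 2 (2 * m) := by
  have hne : {i | a.testBit i ≠ b.testBit i}.Nonempty := Nat.exists_testBit_ne_of_ne hab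
  have hmem := Nat.sInf_mem hne
  unfold coleVishkin
  set i := sInf {i | a.testBit i ≠ b.testBit i}
  have him : i < m := by
    by_contra h
    have : 2 ^ m ≤ 2 ^ i := Nat.pow_le_pow_right (by norm_num) (by omega)
    exact hmem (by rw [Nat.testBit_lt_two_pow (by omega), Nat.testBit_lt_two_pow (by omega)])
  have hi := Bool.toNat_le (a.testBit i)
  have := Nat.le_pow_clog (b := 2) (by norm_num) (2 * m)
  omega

/-- After `log* n` steps, `m ↦ ⌈log₂ (2 m)⌉` has brought down a multiple of `log n` to a
constant. -/
theorem iterate_clog_le {j : ℕ} (hj : 2 ≤ j) (n : ℕ) (hn : 2 ≤ n) (m : ℕ)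
    (hm : m ≤ 2 ^ j * Nat.clog 2 n) :
    (fun m => Nat.clog 2 (2 * m))^[logStar n] m ≤ 2 ^ j := by
  -- With y = ⌈log₂⌈log₂ n⌉⌉ ≥ 1, one step gives at most 1 + j + y ≤ (j + 2) y ≤ 2 ^ j y, so the
  -- hypothesis on `m` is preserved. When ⌈log₂ n⌉ = 1, the last step ends at 1 + j.
  have hj2 : j + 2 ≤ 2 ^ j := by
    induction j, hj using Nat.le_induction with
    | base => norm_num
    | succ j hj ih =>
      have : j + 2 ≤ 2 ^ j := by
        clear ih hm
        induction j, hj using Nat.le_induction with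
        | base => norm_num
        | succ j hj ih => rw [pow_succ]; omega
      rw [pow_succ]; omega
  have step : ∀ y, 1 ≤ y → Nat.clog 2 (2 * (2 ^ j * y)) ≤ 1 + j + Nat.clog 2 y := by
    intro y _
    apply Nat.clog_le_of_le_pow
    rw [pow_add, pow_add]
    have := Nat.le_pow_clog (b := 2) (by norm_num) y
    calc 2 * (2 ^ j * y) ≤ 2 * (2 ^ j * 2 ^ Nat.clog 2 y) := by gcongr
      _ = _ := by ring
  induction n using Nat.strong_induction_on generalizing m with
  | _ n ih =>
    have hclog : 1 ≤ Nat.clog 2 n := Nat.clog_pos (by norm_num) hn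
    have hstep : Nat.clog 2 (2 * m) ≤ 1 + j + Nat.clog 2 (Nat.clog 2 n) :=
      (Nat.clog_mono_right 2 (by gcongr)).trans (step _ hclog)
    have hlog : logStar n = logStar (Nat.clog 2 n) + 1 := by
      rw [logStar, dif_neg (by omega)]
    rw [hlog, Function.iterate_succ_apply]
    rcases eq_or_lt_of_le hclog with h1 | h1
    · rw [← h1] at hstep ⊢
      rw [logStar, dif_pos le_rfl]
      simp only [Nat.clog_one_right, Function.iterate_zero, id_eq] at hstep ⊢
      omega
    · have hlt : Nat.clog 2 n < n := by
        have h1 : n ≤ 2 ^ (n - 1) := by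
          have := (n - 1).lt_two_pow_self
          omega
        have h2 := Nat.clog_le_of_le_pow h1
        omega
      refine ih _ hlt h1 _ (hstep.trans ?_)
      have hc : 1 ≤ Nat.clog 2 (Nat.clog 2 n) := Nat.clog_pos (by norm_num) h1
      calc 1 + j + Nat.clog 2 (Nat.clog 2 n) ≤ (j + 2) * Nat.clog 2 (Nat.clog 2 n) := by nlinarith
        _ ≤ _ := by gcongr

/-- A sequence of few colours without consecutive repetitions has a strict local maximum early on,
here at `j + 1`. -/
theorem exists_local_max {K : ℕ} {c : ℕ → ℕ} (hK : ∀ j ≤ 2 * K, c j < K)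
    (hne : ∀ j < 2 * K, c j ≠ c (j + 1)) : ∃ j, j + 2 ≤ 2 * K ∧ c j < c (j + 1) ∧
      c (j + 2) < c (j + 1) := by
  by_contra! hmax
  -- Without a local maximum, an ascent never stops. An ascent that starts in the first `K` steps
  -- therefore runs out of colours, and so does a descent through all of these steps.
  by_cases hinc : ∃ j < K, c j < c (j + 1)
  · obtain ⟨j, hj, hlt⟩ := hinc
    have : ∀ i, j + i + 1 ≤ 2 * K → c (j + i) < c (j + i + 1) ∧ i ≤ c (j + i) := by
      intro i
      induction i with
      | zero => intro _; exact ⟨hlt, Nat.zero_le _⟩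
      | succ i ih =>
        intro h
        obtain ⟨h1, h2⟩ := ih (by omega)
        have h3 := hmax (j + i) (by omega) h1
        have h4 := hne (j + i + 1) (by omega)
        exact ⟨lt_of_le_of_ne h3 h4, by rw [← add_assoc]; omega⟩
    have h1 := this (K - 1) (by omega)
    have h2 := hK (j + (K - 1) + 1) (by omega)
    omega
  · push Not at hinc
    have : ∀ i ≤ K, c i + i ≤ c 0 := by
      intro i
      induction i with
      | zero => intro _; simp
      | succ i ih =>
        intro h
        have h1 := ih (by omega)
        have h2 := hinc i (by omega)
        have h3 := hne i (by omega)
        omega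
    have h1 := this K le_rfl
    have h2 := hK 0 (by omega)
    omega

/-! ### One phase of merging small clusters -/

namespace ClusterPhase

variable (Γ : SimpleGraph ℕ) (L : ℕ → ℕ) (M : ℕ)

/-- The leaders of the clusters adjacent to the cluster of `l`. -/
def outLeaders (l : ℕ) : Set ℕ :=
  {y | y ≠ l ∧ ∃ u w, L u = l ∧ Γ.Adj u w ∧ L w = y}

/-- The cluster of `l` has fewer than `M` vertices and some edge leaves it. -/
def IsSmall (l : ℕ) : Prop :=
  {u | L u = l}.encard < M ∧ (outLeaders Γ L l).Nonempty

open Classical in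
/-- Small clusters point to an adjacent cluster. -/
noncomputable def next (l : ℕ) : ℕ :=
  if IsSmall Γ L M l then sInf (outLeaders Γ L l) else l

open Classical in
/-- The colours of the leaders after `t` Cole–Vishkin steps. -/
noncomputable def color : ℕ → ℕ → ℕ
  | 0, l => l
  | t + 1, l => coleVishkin (color t l)
      -- A cluster without a pointer uses 0 or 1 as successor colour, whichever differs from its
      -- own.
      (if IsSmall Γ L M l then color t (next Γ L M l) else if color t l = 0 then 1 else 0)

/-- The clusters that are not merged into the one they point to. -/
def IsCenter (τ l : ℕ) : Prop :=
  -- A predecessor of smaller colour is not a center itself and points here, so a small center is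
  -- certain to absorb another cluster.
  ¬ IsSmall Γ L M l ∨ (color Γ L M τ (next Γ L M l) < color Γ L M τ l ∧
    ∃ y, IsSmall Γ L M y ∧ next Γ L M y = l ∧ color Γ L M τ y < color Γ L M τ l)

open Classical in
/-- The first center on the path of pointers that starts in `l`. -/
noncomputable def center (τ l : ℕ) : ℕ :=
  if h : ∃ j, IsCenter Γ L M τ ((next Γ L M)^[j] l) then (next Γ L M)^[Nat.find h] l else l

variable {Γ L M}

open Classical in
theorem center_of_isCenter {τ l : ℕ} (h : IsCenter Γ L M τ l) : center Γ L M τ l = l := by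
  have h' : ∃ j, IsCenter Γ L M τ ((next Γ L M)^[j] l) := ⟨0, h⟩
  have : Nat.find h' = 0 := by rw [Nat.find_eq_zero]; exact h
  rw [center, dif_pos h', this]
  rfl

open Classical in
theorem center_of_not_isCenter {τ l : ℕ} (h : ¬ IsCenter Γ L M τ l)
    (hex : ∃ j, IsCenter Γ L M τ ((next Γ L M)^[j] l)) :
    center Γ L M τ l = center Γ L M τ (next Γ L M l) := by
  have h2 : ∃ j, IsCenter Γ L M τ ((next Γ L M)^[j + 1] l) := by
    obtain ⟨j, hj⟩ := hex
    cases j with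
    | zero => exact absurd hj h
    | succ j => exact ⟨j, hj⟩
  have h3 : ∃ j, IsCenter Γ L M τ ((next Γ L M)^[j] (next Γ L M l)) := h2
  rw [center, center, dif_pos hex, dif_pos h3, Nat.find_comp_succ hex h2 h]
  rfl

open Classical in
theorem isCenter_center {τ l : ℕ} (hex : ∃ j, IsCenter Γ L M τ ((next Γ L M)^[j] l)) :
    IsCenter Γ L M τ (center Γ L M τ l) := by
  rw [center, dif_pos hex]
  exact Nat.find_spec hex

theorem next_mem {l : ℕ} (h : IsSmall Γ L M l) : next Γ L M l ∈ outLeaders Γ L l := by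
  rw [next, if_pos h]
  exact Nat.sInf_mem h.2

theorem next_of_not_isSmall {l : ℕ} (h : ¬ IsSmall Γ L M l) : next Γ L M l = l := by
  rw [next, if_neg h]

theorem not_isCenter_iff {τ l : ℕ} : ¬ IsCenter Γ L M τ l ↔ IsSmall Γ L M l ∧
    ¬ (color Γ L M τ (next Γ L M l) < color Γ L M τ l ∧
      ∃ y, IsSmall Γ L M y ∧ next Γ L M y = l ∧ color Γ L M τ y < color Γ L M τ l) := by
  rw [IsCenter, not_or, not_not]

theorem isSmall_idem (hL : Γ.IsClustering L) {l : ℕ} (h : IsSmall Γ L M l) : L l = l := by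
  obtain ⟨_, _, u, _, rfl, _⟩ := h.2
  exact hL.idem u

theorem next_idem (hL : Γ.IsClustering L) {l : ℕ} (h : L l = l) :
    L (next Γ L M l) = next Γ L M l := by
  by_cases hs : IsSmall Γ L M l
  · obtain ⟨_, _, w, _, _, hw⟩ := next_mem hs
    rw [← hw, hL.idem]
  · rwa [next_of_not_isSmall hs]

theorem next_iterate_idem (hL : Γ.IsClustering L) {l : ℕ} (h : L l = l) (j : ℕ) :
    L ((next Γ L M)^[j] l) = (next Γ L M)^[j] l := by
  induction j generalizing l with
  | zero => exact h
  | succ j ih => exact ih (next_idem hL h)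

theorem color_ne (t : ℕ) {l : ℕ} (h : IsSmall Γ L M l) :
    color Γ L M t l ≠ color Γ L M t (next Γ L M l) := by
  classical
  induction t generalizing l with
  | zero => exact fun h' => (next_mem h).1 h'.symm
  | succ t ih =>
    rw [color, color, if_pos h]
    exact coleVishkin_ne (ih h)

section Merge

variable {τ J ρ : ℕ} (hL : Γ.IsClustering L)
  (hex : ∀ v, ∃ j ≤ J, IsCenter Γ L M τ ((next Γ L M)^[j] (L v)))

include hL hex

open Classical in
theorem center_idem (v : ℕ) : L (center Γ L M τ (L v)) = center Γ L M τ (L v) := by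
  obtain ⟨j, -, hj⟩ := hex v
  have h : ∃ j, IsCenter Γ L M τ ((next Γ L M)^[j] (L v)) := ⟨j, hj⟩
  rw [center, dif_pos h]
  exact next_iterate_idem hL (hL.idem v) _

theorem exists_step {v : ℕ} (hv : ¬ IsCenter Γ L M τ (L v)) :
    ∃ u w, L u = L v ∧ u ∈ Γ.walkBall v M ∧ Γ.Adj u w ∧ L w = next Γ L M (L v) ∧
      center Γ L M τ (L v) = center Γ L M τ (L w) := by
  have hs := (not_isCenter_iff.mp hv).1
  obtain ⟨_, u, w, hu, huw, hw⟩ := next_mem hs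
  obtain ⟨j, -, hj⟩ := hex v
  exact ⟨u, w, hu, hL.mem_walkBall_of_encard_lt' hs.1 hu, huw, hw,
    hw ▸ center_of_not_isCenter hv ⟨j, hj⟩⟩

/-- Following the pointers towards the center, each step crosses an edge between two clusters with
the same center. -/
theorem isClustering_center : Γ.IsClustering fun v => center Γ L M τ (L v) := by
  refine ⟨fun v => ?_, fun v => ?_⟩
  · obtain ⟨j, -, hj⟩ := hex v
    rw [center_idem hL hex v]
    exact center_of_isCenter (isCenter_center ⟨j, hj⟩)
  · have hle : Γ.intra L ≤ Γ.intra fun v => center Γ L M τ (L v) :=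
      fun a b h => ⟨h.1, congrArg _ h.2⟩
    obtain ⟨j, -, hj⟩ := hex v
    induction j generalizing v with
    | zero =>
      change IsCenter Γ L M τ (L v) at hj
      simp only [center_of_isCenter hj]
      exact (hL.reach v).mono hle
    | succ j ih =>
      by_cases hv : IsCenter Γ L M τ (L v)
      · simp only [center_of_isCenter hv]
        exact (hL.reach v).mono hle
      · obtain ⟨u, w, hu, _, huw, hw, hc⟩ := exists_step hL hex hv
        have h1 : (Γ.intra fun v => center Γ L M τ (L v)).Adj u w := ⟨huw, by simp only [hu, hc]⟩
        have h2 := ih w (by rw [hw]; exact hj)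
        simp only [hc]
        exact ((hL.reachable hu.symm).mono hle).trans (h1.reachable.trans h2)

/-- Each of at most `J` pointers costs a path through a small cluster and one edge, that is `M + 1`.
The old radius `ρ` is paid only once, in the final cluster, so the radius grows additively from
phase to phase. -/
theorem center_mem_walkBall (hρ : ∀ v, L v ∈ Γ.walkBall v ρ) (v : ℕ) :
    center Γ L M τ (L v) ∈ Γ.walkBall v (J * (M + 1) + ρ) := by
  suffices ∀ j v, IsCenter Γ L M τ ((next Γ L M)^[j] (L v)) →
      center Γ L M τ (L v) ∈ Γ.walkBall v (j * (M + 1) + ρ) by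
    obtain ⟨j, hj, h⟩ := hex v
    exact SimpleGraph.walkBall_mono (by gcongr) (this j v h)
  intro j
  induction j with
  | zero =>
    intro v hj
    change IsCenter Γ L M τ (L v) at hj
    rw [center_of_isCenter hj]
    exact SimpleGraph.walkBall_mono (by omega) (hρ v)
  | succ j ih =>
    intro v hj
    by_cases hv : IsCenter Γ L M τ (L v)
    · rw [center_of_isCenter hv]
      exact SimpleGraph.walkBall_mono (by omega) (hρ v)
    · obtain ⟨u, w, hu, hvu, huw, hw, hc⟩ := exists_step hL hex hv
      rw [hc]
      have h2 := ih w (by rw [hw]; exact hj)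
      have h3 := SimpleGraph.mem_walkBall_trans
        (SimpleGraph.mem_walkBall_trans hvu huw.mem_walkBall_one) h2
      exact SimpleGraph.walkBall_mono (by rw [Nat.succ_mul]; omega) h3

/-- A small center absorbs its predecessor `y`, and both have at least `M₀` vertices because some
edge leaves each of them. A center that is not small has `M` vertices already or is a component. -/
theorem center_large {M₀ : ℕ} (hM : M ≤ 2 * M₀)
    (hlarge : ∀ v, (M₀ : ℕ∞) ≤ {u | L u = L v}.encard ∨
      ∀ u w, L u = L v → Γ.Adj u w → L w = L v) (v : ℕ) :
    (M : ℕ∞) ≤ {u | center Γ L M τ (L u) = center Γ L M τ (L v)}.encard ∨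
      ∀ u w, center Γ L M τ (L u) = center Γ L M τ (L v) → Γ.Adj u w →
        center Γ L M τ (L w) = center Γ L M τ (L v) := by
  have hcl := isClustering_center hL hex
  have hidem := center_idem hL hex v
  have hc : IsCenter Γ L M τ (center Γ L M τ (L v)) := by
    obtain ⟨j, -, hj⟩ := hex v
    exact isCenter_center ⟨j, hj⟩
  set l := center Γ L M τ (L v) with hl
  have hcl_l : center Γ L M τ l = l := center_of_isCenter hc
  have hsub : {u | L u = l} ⊆ {u | center Γ L M τ (L u) = l} := by
    intro u hu
    simp only [Set.mem_ofPred_eq] at hu ⊢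
    rw [hu, hcl_l]
  by_cases hs : IsSmall Γ L M l
  · left
    obtain ⟨h1, y, hy, hyl, hyc⟩ := hc.resolve_left (not_not.mpr hs)
    have large : ∀ y, IsSmall Γ L M y → (M₀ : ℕ∞) ≤ {u | L u = y}.encard := by
      intro y hy
      have hLy := isSmall_idem hL hy
      rcases hlarge y with h | h
      · rwa [hLy] at h
      · obtain ⟨z, hz, u, w, hu, huw, hw⟩ := hy.2
        exact absurd (hw.symm.trans ((h u w (hu.trans hLy.symm) huw).trans hLy)) hz
    have hyne : y ≠ l := by rintro rfl; exact lt_irrefl _ hyc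
    have hync : ¬ IsCenter Γ L M τ y := by
      rw [not_isCenter_iff]
      refine ⟨hy, fun h => ?_⟩
      rw [hyl] at h
      exact absurd h.1 (not_lt.mpr hyc.le)
    have hcy : center Γ L M τ y = l := by
      have hLy := isSmall_idem hL hy
      obtain ⟨j, -, hj⟩ := hex y
      rw [hLy] at hj
      rw [center_of_not_isCenter hync ⟨j, hj⟩, hyl, hcl_l]
    have hsub2 : {u | L u = y} ⊆ {u | center Γ L M τ (L u) = l} := by
      intro u hu
      simp only [Set.mem_ofPred_eq] at hu ⊢
      rw [hu, hcy]
    have hdisj : Disjoint {u | L u = l} {u | L u = y} := by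
      rw [Set.disjoint_left]
      intro u h1 h2
      exact hyne (h2.symm.trans h1)
    have := Set.encard_le_encard (Set.union_subset hsub hsub2)
    rw [Set.encard_union_eq hdisj] at this
    calc (M : ℕ∞) ≤ ((2 * M₀ : ℕ) : ℕ∞) := by exact_mod_cast hM
      _ = M₀ + M₀ := by push_cast; ring
      _ ≤ _ := add_le_add (large _ hs) (large _ hy)
      _ ≤ _ := this
  · by_cases hM' : (M : ℕ∞) ≤ {u | L u = l}.encard
    · exact Or.inl (hM'.trans (Set.encard_le_encard hsub))
    · right
      -- Not small, yet with fewer than `M` vertices: no edge leaves this cluster, so nothing merges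
      -- into it either.
      have hclosed : ∀ u w, L u = l → Γ.Adj u w → L w = l := by
        intro u w hu huw
        by_contra hw
        exact hs ⟨not_le.mp hM', L w, hw, u, w, hu, huw, rfl⟩
      have hreach : ∀ u w, Γ.Reachable u w → L u = l → L w = l := by
        rintro u w ⟨p⟩
        induction p with
        | nil => exact id
        | cons h _ ih => exact fun hu => ih (hclosed _ _ hu h)
      intro u w hu huw
      have h1 : Γ.Reachable l u := by
        refine ((hcl.reachable (u := l) (w := u) ?_).mono (Γ.intra_le _))
        simp only [hidem, hcl_l, hu]
      have h2 := hclosed u w (hreach _ _ h1 hidem) huw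
      rw [h2, hcl_l]

end Merge

section Color

variable {N m₀ : ℕ} (hL : Γ.IsClustering L) (hN : ∀ u w, Γ.Adj u w → u < N)

include hL hN

theorem leader_lt {v : ℕ} (hv : v < N) : L v < N := by
  obtain ⟨p⟩ := (hL.reach v).symm
  generalize L v = l at p
  cases p with
  | nil => exact hv
  | cons h _ => exact hN _ _ h.1

theorem next_lt {l : ℕ} (hl : l < N) : next Γ L M l < N := by
  by_cases hs : IsSmall Γ L M l
  · obtain ⟨_, u, w, _, huw, hw⟩ := next_mem hs
    rw [← hw]
    exact leader_lt hL hN (hN _ _ huw.symm)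
  · rwa [next_of_not_isSmall hs]

/-- Positivity of the exponent is carried along because the dummy colours 0 and 1 must also obey the
bound. -/
theorem color_lt (hm : N ≤ 2 ^ m₀) (hm₀ : 0 < m₀) (t : ℕ) {l : ℕ} (hl : l < N) :
    color Γ L M t l < 2 ^ (fun m => Nat.clog 2 (2 * m))^[t] m₀ ∧
      0 < (fun m => Nat.clog 2 (2 * m))^[t] m₀ := by
  classical
  induction t generalizing l with
  | zero => exact ⟨hl.trans_le hm, hm₀⟩
  | succ t ih =>
    rw [Function.iterate_succ_apply', color]
    obtain ⟨h1, h2⟩ := ih hl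
    refine ⟨coleVishkin_lt ?_ h1 ?_, Nat.clog_pos (by norm_num) (by omega)⟩
    · split_ifs with hs h0
      · exact color_ne t hs
      · omega
      · exact h0
    · have : 2 ≤ 2 ^ ((fun m => Nat.clog 2 (2 * m))^[t] m₀) := by
        calc 2 = 2 ^ 1 := rfl
          _ ≤ _ := Nat.pow_le_pow_right (by norm_num) h2
      split_ifs with hs h0
      · exact (ih (next_lt hL hN hl)).1
      · omega
      · omega

/-- A pointer path that avoids centers runs through small clusters only. Its colours are below `K`
and change at every step, so it has an early local maximum, which is a center. -/
theorem exists_isCenter (hm : N ≤ 2 ^ m₀) (hm₀ : 0 < m₀) {τ K : ℕ}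
    (hK : 2 ^ (fun m => Nat.clog 2 (2 * m))^[τ] m₀ ≤ K) (v : ℕ) :
    ∃ j ≤ 2 * K, IsCenter Γ L M τ ((next Γ L M)^[j] (L v)) := by
  by_contra! h
  have hsmall : ∀ j ≤ 2 * K, IsSmall Γ L M ((next Γ L M)^[j] (L v)) :=
    fun j hj => (not_isCenter_iff.mp (h j hj)).1
  have hlt : ∀ j, (next Γ L M)^[j] (L v) < N := by
    intro j
    induction j with
    | zero =>
      obtain ⟨_, _, u, w, hu, huw, _⟩ := (hsmall 0 (Nat.zero_le _)).2
      have := leader_lt hL hN (hN _ _ huw)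
      rwa [hu] at this
    | succ j ih =>
      rw [Function.iterate_succ_apply']
      exact next_lt hL hN ih
  obtain ⟨j, hj, h1, h2⟩ := exists_local_max (K := K)
    (c := fun j => color Γ L M τ ((next Γ L M)^[j] (L v)))
    (fun j _ => ((color_lt hL hN hm hm₀ τ (hlt j)).1).trans_le hK)
    (fun j hj => by
      simp only [Function.iterate_succ_apply']
      exact color_ne τ (hsmall j hj.le))
  simp only [Function.iterate_succ_apply'] at h1 h2
  refine h (j + 1) (by omega) (Or.inr ?_)
  simp only [Function.iterate_succ_apply']
  exact ⟨h2, _, hsmall j (by omega), rfl, h1⟩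

end Color

/-! ### Locality of a merging phase -/

section Agree

variable {Γ' : SimpleGraph ℕ} {L' : ℕ → ℕ} {T ρ : ℕ}

/-- A small cluster lies within `M` of its leader and its outgoing edges end within `M + 1`, where
both labellings coincide. For `L'` smallness is not yet known, so only its part inside the ball is
counted. -/
theorem isSmall_of_agreeOn (hL' : Γ'.IsClustering L')
    (hL : Γ.IsClustering L)
    (hLL : ∀ u, Γ.AgreeOn Γ' u T → L u = L' u) {l : ℕ} (hl : L l = l)
    (h : Γ.AgreeOn Γ' l (T + M + 1)) (hs : IsSmall Γ L M l) :
    IsSmall Γ' L' M l ∧ outLeaders Γ L l = outLeaders Γ' L' l := by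
  have heq : ∀ u ∈ Γ.walkBall l (M + 1), L u = L' u := fun u hu =>
    hLL u (h.shift hu (by omega))
  have hl' : L' l = l := (heq l (SimpleGraph.self_mem_walkBall _ _)).symm.trans hl
  have hball : ∀ u, u ∈ Γ.walkBall l M ↔ u ∈ Γ'.walkBall l M :=
    fun u => h.mem_walkBall_iff (by omega)
  have hcl : ∀ u, L u = l → u ∈ Γ.walkBall l M := by
    intro u hu
    refine hL.mem_walkBall_of_encard_lt' ?_ (hu.trans hl.symm)
    rw [hl]
    exact hs.1
  have hcl' : ∀ u, L' u = l → u ∈ Γ'.walkBall l M := by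
    intro u hu
    refine hL'.mem_walkBall_of_encard_lt ?_ (hu.trans hl'.symm)
    refine (Set.encard_le_encard ?_).trans_lt hs.1
    rintro w ⟨hw, hw'⟩
    have h1 := (hball w).mpr hw'
    simp only [Set.mem_ofPred_eq] at hw ⊢
    rw [heq w (SimpleGraph.walkBall_mono (by omega) h1), hw, hl']
  have hclus : ∀ u, L u = l ↔ L' u = l := by
    intro u
    constructor
    · intro hu
      rw [← heq u (SimpleGraph.walkBall_mono (by omega) (hcl u hu)), hu]
    · intro hu
      rw [heq u (SimpleGraph.walkBall_mono (by omega) ((hball u).mpr (hcl' u hu))), hu]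
  have hout : outLeaders Γ L l = outLeaders Γ' L' l := by
    ext y
    simp only [outLeaders, Set.mem_ofPred_eq]
    refine and_congr_right fun _ => exists_congr fun u => exists_congr fun w => ?_
    rw [← hclus]
    refine and_congr_right fun hu => ?_
    rw [← h u (SimpleGraph.walkBall_mono (by omega) (hcl u hu)) w]
    refine and_congr_right fun huw => ?_
    rw [heq w (SimpleGraph.mem_walkBall_trans (hcl u hu) huw.mem_walkBall_one)]
  refine ⟨⟨?_, hout ▸ hs.2⟩, hout⟩
  simp only [← hclus]
  exact hs.1

theorem next_mem_walkBall (hL : Γ.IsClustering L) (hρ : ∀ v, L v ∈ Γ.walkBall v ρ) {l : ℕ}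
    (hl : L l = l) : next Γ L M l ∈ Γ.walkBall l (M + 1 + ρ) := by
  by_cases hs : IsSmall Γ L M l
  · obtain ⟨_, u, w, hu, huw, hw⟩ := next_mem hs
    rw [← hw]
    have h1 := hL.mem_walkBall_of_encard_lt' (v := l) (by rw [hl]; exact hs.1) (hu.trans hl.symm)
    exact SimpleGraph.mem_walkBall_trans
      (SimpleGraph.mem_walkBall_trans h1 huw.mem_walkBall_one) (hρ w)
  · rw [next_of_not_isSmall hs]
    exact SimpleGraph.self_mem_walkBall _ _

variable (hL : Γ.IsClustering L) (hL' : Γ'.IsClustering L')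
  (hLL : ∀ u, Γ.AgreeOn Γ' u T → L u = L' u)

include hL hL' hLL

theorem isSmall_iff_of_agreeOn {l : ℕ} (hl : L l = l) (h : Γ.AgreeOn Γ' l (T + M + 1)) :
    (IsSmall Γ L M l ↔ IsSmall Γ' L' M l) ∧ next Γ L M l = next Γ' L' M l := by
  have hl' : L' l = l := (hLL l (h.mono (by omega))).symm.trans hl
  have h1 := isSmall_of_agreeOn (M := M) hL' hL hLL hl h
  have h2 := isSmall_of_agreeOn (M := M) hL hL' (fun u hu => (hLL u hu.symm).symm) hl' h.symm
  have h3 : IsSmall Γ L M l ↔ IsSmall Γ' L' M l := ⟨fun h => (h1 h).1, fun h => (h2 h).1⟩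
  refine ⟨h3, ?_⟩
  by_cases hs : IsSmall Γ L M l
  · rw [next, next, if_pos hs, if_pos (h3.mp hs), (h1 hs).2]
  · rw [next, next, if_neg hs, if_neg (h3.not.mp hs)]

variable (hρ : ∀ v, L v ∈ Γ.walkBall v ρ)

include hρ

/-- Every colour step looks one pointer further, and a pointer leads from leader to leader over
distance at most `M + 1 + ρ`. -/
theorem color_eq_of_agreeOn (t : ℕ) {l : ℕ} (hl : L l = l)
    (h : Γ.AgreeOn Γ' l (T + M + 1 + t * (M + 1 + ρ))) :
    color Γ L M t l = color Γ' L' M t l := by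
  classical
  induction t generalizing l with
  | zero => rfl
  | succ t ih =>
    obtain ⟨h1, h2⟩ := isSmall_iff_of_agreeOn (M := M) hL hL' hLL hl (h.mono (by omega))
    have h3 := ih hl (h.mono (by gcongr; omega))
    have h4 := ih (next_idem (M := M) hL hl) (h.shift (next_mem_walkBall hL hρ hl)
      (by rw [Nat.succ_mul]; omega))
    rw [color, color, h3, h4, h2]
    simp only [h1]

theorem isCenter_of_agreeOn {τ l : ℕ} (hl : L l = l)
    (h : Γ.AgreeOn Γ' l (T + M + 1 + (τ + 1) * (M + 1 + ρ))) (hc : IsCenter Γ L M τ l) :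
    IsCenter Γ' L' M τ l := by
  have hcol : ∀ y, L y = y → y ∈ Γ.walkBall l (M + 1 + ρ) →
      color Γ L M τ y = color Γ' L' M τ y ∧ (IsSmall Γ L M y ↔ IsSmall Γ' L' M y) ∧
      next Γ L M y = next Γ' L' M y := by
    intro y hy hyl
    have h' : Γ.AgreeOn Γ' y (T + M + 1 + τ * (M + 1 + ρ)) :=
      h.shift hyl (by rw [Nat.succ_mul]; omega)
    exact ⟨color_eq_of_agreeOn hL hL' hLL hρ τ hy h',
      isSmall_iff_of_agreeOn (M := M) hL hL' hLL hy (h'.mono (by omega))⟩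
  obtain ⟨hl1, hl2, hl3⟩ := hcol l hl (SimpleGraph.self_mem_walkBall _ _)
  rcases hc with hc | ⟨hc, y, hy, hyl, hyc⟩
  · exact Or.inl (hl2.not.mp hc)
  · have hyy := isSmall_idem hL hy
    obtain ⟨hy1, hy2, hy3⟩ := hcol y hyy
      (SimpleGraph.mem_walkBall_symm (hyl ▸ next_mem_walkBall hL hρ hyy))
    obtain ⟨hn1, -, -⟩ := hcol _ (next_idem (M := M) hL hl) (next_mem_walkBall hL hρ hl)
    refine Or.inr ⟨?_, y, hy2.mp hy, hy3 ▸ hyl, ?_⟩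
    · rwa [← hl3, ← hn1, ← hl1]
    · rwa [← hy1, ← hl1]

/-- The radius covers the way to the leader, up to `J` pointers, and at each cluster visited the `τ
+ 1` pointer lengths that decide whether it is a center. -/
theorem center_eq_of_agreeOn (hρ' : ∀ v, L' v ∈ Γ'.walkBall v ρ) {τ J : ℕ}
    (hex : ∀ v, ∃ j ≤ J, IsCenter Γ L M τ ((next Γ L M)^[j] (L v)))
    (hex' : ∀ v, ∃ j ≤ J, IsCenter Γ' L' M τ ((next Γ' L' M)^[j] (L' v))) {v : ℕ}
    (h : Γ.AgreeOn Γ' v (T + M + 1 + ρ + (J + τ + 1) * (M + 1 + ρ))) :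
    center Γ L M τ (L v) = center Γ' L' M τ (L' v) := by
  have key : ∀ j l, L l = l → IsCenter Γ L M τ ((next Γ L M)^[j] l) →
      Γ.AgreeOn Γ' l (T + M + 1 + (j + τ + 1) * (M + 1 + ρ)) →
      center Γ L M τ l = center Γ' L' M τ l := by
    intro j
    induction j with
    | zero =>
      intro l hl hj h
      change IsCenter Γ L M τ l at hj
      rw [center_of_isCenter hj, center_of_isCenter (isCenter_of_agreeOn hL hL' hLL hρ hl
        (by simpa using h) hj)]
    | succ j ih =>
      intro l hl hj h
      have hle : (τ + 1) * (M + 1 + ρ) ≤ (j + 1 + τ + 1) * (M + 1 + ρ) := by gcongr; omega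
      have hl' : L' l = l := (hLL l (h.mono (by omega))).symm.trans hl
      by_cases hc : IsCenter Γ L M τ l
      · rw [center_of_isCenter hc, center_of_isCenter (isCenter_of_agreeOn hL hL' hLL hρ hl
          (h.mono (by omega)) hc)]
      · have hc' : ¬ IsCenter Γ' L' M τ l := fun hc' =>
          hc (isCenter_of_agreeOn hL' hL (fun u hu => (hLL u hu.symm).symm) hρ' hl'
            (h.mono (by omega)).symm hc')
        obtain ⟨i, -, hi⟩ := hex' l
        rw [hl'] at hi
        rw [center_of_not_isCenter hc ⟨_, hj⟩, center_of_not_isCenter hc' ⟨_, hi⟩,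
          ← (isSmall_iff_of_agreeOn (M := M) hL hL' hLL hl (h.mono (by omega))).2]
        refine ih _ (next_idem hL hl) hj (h.shift (next_mem_walkBall hL hρ hl) ?_)
        have : (j + 1 + τ + 1) * (M + 1 + ρ) = (j + τ + 1) * (M + 1 + ρ) + (M + 1 + ρ) := by ring
        omega
  rw [← hLL v (h.mono (by omega))]
  obtain ⟨j, hj, hj'⟩ := hex v
  refine key j (L v) (hL.idem v) hj' (h.shift (hρ v) ?_)
  have : (j + τ + 1) * (M + 1 + ρ) ≤ (J + τ + 1) * (M + 1 + ρ) := by gcongr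
  omega

end Agree

end ClusterPhase

/-! ### Local clustering by repeated doubling -/

/-- Graphs of finitely many vertices with identifiers less than `N` can be clustered locally. -/
theorem exists_local_clustering (k : ℕ) : ∃ C : ℕ, ∀ n, 2 ≤ n → ∀ i : ℕ,
    ∃ L : SimpleGraph ℕ → ℕ → ℕ,
      (∀ Γ : SimpleGraph ℕ, (∀ u w, Γ.Adj u w → u < n ^ k) →
        Γ.IsClustering (L Γ) ∧
        (∀ v, ((2 ^ i : ℕ) : ℕ∞) ≤ {u | L Γ u = L Γ v}.encard ∨
          ∀ u w, L Γ u = L Γ v → Γ.Adj u w → L Γ w = L Γ v) ∧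
        ∀ v, L Γ v ∈ Γ.walkBall v (C * 2 ^ i)) ∧
      ∀ Γ Γ' : SimpleGraph ℕ, (∀ u w, Γ.Adj u w → u < n ^ k) →
        (∀ u w, Γ'.Adj u w → u < n ^ k) →
        ∀ v, Γ.AgreeOn Γ' v (C * 2 ^ i * logStar n) → L Γ v = L Γ' v := by
  set K : ℕ := 2 ^ 2 ^ (k + 2) with hK
  set J : ℕ := 2 * K with hJ
  refine ⟨4 * (J + 1) * (J + 3), fun n hn i => ?_⟩
  have hlog : 1 ≤ logStar n := by
    rw [logStar, dif_neg (by omega)]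
    omega
  have hclog : 1 ≤ Nat.clog 2 n := Nat.clog_pos (by norm_num) hn
  set τ := logStar n with hτ
  -- The identifiers are the initial colours and have at most `k * clog 2 n` bits; the factor `k +
  -- 1` keeps the number of bits positive when `k = 0`.
  have hcolors : 2 ^ (fun m => Nat.clog 2 (2 * m))^[τ] ((k + 1) * Nat.clog 2 n) ≤ K := by
    refine Nat.pow_le_pow_right (by norm_num) (iterate_clog_le (by omega) n hn _ ?_)
    gcongr
    have := (k + 2).lt_two_pow_self
    omega
  have hNle : n ^ k ≤ 2 ^ ((k + 1) * Nat.clog 2 n) := by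
    calc n ^ k ≤ (2 ^ Nat.clog 2 n) ^ k := by
          gcongr
          exact Nat.le_pow_clog (by norm_num) n
      _ = 2 ^ (k * Nat.clog 2 n) := by rw [← pow_mul, mul_comm]
      _ ≤ _ := Nat.pow_le_pow_right (by norm_num) (by gcongr; omega)
  have hmpos : 0 < (k + 1) * Nat.clog 2 n := by positivity
  -- The factor 4 leaves room for the induction: passing from `i` to `i + 1` doubles these bounds,
  -- and the contribution of one phase is a fraction of the new ones.
  suffices ∃ L : SimpleGraph ℕ → ℕ → ℕ,
      (∀ Γ : SimpleGraph ℕ, (∀ u w, Γ.Adj u w → u < n ^ k) →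
        Γ.IsClustering (L Γ) ∧
        (∀ v, ((2 ^ i : ℕ) : ℕ∞) ≤ {u | L Γ u = L Γ v}.encard ∨
          ∀ u w, L Γ u = L Γ v → Γ.Adj u w → L Γ w = L Γ v) ∧
        ∀ v, L Γ v ∈ Γ.walkBall v (J * (4 * 2 ^ i))) ∧
      ∀ Γ Γ' : SimpleGraph ℕ, (∀ u w, Γ.Adj u w → u < n ^ k) →
        (∀ u w, Γ'.Adj u w → u < n ^ k) →
        ∀ v, Γ.AgreeOn Γ' v (4 * 2 ^ i * ((1 + J) * (J + τ + 2))) → L Γ v = L Γ' v by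
    obtain ⟨L, h1, h2⟩ := this
    refine ⟨L, fun Γ hΓ => ⟨(h1 Γ hΓ).1, (h1 Γ hΓ).2.1, fun v =>
      SimpleGraph.walkBall_mono ?_ ((h1 Γ hΓ).2.2 v)⟩, fun Γ Γ' hΓ hΓ' v h =>
      h2 Γ Γ' hΓ hΓ' v (h.mono ?_)⟩
    · calc J * (4 * 2 ^ i) ≤ (J + 1) * (J + 3) * (4 * 2 ^ i) := by gcongr; nlinarith
        _ = _ := by ring
    · have : J + τ + 2 ≤ (J + 3) * τ := by nlinarith
      calc 4 * 2 ^ i * ((1 + J) * (J + τ + 2)) ≤ 4 * 2 ^ i * ((1 + J) * ((J + 3) * τ)) := by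
            gcongr
        _ = _ := by ring
  induction i with
  | zero =>
    refine ⟨fun _ v => v, fun Γ _ => ⟨⟨fun _ => rfl, fun _ => SimpleGraph.Reachable.refl _⟩,
      fun v => Or.inl ?_, fun v => SimpleGraph.self_mem_walkBall _ _⟩, fun _ _ _ _ _ _ => rfl⟩
    simp
  | succ i ih =>
    obtain ⟨L, h1, h2⟩ := ih
    have hex : ∀ Γ : SimpleGraph ℕ, (∀ u w, Γ.Adj u w → u < n ^ k) → ∀ v, ∃ j ≤ J,
        ClusterPhase.IsCenter Γ (L Γ) (2 ^ (i + 1)) τ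
          ((ClusterPhase.next Γ (L Γ) (2 ^ (i + 1)))^[j] (L Γ v)) := fun Γ hΓ v =>
      ClusterPhase.exists_isCenter (h1 Γ hΓ).1 hΓ hNle hmpos hcolors v
    have hpow : 1 ≤ 2 ^ i := Nat.one_le_two_pow
    refine ⟨fun Γ v => ClusterPhase.center Γ (L Γ) (2 ^ (i + 1)) τ (L Γ v), fun Γ hΓ => ?_,
      fun Γ Γ' hΓ hΓ' v h => ?_⟩
    · obtain ⟨hcl, hlarge, hρ⟩ := h1 Γ hΓ
      refine ⟨ClusterPhase.isClustering_center hcl (hex Γ hΓ),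
        ClusterPhase.center_large hcl (hex Γ hΓ) (M₀ := 2 ^ i) (by rw [pow_succ]; omega) hlarge,
        fun v => SimpleGraph.walkBall_mono ?_
          (ClusterPhase.center_mem_walkBall hcl (hex Γ hΓ) hρ v)⟩
      rw [pow_succ, ← mul_add]
      gcongr
      omega
    · refine ClusterPhase.center_eq_of_agreeOn (h1 Γ hΓ).1 (h1 Γ' hΓ').1 (h2 Γ Γ' hΓ hΓ')
        (h1 Γ hΓ).2.2 (h1 Γ' hΓ').2.2 (hex Γ hΓ) (hex Γ' hΓ') (h.mono ?_)
      rw [pow_succ]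
      have : (J + τ + 1) * (2 ^ i * 2 + 1 + J * (4 * 2 ^ i)) ≤
          (J + τ + 1) * (4 * 2 ^ i * (1 + J)) := by
        gcongr
        nlinarith
      nlinarith

/-! ### Cacti and common detours -/

namespace SimpleGraph

variable {V : Type*}

/-- Two detours of an edge contain a common detour. Cacti have this property, since an edge of a
cactus has at most one detour without repeated vertices. -/
def HasCommonDetours (H : SimpleGraph V) : Prop :=
  ∀ ⦃u v : V⦄, H.Adj u v → ∀ D₁ ≤ H, ∀ D₂ ≤ H, ¬ D₁.Adj u v → ¬ D₂.Adj u v →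
    D₁.Reachable u v → D₂.Reachable u v → (D₁ ⊓ D₂).Reachable u v

theorem HasCommonDetours.mono {H H' : SimpleGraph V} (h : H.HasCommonDetours) (hle : H' ≤ H) :
    H'.HasCommonDetours :=
  fun _ _ huv D₁ h₁ D₂ h₂ => h (hle huv) D₁ (h₁.trans hle) D₂ (h₂.trans hle)

/-- A path in either detour closes up with the edge `uv` to a cycle. Both cycles contain `uv`, hence
coincide, so the path in `D₁` also runs in `D₂`. -/
theorem IsCactus.hasCommonDetours {H : SimpleGraph V} (hH : H.IsCactus) :
    H.HasCommonDetours := by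
  classical
  intro u v huv D₁ h₁ D₂ h₂ hn₁ hn₂ hr₁ hr₂
  have cyc : ∀ D ≤ H, ¬ D.Adj u v → D.Reachable u v → ∃ p : D.Walk v u, ∃ c : H.Walk u u,
      c.IsCycle ∧ c.edges = s(u, v) :: p.edges := by
    intro D hD hn hr
    obtain ⟨p⟩ := hr.symm
    refine ⟨p.toPath.1, Walk.cons huv (p.toPath.1.mapLe hD), ?_, ?_⟩
    · rw [Walk.cons_isCycle_iff]
      refine ⟨p.toPath.2.mapLe hD, fun he => hn ?_⟩
      rw [Walk.edges_mapLe_eq_edges] at he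
      exact Walk.edges_subset_edgeSet _ he
    · rw [Walk.edges_cons, Walk.edges_mapLe_eq_edges]
  obtain ⟨p₁, c₁, hc₁, he₁⟩ := cyc D₁ h₁ hn₁ hr₁
  obtain ⟨p₂, c₂, hc₂, he₂⟩ := cyc D₂ h₂ hn₂ hr₂
  have heq := hH c₁ c₂ hc₁ hc₂ s(u, v) (by simp [he₁]) (by simp [he₂])
  refine Reachable.symm ⟨p₁.transfer (D₁ ⊓ D₂) fun e he => ?_⟩
  have hD₁ := Walk.edges_subset_edgeSet _ he
  have hne : e ≠ s(u, v) := by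
    rintro rfl
    exact hn₁ hD₁
  have h2 : e ∈ c₂.edges := by
    rw [← Walk.mem_edges_toSubgraph, ← heq, Walk.mem_edges_toSubgraph, he₁]
    exact List.mem_cons_of_mem _ he
  rw [he₂, List.mem_cons] at h2
  have hD₂ := Walk.edges_subset_edgeSet _ (h2.resolve_left hne)
  induction e with
  | _ a b => exact ⟨hD₁, hD₂⟩

theorem HasCommonDetours.map {W : Type*} {G : SimpleGraph V} (hG : G.HasCommonDetours)
    (f : V ↪ W) : (G.map f).HasCommonDetours := by
  have lift : ∀ D ≤ G.map f, ∀ w w', D.Reachable w w' → ∀ u, w = f u →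
      ∃ u', w' = f u' ∧ (D.comap f).Reachable u u' := by
    rintro D hD w w' ⟨p⟩
    induction p with
    | nil => exact fun u hu => ⟨u, hu, Reachable.refl _⟩
    | @cons a b c h p ih =>
      rintro u rfl
      obtain ⟨x, y, -, -, rfl⟩ := (map_adj f G _ _).mp (hD h)
      obtain ⟨u', hu', hr⟩ := ih y rfl
      have h' : (D.comap f).Adj u y := h
      exact ⟨u', hu', h'.reachable.trans hr⟩
  have hle : ∀ D ≤ G.map f, D.comap f ≤ G := by
    intro D hD u v h
    obtain ⟨x, y, hxy, hx, hy⟩ := (map_adj f G _ _).mp (hD h)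
    rwa [f.injective hx, f.injective hy] at hxy
  intro u' v' huv D₁ h₁ D₂ h₂ hn₁ hn₂ hr₁ hr₂
  obtain ⟨u, v, huvG, rfl, rfl⟩ := (map_adj f G _ _).mp huv
  have lift' : ∀ D ≤ G.map f, D.Reachable (f u) (f v) → (D.comap f).Reachable u v := by
    intro D hD hr
    obtain ⟨v', hv', hr'⟩ := lift D hD _ _ hr u rfl
    rwa [f.injective hv']
  have h := hG huvG _ (hle D₁ h₁) _ (hle D₂ h₂) hn₁ hn₂ (lift' D₁ h₁ hr₁) (lift' D₂ h₂ hr₂)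
  exact h.map (G' := D₁ ⊓ D₂) ⟨f, fun h => h⟩

/-- Contracting connected classes of a cactus leaves at most two parallel edges between any two of
them, so that there are at most twice as many edges as classes. The edges are given by one end each,
the other end being `g b`. -/
theorem HasCommonDetours.card_le_of_crossing {ι : Type*} {H : SimpleGraph V}
    (hH : H.HasCommonDetours) (g : V → V) (Λ : Finset ι) (L : V → ι)
    (hL : ∀ u w, L u = L w → (H.intra L).Reachable u w) (Y : Finset V)
    (hY : ∀ b ∈ Y, H.Adj b (g b) ∧ g b ∉ Y ∧ L b ≠ L (g b) ∧ L b ∈ Λ ∧ L (g b) ∈ Λ) :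
    Y.card ≤ 2 * Λ.card := by
  classical
  induction hn : Λ.card generalizing Λ L Y with
  | zero =>
    rw [Finset.card_eq_zero] at hn
    subst hn
    rcases Y.eq_empty_or_nonempty with rfl | ⟨b, hb⟩
    · simp
    · exact absurd (hY b hb).2.2.2.1 (Finset.notMem_empty _)
  | succ n ih =>
    rcases Y.eq_empty_or_nonempty with rfl | ⟨b₀, hb₀⟩
    · simp
    obtain ⟨hadj₀, hg₀, hne₀, hl₀, hl₀'⟩ := hY b₀ hb₀
    set l := L b₀ with hl
    set l' := L (g b₀) with hl'
    set L' : V → ι := fun v => if L v = l' then l else L v with hL'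
    let par : V → Prop := fun b => (L b = l ∧ L (g b) = l') ∨ (L b = l' ∧ L (g b) = l)
    have hle : H.intra L ≤ H.intra L' := fun a b h => ⟨h.1, by simp only [hL', h.2]⟩
    have hbg : (H.intra L').Reachable b₀ (g b₀) :=
      Adj.reachable ⟨hadj₀, by simp only [hL', ← hl, ← hl', if_neg hne₀, if_true]⟩
    -- Of three parallel edges, the second and the third each give a detour of the first, together
    -- with edges inside the classes. The common part of the detours lies inside the classes and
    -- cannot join different ones. As `g b ∉ Y`, distinct `b` give distinct edges.
    have key : (Y.filter par).card ≤ 2 := by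
      by_contra! hcard
      obtain ⟨b₁, h1, b₂, h2, b₃, h3, h12, h13, h23⟩ := Finset.two_lt_card.mp hcard
      simp only [Finset.mem_filter] at h1 h2 h3
      have reach : ∀ b ∈ Y, par b → (H.intra L ⊔ edge b (g b)).Reachable b₁ (g b₁) := by
        intro b hb hp
        have hadj : (H.intra L ⊔ edge b (g b)).Adj b (g b) :=
          Or.inr (by rw [edge_adj]; exact ⟨Or.inl ⟨rfl, rfl⟩, (hY b hb).1.ne⟩)
        have hle' : H.intra L ≤ H.intra L ⊔ edge b (g b) := le_sup_left
        have same : L b₁ = L b → L (g b₁) = L (g b) →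
            (H.intra L ⊔ edge b (g b)).Reachable b₁ (g b₁) := fun e1 e2 =>
          ((hL _ _ e1).mono hle').trans (hadj.reachable.trans ((hL _ _ e2.symm).mono hle'))
        have opp : L b₁ = L (g b) → L (g b₁) = L b →
            (H.intra L ⊔ edge b (g b)).Reachable b₁ (g b₁) := fun e1 e2 =>
          ((hL _ _ e1).mono hle').trans (hadj.symm.reachable.trans ((hL _ _ e2.symm).mono hle'))
        rcases h1.2 with ⟨e1, e2⟩ | ⟨e1, e2⟩ <;> rcases hp with ⟨e3, e4⟩ | ⟨e3, e4⟩
        · exact same (e1.trans e3.symm) (e2.trans e4.symm)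
        · exact opp (e1.trans e4.symm) (e2.trans e3.symm)
        · exact opp (e1.trans e4.symm) (e2.trans e3.symm)
        · exact same (e1.trans e3.symm) (e2.trans e4.symm)
      have le : ∀ b ∈ Y, H.intra L ⊔ edge b (g b) ≤ H := by
        intro b hb
        refine sup_le (intra_le _ _) ?_
        rw [edge_le_iff]
        exact Or.inr (hY b hb).1
      have nadj : ∀ b ∈ Y, b₁ ≠ b → ¬ (H.intra L ⊔ edge b (g b)).Adj b₁ (g b₁) := by
        rintro b hb hne (h | h)
        · exact (hY b₁ h1.1).2.2.1 h.2
        · rw [edge_adj] at h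
          rcases h.1 with h | h
          · exact hne h.1
          · exact (hY b hb).2.1 (h.1 ▸ h1.1)
      have h := hH (hY b₁ h1.1).1 _ (le b₂ h2.1) _ (le b₃ h3.1) (nadj b₂ h2.1 h12)
        (nadj b₃ h3.1 h13) (reach b₂ h2.1 h2.2) (reach b₃ h3.1 h3.2)
      have hle' : (H.intra L ⊔ edge b₂ (g b₂)) ⊓ (H.intra L ⊔ edge b₃ (g b₃)) ≤ H.intra L := by
        rintro x y ⟨h | h, h' | h'⟩
        · exact h
        · exact h
        · exact h'
        · exfalso
          rw [edge_adj] at h h'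
          rcases h.1 with h | h <;> rcases h'.1 with h' | h'
          · exact h23 (h.1.symm.trans h'.1)
          · exact (hY b₃ h3.1).2.1 (h'.1.symm.trans h.1 ▸ h2.1)
          · exact (hY b₂ h2.1).2.1 (h.1.symm.trans h'.1 ▸ h3.1)
          · exact h23 (h.2.symm.trans h'.2)
      exact (hY b₁ h1.1).2.2.1 (eq_of_reachable_intra (h.mono hle'))
    -- Merging the two classes costs one class and at most two edges, and the merged class is
    -- connected through the edge at `b₀`.
    have hrest : (Y.filter fun b => ¬ par b).card ≤ 2 * n := by
      refine ih (Λ.erase l') L' ?_ _ ?_ ?_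
      · intro u w huw
        have cross : ∀ u w, L u = l → L w = l' → (H.intra L').Reachable u w := fun u w hu hw =>
          ((hL _ _ hu).mono hle).trans (hbg.trans ((hL _ _ hw.symm).mono hle))
        simp only [hL'] at huw
        split_ifs at huw with h1 h2 h2
        · exact (hL _ _ (h1.trans h2.symm)).mono hle
        · exact (cross w u huw.symm h1).symm
        · exact cross u w huw h2
        · exact (hL _ _ huw).mono hle
      · intro b hb
        rw [Finset.mem_filter] at hb
        obtain ⟨h1, h2, h3, h4, h5⟩ := hY b hb.1
        refine ⟨h1, fun h => h2 (Finset.mem_filter.mp h).1, ?_, ?_, ?_⟩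
        · simp only [hL']
          have := hb.2
          simp only [par] at this
          split_ifs with h6 h7 h7 <;> grind
        · simp only [hL']
          split_ifs with h6
          · exact Finset.mem_erase.mpr ⟨hne₀, hl₀⟩
          · exact Finset.mem_erase.mpr ⟨h6, h4⟩
        · simp only [hL']
          split_ifs with h6
          · exact Finset.mem_erase.mpr ⟨hne₀, hl₀⟩
          · exact Finset.mem_erase.mpr ⟨h6, h5⟩
      · rw [Finset.card_erase_of_mem hl₀', hn]
        rfl
    have := Finset.card_filter_add_card_filter_not (s := Y) par
    omega

/-- A cactus contains a part that is attached to the rest at a single vertex and in which no vertex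
has more than two neighbours. The part is minimal among those attached at a single vertex. -/
theorem HasCommonDetours.exists_pendant [DecidableEq V] {H : SimpleGraph V}
    (hH : H.HasCommonDetours) (S : Finset V) (hS : ∀ u w, H.Adj u w → w ∈ S)
    (hcard : 2 ≤ S.card) :
    ∃ U ⊆ S, ∃ x, U.Nonempty ∧ x ∉ U ∧ (∀ u ∈ U, ∀ w, H.Adj u w → w ∈ U ∨ w = x) ∧
      (∀ U' ⊂ U, U'.Nonempty → ∀ z ∉ U', ∃ u ∈ U', ∃ w, H.Adj u w ∧ w ∉ U' ∧ w ≠ z) ∧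
      ∀ y ∈ U, ∀ w₁ w₂ w₃, H.Adj y w₁ → H.Adj y w₂ → H.Adj y w₃ → w₁ ≠ w₂ → w₁ ≠ w₃ →
        w₂ = w₃ := by
  classical
  let good : Finset V → Prop := fun U => U.Nonempty ∧ ∃ x ∉ U, ∀ u ∈ U, ∀ w, H.Adj u w →
    w ∈ U ∨ w = x
  have hne : (S.powerset.filter good).Nonempty := by
    obtain ⟨x, hx⟩ : S.Nonempty := Finset.card_pos.mp (by omega)
    refine ⟨S.erase x, Finset.mem_filter.mpr ⟨Finset.mem_powerset.mpr (Finset.erase_subset _ _),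
      ?_, x, Finset.notMem_erase _ _, fun u _ w huw => ?_⟩⟩
    · rw [← Finset.card_pos, Finset.card_erase_of_mem hx]
      omega
    · by_cases h : w = x
      · exact Or.inr h
      · exact Or.inl (Finset.mem_erase.mpr ⟨h, hS u w huw⟩)
  obtain ⟨U, hU, hmin⟩ := Finset.exists_min_image _ Finset.card hne
  rw [Finset.mem_filter, Finset.mem_powerset] at hU
  obtain ⟨hUS, hUne, x, hx, hN⟩ := hU
  have hmin' : ∀ U' ⊂ U, U'.Nonempty → ∀ z ∉ U', ∃ u ∈ U', ∃ w, H.Adj u w ∧ w ∉ U' ∧ w ≠ z := by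
    intro U' hU' hne' z hz
    by_contra! h
    have := hmin U' (Finset.mem_filter.mpr ⟨Finset.mem_powerset.mpr (hU'.subset.trans hUS), hne',
      z, hz, fun u hu w huw => or_iff_not_imp_left.mpr (h u hu w huw)⟩)
    exact absurd (Finset.card_lt_card hU') (not_lt.mpr this)
  refine ⟨U, hUS, x, hUne, hx, hN, hmin', ?_⟩
  intro y hy w₁ w₂ w₃ h1 h2 h3 h12 h13
  by_contra h23
  let D : SimpleGraph V :=
    { Adj := fun u w => H.Adj u w ∧ u ≠ y ∧ w ≠ y
      symm := ⟨fun _ _ h => ⟨h.1.symm, h.2.2, h.2.1⟩⟩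
      loopless := ⟨fun _ h => H.loopless.irrefl _ h.1⟩ }
  have hD : D ≤ H := fun _ _ h => h.1
  -- Here `D` is `H` without `y`. The vertices of `U` that `y` separates from `x` would form a
  -- smaller part attached at `y` alone.
  have hconn : ∀ w, w ∈ U ∨ w = x → w ≠ y → D.Reachable w x := by
    rintro w (hw | rfl) hwy
    · by_contra hr
      let U' := U.filter fun u => u ≠ y ∧ ¬ D.Reachable u x
      have hyU' : y ∉ U' := fun h => (Finset.mem_filter.mp h).2.1 rfl
      obtain ⟨u, hu, z, huz, hz, hzy⟩ := hmin' U'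
        (Finset.ssubset_iff_subset_ne.mpr ⟨Finset.filter_subset _ _, fun h => hyU' (h ▸ hy)⟩)
        ⟨w, Finset.mem_filter.mpr ⟨hw, hwy, hr⟩⟩ y hyU'
      obtain ⟨huU, huy, hur⟩ := Finset.mem_filter.mp hu
      have hDuz : D.Adj u z := ⟨huz, huy, hzy⟩
      rcases hN u huU z huz with hzU | rfl
      · exact hz (Finset.mem_filter.mpr ⟨hzU, hzy, fun h => hur (hDuz.reachable.trans h)⟩)
      · exact hur hDuz.reachable
    · exact Reachable.refl _
  have reach : ∀ w, H.Adj y w → (D ⊔ edge y w).Reachable y w₁ := by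
    intro w hw
    have hadj : (D ⊔ edge y w).Adj y w :=
      Or.inr (by rw [edge_adj]; exact ⟨Or.inl ⟨rfl, rfl⟩, hw.ne⟩)
    exact hadj.reachable.trans (((hconn w (hN y hy w hw) hw.ne').trans
      (hconn w₁ (hN y hy w₁ h1) h1.ne').symm).mono le_sup_left)
  have le : ∀ w, H.Adj y w → D ⊔ edge y w ≤ H := fun w hw =>
    sup_le hD ((edge_le_iff ..).mpr (Or.inr hw))
  have adj : ∀ w z, (D ⊔ edge y w).Adj y z → z = w := by
    rintro w z (h | h)
    · exact absurd rfl h.2.1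
    · rw [edge_adj] at h
      rcases h.1 with h' | h'
      · exact h'.2
      · exact absurd h'.2.symm h.2
  -- The detours of `y w₁` through `w₂` and through `w₃` have no common edge at `y`.
  obtain ⟨p⟩ := hH h1 _ (le w₂ h2) _ (le w₃ h3) (fun h => h12 (adj _ _ h))
    (fun h => h13 (adj _ _ h)) (reach w₂ h2) (reach w₃ h3)
  cases p with
  | nil => exact h1.ne rfl
  | cons h _ => exact h23 ((adj _ _ h.1).symm.trans (adj _ _ h.2))

end SimpleGraph

/-- Double counting of the related pairs. -/
theorem Finset.two_mul_card_eq_of_bipartite {V : Type*} [DecidableEq V] (r : V → V → Prop)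
    [DecidableRel r] {Z Y : Finset V} {x : V} (hx : x ∉ Y)
    (hZ : ∀ z ∈ Z, ((insert x Y).filter (r z)).card = 2)
    (hY : ∀ y ∈ Y, (Z.filter fun z => r z y).card = 2) :
    2 * Z.card = 2 * Y.card + (Z.filter fun z => r z x).card := by
  have h := Finset.sum_card_bipartiteAbove_eq_sum_card_bipartiteBelow r (s := Z) (t := insert x Y)
  rw [Finset.sum_insert hx] at h
  simp only [Finset.bipartiteAbove, Finset.bipartiteBelow] at h
  rw [Finset.sum_congr rfl hZ, Finset.sum_congr rfl hY] at h
  simp only [Finset.sum_const, smul_eq_mul] at h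
  omega

/-! ### Exchanging one side of a cactus for the other -/

namespace SimpleGraph

variable {V : Type*}

open Classical in
/-- The vertices of `A` all of whose neighbours in `B` belong to `P`. -/
noncomputable def closedIn (H : SimpleGraph V) (A B P : Finset V) : Finset V :=
  A.filter fun a => ∀ b ∈ B, H.Adj a b → b ∈ P

theorem mem_closedIn {H : SimpleGraph V} {A B P : Finset V} {a : V} :
    a ∈ H.closedIn A B P ↔ a ∈ A ∧ ∀ b ∈ B, H.Adj a b → b ∈ P := by
  classical
  rw [closedIn, Finset.mem_filter]

theorem closedIn_mono {H : SimpleGraph V} {A B P P' : Finset V} (h : P ⊆ P') :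
    H.closedIn A B P ⊆ H.closedIn A B P' := by
  intro a ha
  rw [mem_closedIn] at ha ⊢
  exact ⟨ha.1, fun b hb hab => h (ha.2 b hb hab)⟩

variable [DecidableEq V]

/-- `P ⊆ B` can be filled vertex by vertex in such a way that it always has at most two vertices more
than the set of those vertices of `A` whose neighbours have all been filled in. -/
inductive Fillable (H : SimpleGraph V) (A B : Finset V) : Finset V → Prop
  | nil : Fillable H A B ∅
  | step {P : Finset V} {b : V} : Fillable H A B P → b ∈ B → b ∉ P →
      P.card + 1 ≤ (H.closedIn A B (insert b P)).card + 2 → Fillable H A B (insert b P)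

/-- This is one round of the greedy construction: a fillable piece of `B` that pays for itself. It
is found inside, or equal to, a minimal set `B'` that frees at least as many vertices as it has. -/
theorem HasCommonDetours.exists_fillable {H : SimpleGraph V} (hH : H.HasCommonDetours)
    {A B : Finset V} (hAB : Disjoint A B) (hB : B.Nonempty) (hcard : B.card ≤ A.card) :
    ∃ B₀ ⊆ B, B₀.Nonempty ∧ H.Fillable A B B₀ ∧ B₀.card ≤ (H.closedIn A B B₀).card := by
  classical
  have hne : (B.powerset.filter fun Z => Z.Nonempty ∧ Z.card ≤ (H.closedIn A B Z).card).Nonempty := by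
    refine ⟨B, Finset.mem_filter.mpr ⟨Finset.mem_powerset_self _, hB, hcard.trans_eq ?_⟩⟩
    congr 1
    ext a
    rw [mem_closedIn]
    exact ⟨fun h => ⟨h, fun b hb _ => hb⟩, fun h => h.1⟩
  obtain ⟨B', hB', hmin⟩ := Finset.exists_min_image _ Finset.card hne
  rw [Finset.mem_filter, Finset.mem_powerset] at hB'
  obtain ⟨hB'B, hB'ne, hB'card⟩ := hB'
  have hmin' : ∀ Z ⊂ B', Z.Nonempty → (H.closedIn A B Z).card < Z.card := by
    intro Z hZ hZne
    by_contra! h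
    have := hmin Z (Finset.mem_filter.mpr
      ⟨Finset.mem_powerset.mpr (hZ.subset.trans hB'B), hZne, h⟩)
    exact absurd (Finset.card_lt_card hZ) (not_lt.mpr this)
  have hsingle : ∀ b ∈ B, H.Fillable A B {b} := fun b hb =>
    Fillable.step Fillable.nil hb (Finset.notMem_empty _) (by simp)
  by_cases hlow : ∃ b ∈ B', (H.closedIn A B {b}).Nonempty
  · obtain ⟨b, hb, hbne⟩ := hlow
    exact ⟨{b}, Finset.singleton_subset_iff.mpr (hB'B hb), Finset.singleton_nonempty _,
      hsingle b (hB'B hb), by rw [Finset.card_singleton]; exact Finset.card_pos.mpr hbne⟩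
  push Not at hlow
  set A' := H.closedIn A B B' with hA'
  have hA'A : ∀ a ∈ A', a ∈ A := fun a ha => (mem_closedIn.mp ha).1
  have hA'N : ∀ a ∈ A', ∀ b ∈ B, H.Adj a b → b ∈ B' := fun a ha => (mem_closedIn.mp ha).2
  have hdisj : ∀ v, v ∈ A' → v ∉ B' := fun v hv hv' =>
    Finset.disjoint_left.mp hAB (hA'A v hv) (hB'B hv')
  have ha2 : ∀ a ∈ A', ∃ b₁ ∈ B', ∃ b₂ ∈ B', b₁ ≠ b₂ ∧ H.Adj a b₁ ∧ H.Adj a b₂ := by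
    intro a ha
    have step : ∀ b ∈ B', ∃ b' ∈ B', b' ≠ b ∧ H.Adj a b' := by
      intro b hb
      by_contra! h
      have : a ∈ H.closedIn A B {b} := by
        refine mem_closedIn.mpr ⟨hA'A a ha, fun b' hb' hab => ?_⟩
        by_contra hne
        exact h b' (hA'N a ha b' hb' hab) (fun he => hne (Finset.mem_singleton.mpr he)) hab
      rw [hlow b hb] at this
      exact Finset.notMem_empty _ this
    obtain ⟨b, hb⟩ := hB'ne
    obtain ⟨b₁, hb₁, -, hab₁⟩ := step b hb
    obtain ⟨b₂, hb₂, hne, hab₂⟩ := step b₁ hb₁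
    exact ⟨b₁, hb₁, b₂, hb₂, hne.symm, hab₁, hab₂⟩
  -- Otherwise `B' \ Z` would still free at least as many vertices as it has, against minimality.
  have hcut : ∀ Z ⊆ B', Z.Nonempty → (A'.filter fun a => ∃ z ∈ Z, H.Adj a z).card ≤ Z.card →
      Z = B' := by
    intro Z hZ hZne hle
    by_contra hne
    have hZss : Z ⊂ B' := Finset.ssubset_iff_subset_ne.mpr ⟨hZ, hne⟩
    have h1 : (B' \ Z).Nonempty := Finset.sdiff_nonempty.mpr hZss.not_subset
    have h2 : B' \ Z ⊂ B' := Finset.sdiff_ssubset hZ hZne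
    have h3 := hmin' _ h2 h1
    have h4 : A' \ (A'.filter fun a => ∃ z ∈ Z, H.Adj a z) ⊆ H.closedIn A B (B' \ Z) := by
      intro a ha
      rw [Finset.mem_sdiff, Finset.mem_filter] at ha
      refine mem_closedIn.mpr ⟨hA'A a ha.1, fun b hb hab => Finset.mem_sdiff.mpr
        ⟨hA'N a ha.1 b hb hab, fun hbZ => ha.2 ⟨ha.1, b, hbZ, hab⟩⟩⟩
    have h5 := Finset.card_le_card h4
    have h6 := Finset.le_card_sdiff (A'.filter fun a => ∃ z ∈ Z, H.Adj a z) A'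
    have h7 := Finset.card_sdiff_add_card_eq_card hZ
    omega
  have hb2 : ∀ b ∈ B', ∃ a₁ ∈ A', ∃ a₂ ∈ A', a₁ ≠ a₂ ∧ H.Adj b a₁ ∧ H.Adj b a₂ := by
    intro b hb
    have : 1 < (A'.filter fun a => ∃ z ∈ ({b} : Finset V), H.Adj a z).card := by
      by_contra! h
      have h1 := hcut {b} (Finset.singleton_subset_iff.mpr hb) (Finset.singleton_nonempty _)
        (by simpa using h)
      have h2 := hlow b hb
      rw [h1] at h2
      have h3 : A' = ∅ := h2
      rw [h3, ← h1] at hB'card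
      simp at hB'card
    obtain ⟨a₁, h1, a₂, h2, hne⟩ := Finset.one_lt_card.mp this
    simp only [Finset.mem_filter, Finset.mem_singleton, exists_eq_left] at h1 h2
    exact ⟨a₁, h1.1, a₂, h2.1, hne, h1.2.symm, h2.2.symm⟩
  -- Between `A'` and `B'` all degrees are now at least two, so in a pendant part of this graph they
  -- are exactly two.
  let H' : SimpleGraph V :=
    { Adj := fun u w => H.Adj u w ∧ ((u ∈ A' ∧ w ∈ B') ∨ (u ∈ B' ∧ w ∈ A'))
      symm := ⟨fun _ _ h => ⟨h.1.symm, h.2.symm.imp And.symm And.symm⟩⟩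
      loopless := ⟨fun _ h => H.loopless.irrefl _ h.1⟩ }
  have hH' : H'.HasCommonDetours := hH.mono fun _ _ h => h.1
  obtain ⟨U, hUS, x, hUne, hx, hN, hUmin, hdeg⟩ := hH'.exists_pendant (A' ∪ B')
    (fun u w h => by
      rcases h.2 with h | h
      · exact Finset.mem_union_right _ h.2
      · exact Finset.mem_union_left _ h.2)
    (by
      obtain ⟨b, hb⟩ := hB'ne
      obtain ⟨a₁, h1, a₂, h2, hne, -⟩ := hb2 b hb
      exact (Finset.one_lt_card.mpr ⟨a₁, Finset.mem_union_left _ h1, a₂,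
        Finset.mem_union_left _ h2, hne⟩))
  set Z := B' ∩ U with hZ
  set Y := A' ∩ U with hY
  have hZB : ∀ z ∈ Z, z ∈ B := fun z hz => hB'B (Finset.mem_inter.mp hz).1
  have hAadj : ∀ a ∈ A', ∀ b ∈ B, H.Adj a b → H'.Adj a b := fun a ha b hb hab =>
    ⟨hab, Or.inl ⟨ha, hA'N a ha b hb hab⟩⟩
  have hZne : Z.Nonempty := by
    obtain ⟨y, hy⟩ := hUne
    rcases Finset.mem_union.mp (hUS hy) with h | h
    · obtain ⟨b₁, h1, b₂, h2, hne, hy1, hy2⟩ := ha2 y h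
      rcases hN y hy b₁ ⟨hy1, Or.inl ⟨h, h1⟩⟩ with h3 | h3
      · exact ⟨b₁, Finset.mem_inter.mpr ⟨h1, h3⟩⟩
      · rcases hN y hy b₂ ⟨hy2, Or.inl ⟨h, h2⟩⟩ with h4 | h4
        · exact ⟨b₂, Finset.mem_inter.mpr ⟨h2, h4⟩⟩
        · exact absurd (h3.trans h4.symm) hne
    · exact ⟨y, Finset.mem_inter.mpr ⟨h, hy⟩⟩
  have grow : ∀ m, 1 ≤ m → m ≤ Z.card → ∃ P ⊆ Z, P.card = m ∧ H.Fillable A B P ∧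
      P.card ≤ (H.closedIn A B P).card + 1 := by
    intro m hm
    induction m, hm using Nat.le_induction with
    | base =>
      intro _
      obtain ⟨z, hz⟩ := hZne
      exact ⟨{z}, Finset.singleton_subset_iff.mpr hz, Finset.card_singleton _,
        hsingle z (hZB z hz), by simp⟩
    | succ m hm ih =>
      intro hmZ
      obtain ⟨P, hPZ, hPm, hPf, hPc⟩ := ih (by omega)
      have hrest : (Z \ P).Nonempty := by
        rw [← Finset.card_pos]
        have := Finset.card_sdiff_add_card_eq_card hPZ
        omega
      obtain ⟨b₀, hb₀⟩ : P.Nonempty := Finset.card_pos.mp (by omega)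
      -- If no vertex of `Y` saw both filled and unfilled vertices of `Z`, the unfilled vertices and
      -- those of `Y` without filled neighbours would be a smaller part attached at `x`. Having
      -- degree two, the vertex `a` is freed once `b` is added.
      have hex : ∃ a ∈ Y, ∃ p ∈ P, ∃ b ∈ Z \ P, H.Adj a p ∧ H.Adj a b := by
        by_contra! hstuck
        let U' := U.filter fun u => (u ∈ B' ∧ u ∉ P) ∨ (u ∈ A' ∧ ∀ p ∈ P, ¬ H.Adj u p)
        have hb₀' := Finset.mem_inter.mp (hPZ hb₀)
        have hb₀U' : b₀ ∉ U' := by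
          intro h
          rcases (Finset.mem_filter.mp h).2 with h | h
          · exact h.2 hb₀
          · exact hdisj _ h.1 hb₀'.1
        have hU'ne : U'.Nonempty := by
          obtain ⟨z, hz⟩ := hrest
          rw [Finset.mem_sdiff, hZ, Finset.mem_inter] at hz
          exact ⟨z, Finset.mem_filter.mpr ⟨hz.1.2, Or.inl ⟨hz.1.1, hz.2⟩⟩⟩
        obtain ⟨u, hu, w, huw, hw, hwx⟩ := hUmin U' (Finset.ssubset_iff_subset_ne.mpr
          ⟨Finset.filter_subset _ _, fun h => hb₀U' (h ▸ hb₀'.2)⟩) hU'ne x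
          (fun h => hx (Finset.mem_filter.mp h).1)
        obtain ⟨huU, hu'⟩ := Finset.mem_filter.mp hu
        have hwU := (hN u huU w huw).resolve_right hwx
        rcases huw.2 with ⟨huA, hwB⟩ | ⟨huB, hwA⟩
        · have h1 := (hu'.resolve_left fun h => hdisj u huA h.1).2
          exact hw (Finset.mem_filter.mpr ⟨hwU, Or.inl ⟨hwB, fun h => h1 w h huw.1⟩⟩)
        · have h1 := (hu'.resolve_right fun h => hdisj u h.1 huB).2
          refine hw (Finset.mem_filter.mpr ⟨hwU, Or.inr ⟨hwA, fun p hp hwp => ?_⟩⟩)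
          exact hstuck w (Finset.mem_inter.mpr ⟨hwA, hwU⟩) p hp u
            (Finset.mem_sdiff.mpr ⟨Finset.mem_inter.mpr ⟨huB, huU⟩, h1⟩) hwp huw.1.symm
      obtain ⟨a, ha, p, hp, b, hb, hap, hab⟩ := hex
      rw [hY, Finset.mem_inter] at ha
      rw [Finset.mem_sdiff] at hb
      have hbp : b ≠ p := fun h => hb.2 (h ▸ hp)
      have hcl : insert a (H.closedIn A B P) ⊆ H.closedIn A B (insert b P) := by
        refine Finset.insert_subset ?_ (closedIn_mono (Finset.subset_insert _ _))
        refine mem_closedIn.mpr ⟨hA'A a ha.1, fun b' hb' hab' => ?_⟩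
        by_cases h : b = b'
        · exact h ▸ Finset.mem_insert_self _ _
        · have := hdeg a ha.2 b b' p (hAadj a ha.1 b (hZB b hb.1) hab)
            (hAadj a ha.1 b' hb' hab') (hAadj a ha.1 p (hZB p (hPZ hp)) hap) h hbp
          exact Finset.mem_insert_of_mem (this ▸ hp)
      have hacl : a ∉ H.closedIn A B P := fun h =>
        hb.2 ((mem_closedIn.mp h).2 b (hZB b hb.1) hab)
      have h1 := Finset.card_le_card hcl
      rw [Finset.card_insert_of_notMem hacl] at h1
      refine ⟨insert b P, Finset.insert_subset hb.1 hPZ, ?_,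
        Fillable.step hPf (hZB b hb.1) hb.2 (by omega), ?_⟩
      · rw [Finset.card_insert_of_notMem hb.2, hPm]
      · rw [Finset.card_insert_of_notMem hb.2]
        omega
  have hZpos := Finset.card_pos.mpr hZne
  obtain ⟨P, hPZ, hPcard, hZf, hZc⟩ := grow Z.card (by omega) le_rfl
  obtain rfl : P = Z := Finset.eq_of_subset_of_card_le hPZ hPcard.ge
  by_cases hclosed : Z.card ≤ (H.closedIn A B Z).card
  · exact ⟨Z, fun z hz => hZB z hz, hZne, hZf, hclosed⟩
  have hcard2 : ∀ y ∈ U, ∀ T : Finset V, (∀ w, H'.Adj y w → w ∈ T) →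
      (T.filter (H'.Adj y)).card = 2 := by
    intro y hy T hT
    have hge : 1 < (T.filter (H'.Adj y)).card := by
      have : ∃ w₁ w₂, w₁ ≠ w₂ ∧ H'.Adj y w₁ ∧ H'.Adj y w₂ := by
        rcases Finset.mem_union.mp (hUS hy) with h | h
        · obtain ⟨b₁, h1, b₂, h2, hne, hy1, hy2⟩ := ha2 y h
          exact ⟨b₁, b₂, hne, ⟨hy1, Or.inl ⟨h, h1⟩⟩, ⟨hy2, Or.inl ⟨h, h2⟩⟩⟩
        · obtain ⟨b₁, h1, b₂, h2, hne, hy1, hy2⟩ := hb2 y h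
          exact ⟨b₁, b₂, hne, ⟨hy1, Or.inr ⟨h, h1⟩⟩, ⟨hy2, Or.inr ⟨h, h2⟩⟩⟩
      obtain ⟨w₁, w₂, hne, h1, h2⟩ := this
      exact Finset.one_lt_card.mpr ⟨w₁, Finset.mem_filter.mpr ⟨hT _ h1, h1⟩, w₂,
        Finset.mem_filter.mpr ⟨hT _ h2, h2⟩, hne⟩
    have hle : ¬ 2 < (T.filter (H'.Adj y)).card := by
      intro h
      obtain ⟨w₁, h1, w₂, h2, w₃, h3, h12, h13, h23⟩ := Finset.two_lt_card.mp h
      simp only [Finset.mem_filter] at h1 h2 h3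
      exact h23 (hdeg y hy w₁ w₂ w₃ h1.2 h2.2 h3.2 h12 h13)
    omega
  -- If `x` is in `B'`, counting edges gives `Y` more vertices than `Z`, and adding `x` frees all of
  -- `Y`. If not, `Z` has at most `Z.card` neighbours in `A'`, so `hcut` gives `Z = B'`, which pays
  -- for itself.
  by_cases hxB : x ∈ B'
  · have hxZ : x ∉ Z := fun h => hx (Finset.mem_inter.mp h).2
    have hcount := Finset.two_mul_card_eq_of_bipartite H'.Adj (Z := Y) (Y := Z) hxZ
      (fun y hy => by
        rw [hY, Finset.mem_inter] at hy
        refine hcard2 y hy.2 _ fun w hw => ?_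
        have hwB : w ∈ B' := by
          rcases hw.2 with h | h
          · exact h.2
          · exact absurd h.1 (hdisj y hy.1)
        rcases hN y hy.2 w hw with h | rfl
        · exact Finset.mem_insert_of_mem (Finset.mem_inter.mpr ⟨hwB, h⟩)
        · exact Finset.mem_insert_self _ _)
      (fun z hz => by
        rw [hZ, Finset.mem_inter] at hz
        simp only [H'.adj_comm _ z]
        refine hcard2 z hz.2 _ fun w hw => ?_
        have hwA : w ∈ A' := by
          rcases hw.2 with h | h
          · exact absurd hz.1 (hdisj z h.1)
          · exact h.2
        rcases hN z hz.2 w hw with h | rfl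
        · exact Finset.mem_inter.mpr ⟨hwA, h⟩
        · exact absurd hxB (hdisj _ hwA))
    have hsub : Y ⊆ H.closedIn A B (insert x Z) := by
      intro y hy
      have hy' := Finset.mem_inter.mp hy
      refine mem_closedIn.mpr ⟨hA'A y hy'.1, fun b hb hyb => ?_⟩
      rcases hN y hy'.2 b (hAadj y hy'.1 b hb hyb) with h | rfl
      · exact Finset.mem_insert_of_mem (Finset.mem_inter.mpr ⟨hA'N y hy'.1 b hb hyb, h⟩)
      · exact Finset.mem_insert_self _ _
    have hYcard := Finset.card_le_card hsub
    have hpos : 0 < (Y.filter fun y => H'.Adj y x).card := by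
      by_contra h0
      have h0' : (Y.filter fun y => H'.Adj y x) = ∅ := by
        rw [← Finset.card_eq_zero]; omega
      have hsub' : Y ⊆ H.closedIn A B Z := by
        intro y hy
        have hy' := Finset.mem_inter.mp hy
        have h1 := mem_closedIn.mp (hsub hy)
        refine mem_closedIn.mpr ⟨h1.1, fun b hb hyb => ?_⟩
        rcases Finset.mem_insert.mp (h1.2 b hb hyb) with rfl | h
        · have : y ∈ (∅ : Finset V) :=
            h0' ▸ Finset.mem_filter.mpr ⟨hy, hAadj y hy'.1 b hb hyb⟩
          exact absurd this (Finset.notMem_empty _)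
        · exact h
      have := Finset.card_le_card hsub'
      omega
    refine ⟨insert x Z, Finset.insert_subset (hB'B hxB) fun z hz => hZB z hz,
      Finset.insert_nonempty _ _, Fillable.step hZf (hB'B hxB) hxZ (by omega), ?_⟩
    rw [Finset.card_insert_of_notMem hxZ]
    omega
  · have hxY : x ∉ Y := fun h => hx (Finset.mem_inter.mp h).2
    have hzadj : ∀ z ∈ Z, ∀ w, H'.Adj z w → w ∈ insert x Y := by
      intro z hz w hw
      rw [hZ, Finset.mem_inter] at hz
      have hwA : w ∈ A' := by
        rcases hw.2 with h | h
        · exact absurd hz.1 (hdisj z h.1)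
        · exact h.2
      rcases hN z hz.2 w hw with h | rfl
      · exact Finset.mem_insert_of_mem (Finset.mem_inter.mpr ⟨hwA, h⟩)
      · exact Finset.mem_insert_self _ _
    have hcount := Finset.two_mul_card_eq_of_bipartite H'.Adj (Z := Z) (Y := Y) hxY
      (fun z hz => hcard2 z (Finset.mem_inter.mp hz).2 _ (hzadj z hz))
      (fun y hy => by
        rw [hY, Finset.mem_inter] at hy
        simp only [H'.adj_comm _ y]
        refine hcard2 y hy.2 _ fun w hw => ?_
        have hwB : w ∈ B' := by
          rcases hw.2 with h | h
          · exact h.2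
          · exact absurd h.1 (hdisj y hy.1)
        rcases hN y hy.2 w hw with h | rfl
        · exact Finset.mem_inter.mpr ⟨hwB, h⟩
        · exact absurd hwB hxB)
    have hNle : (A'.filter fun a => ∃ z ∈ Z, H.Adj a z).card ≤ Z.card := by
      have hsub : (A'.filter fun a => ∃ z ∈ Z, H.Adj a z) ⊆ insert x Y := by
        intro a ha
        obtain ⟨ha, z, hz, haz⟩ := Finset.mem_filter.mp ha
        exact hzadj z hz a (hAadj a ha z (hZB z hz) haz).symm
      by_cases h0 : (Z.filter fun z => H'.Adj z x) = ∅
      · have hsub' : (A'.filter fun a => ∃ z ∈ Z, H.Adj a z) ⊆ Y := by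
          intro a ha
          rcases Finset.mem_insert.mp (hsub ha) with rfl | h
          · obtain ⟨ha, z, hz, haz⟩ := Finset.mem_filter.mp ha
            have : z ∈ (∅ : Finset V) :=
              h0 ▸ Finset.mem_filter.mpr ⟨hz, (hAadj a ha z (hZB z hz) haz).symm⟩
            exact absurd this (Finset.notMem_empty _)
          · exact h
        have := Finset.card_le_card hsub'
        rw [h0, Finset.card_empty] at hcount
        omega
      · have h1 := Finset.card_pos.mpr (Finset.nonempty_iff_ne_empty.mpr h0)
        have h2 := Finset.card_le_card hsub
        rw [Finset.card_insert_of_notMem hxY] at h2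
        omega
    have hPB' := hcut Z Finset.inter_subset_left hZne hNle
    rw [hPB'] at hclosed
    exact absurd hB'card hclosed

/-- The piece `B₀` is set off against equally many vertices `A₀` that it frees. The rest still
satisfies the hypothesis, and `A₀` compensates for `B₀` in all later counts. -/
theorem HasCommonDetours.fillable {H : SimpleGraph V} (hH : H.HasCommonDetours)
    {A B : Finset V} (hAB : Disjoint A B) (hcard : B.card ≤ A.card) : H.Fillable A B B := by
  induction hn : B.card using Nat.strong_induction_on generalizing A B with
  | _ n ih =>
    subst hn
    rcases B.eq_empty_or_nonempty with rfl | hB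
    · exact Fillable.nil
    obtain ⟨B₀, hB₀, hne, hfill, hle⟩ := hH.exists_fillable hAB hB hcard
    obtain ⟨A₀, hA₀, hA₀card⟩ := Finset.exists_subset_card_eq hle
    have hA₀A : A₀ ⊆ A := fun a ha => (mem_closedIn.mp (hA₀ ha)).1
    have hc1 := Finset.card_sdiff_add_card_eq_card hB₀
    have hc2 := Finset.card_sdiff_add_card_eq_card hA₀A
    have hpos := Finset.card_pos.mpr hne
    have h := ih (B \ B₀).card (by omega) (A := A \ A₀) (B := B \ B₀)
      (hAB.mono Finset.sdiff_subset Finset.sdiff_subset) (by omega) rfl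
    have key : ∀ P, H.Fillable (A \ A₀) (B \ B₀) P → H.Fillable A B (B₀ ∪ P) := by
      intro P hP
      induction hP with
      | nil => rwa [Finset.union_empty]
      | @step P b hP hb hbP hPc ihP =>
        rw [Finset.mem_sdiff] at hb
        rw [Finset.union_insert]
        refine Fillable.step ihP hb.1 (by simp [hb.2, hbP]) ?_
        have hsub : A₀ ∪ H.closedIn (A \ A₀) (B \ B₀) (insert b P) ⊆
            H.closedIn A B (insert b (B₀ ∪ P)) := by
          intro a ha
          rcases Finset.mem_union.mp ha with ha | ha
          · exact closedIn_mono (Finset.subset_union_left.trans (Finset.subset_insert _ _))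
              (hA₀ ha)
          · rw [mem_closedIn, Finset.mem_sdiff] at ha
            refine mem_closedIn.mpr ⟨ha.1.1, fun b' hb' hab => ?_⟩
            by_cases hb'B₀ : b' ∈ B₀
            · simp [hb'B₀]
            · have := ha.2 b' (Finset.mem_sdiff.mpr ⟨hb', hb'B₀⟩) hab
              rw [Finset.mem_insert] at this ⊢
              exact this.imp id fun h => Finset.mem_union_right _ h
        have hdisj : Disjoint A₀ (H.closedIn (A \ A₀) (B \ B₀) (insert b P)) := by
          rw [Finset.disjoint_left]
          intro a ha ha'
          exact (Finset.mem_sdiff.mp (mem_closedIn.mp ha').1).2 ha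
        have h1 := Finset.card_le_card hsub
        rw [Finset.card_union_of_disjoint hdisj] at h1
        have h2 := Finset.card_union_le B₀ P
        omega
    have := key _ h
    rwa [Finset.union_sdiff_of_subset hB₀] at this

theorem Fillable.exists_sequence {H : SimpleGraph V} {A B P : Finset V} (h : H.Fillable A B P) :
    ∃ c : ℕ → Finset V, Monotone c ∧ (∀ i, P.card ≤ i → c i = P) ∧ (∀ i, c i ⊆ B) ∧
      ∀ i ≤ P.card, (c i).card = i ∧ i ≤ (H.closedIn A B (c i)).card + 2 := by
  induction h with
  | nil => exact ⟨fun _ => ∅, monotone_const, by simp, by simp, by simp⟩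
  | @step P b hP hb hbP hPc ih =>
    obtain ⟨c, hmono, hlast, hsub, hc⟩ := ih
    have hcP : ∀ i, c i ⊆ P := by
      intro i
      rcases le_total P.card i with h | h
      · exact (hlast i h).subset
      · exact (hmono h).trans (hlast _ le_rfl).subset
    have hPB : P ⊆ B := hlast _ le_rfl ▸ hsub _
    rw [Finset.card_insert_of_notMem hbP]
    refine ⟨fun i => if i ≤ P.card then c i else insert b P, ?_, ?_, ?_, ?_⟩
    · intro i j hij
      simp only
      split_ifs with h1 h2 h2
      · exact hmono hij
      · exact (hcP i).trans (Finset.subset_insert _ _)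
      · omega
      · exact subset_rfl
    · intro i hi
      simp only
      rw [if_neg (by omega)]
    · intro i
      simp only
      split_ifs
      · exact hsub i
      · exact Finset.insert_subset hb hPB
    · intro i hi
      simp only
      split_ifs with h1
      · exact hc i h1
      · obtain rfl : i = P.card + 1 := by omega
        exact ⟨Finset.card_insert_of_notMem hbP, hPc⟩

/-- A plan for replacing `A` by `B` in `q` steps: in every step, first vertices of `B` are added,
then vertices of `A` all of whose neighbours in `B` are present are removed. -/
structure ExchangePlan (H : SimpleGraph V) (A B : Finset V) (q : ℕ) (P R : ℕ → Finset V) : Prop where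
  mono_added : Monotone P
  mono_removed : Monotone R
  added_zero : P 0 = ∅
  removed_zero : R 0 = ∅
  added_last : P q = B
  removed_last : R q = A
  added_sub : ∀ j, P j ⊆ B
  removed_sub : ∀ j, R j ⊆ A
  adj_mem : ∀ j, ∀ a ∈ R j, ∀ b ∈ B, H.Adj a b → b ∈ P j
  card_le : ∀ j, (P (j + 1)).card ≤ (R j).card + 3 + B.card / q

/-- The filling order is cut into blocks of length `B.card / q + 1`. The excess 3 is the 2 of
`Fillable` plus 1 for rounding up the block length. -/
theorem HasCommonDetours.exists_exchangePlan {H : SimpleGraph V} (hH : H.HasCommonDetours)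
    {A B : Finset V} (hAB : Disjoint A B) (hcard : B.card ≤ A.card) {q : ℕ} (hq : 0 < q) :
    ∃ P R, H.ExchangePlan A B q P R := by
  obtain ⟨c, hmono, hlast, hsub, hc⟩ := (hH.fillable hAB hcard).exists_sequence
  set g := B.card / q + 1 with hg
  have hqg : B.card ≤ q * g := by
    have := Nat.lt_mul_div_succ B.card hq
    rw [hg]
    omega
  have hclosedB : H.closedIn A B B = A := by
    ext a
    rw [mem_closedIn]
    exact ⟨fun h => h.1, fun h => ⟨h, fun b hb _ => hb⟩⟩
  -- Nothing is removed at `j = 0`, although vertices of `A` without neighbours in `B` are free from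
  -- the start: the plan has to begin with `A` itself.
  refine ⟨fun j => c (j * g), fun j => if j = 0 then ∅ else H.closedIn A B (c (j * g)),
    fun i j hij => hmono (by gcongr), fun i j hij => ?_, ?_, if_pos rfl, hlast _ hqg, ?_,
    fun j => hsub _, fun j => ?_, fun j a ha => ?_, fun j => ?_⟩
  · split_ifs with h1 h2 h2
    · exact subset_rfl
    · exact Finset.empty_subset _
    · omega
    · exact closedIn_mono (hmono (by gcongr))
  · rw [zero_mul]
    exact Finset.card_eq_zero.mp (hc 0 (Nat.zero_le _)).1
  · rw [if_neg (by omega), hlast _ hqg, hclosedB]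
  · split_ifs
    · exact Finset.empty_subset _
    · exact fun a ha => (mem_closedIn.mp ha).1
  · split_ifs at ha
    · exact absurd ha (Finset.notMem_empty _)
    · exact (mem_closedIn.mp ha).2
  · have hle : (c ((j + 1) * g)).card ≤ (j + 1) * g := by
      rcases le_total ((j + 1) * g) B.card with h | h
      · exact (hc _ h).1.le
      · rw [hlast _ h]
        exact h
    split_ifs with h0
    · subst h0
      simp only [Finset.card_empty]
      omega
    · rcases le_total (j * g) B.card with h | h
      · have := (hc _ h).2
        rw [Nat.succ_mul] at hle ⊢
        omega
      · rw [hlast _ h, hclosedB]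
        have := Finset.card_le_card (hsub ((j + 1) * g))
        have := Nat.zero_le (B.card / q)
        omega

end SimpleGraph

/-! ### States of a class over time -/

namespace SimpleGraph

variable {V : Type*} [DecidableEq V]

open Classical in
/-- A canonical exchange plan, which depends only on the edges between `A` and `B`. -/
noncomputable def exchangePlan (G : SimpleGraph V) (A B : Finset V) (q : ℕ) :
    (ℕ → Finset V) × (ℕ → Finset V) :=
  if h : ∃ p : (ℕ → Finset V) × (ℕ → Finset V),
      (G.between (A : Set V) (B : Set V)).ExchangePlan A B q p.1 p.2 then h.choose
  else (fun _ => ∅, fun _ => ∅)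

/-- The set reached from `A` after `u` half-steps of the exchange plan. -/
noncomputable def exchangeStage (G : SimpleGraph V) (A B : Finset V) (q u : ℕ) : Finset V :=
  (A \ (G.exchangePlan A B q).2 (u / 2)) ∪ (G.exchangePlan A B q).1 ((u + 1) / 2)

/-- The state at time `t` of a class with the vertices `A` to be removed and `B` to be added: classes
that do not grow are exchanged in the first `2 * q` batches after the initial one, the others
in the following `2 * q` batches, along a reversed plan for the opposite exchange. -/
noncomputable def exchangeState (G : SimpleGraph V) (A B : Finset V) (q t : ℕ) : Finset V :=
  if B.card ≤ A.card then G.exchangeStage A B q (min (t - 1) (2 * q))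
  else G.exchangeStage B A q (min (2 * q) (4 * q + 1 - t))

section Stage

variable {G : SimpleGraph V} {A B : Finset V} {q : ℕ}

/-- The properties of the stages of an exchange plan from `A` to `B`. -/
structure IsExchange (G : SimpleGraph V) (A B : Finset V) (q : ℕ) (S : ℕ → Finset V) : Prop where
  zero : S 0 = A
  last : S (2 * q) = B
  subset : ∀ u, S u ⊆ A ∪ B
  cover : ∀ u, ∀ a ∈ A, ∀ b ∈ B, G.Adj a b → a ∈ S u ∨ b ∈ S u
  even : ∀ u, Even u → ∀ a ∈ A, a ∈ S u ↔ a ∈ S (u + 1)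
  odd : ∀ u, ¬ Even u → ∀ b ∈ B, b ∈ S u ↔ b ∈ S (u + 1)
  card_le : ∀ u, (S u ∪ S (u + 1)).card ≤ A.card + 3 + B.card / q

theorem isExchange_exchangeStage (hAB : Disjoint A B)
    (hG : (G.between (A : Set V) (B : Set V)).HasCommonDetours) (hcard : B.card ≤ A.card)
    (hq : 0 < q) : G.IsExchange A B q (G.exchangeStage A B q) := by
  classical
  have hex : ∃ p : (ℕ → Finset V) × (ℕ → Finset V),
      (G.between (A : Set V) (B : Set V)).ExchangePlan A B q p.1 p.2 := by
    obtain ⟨P, R, h⟩ := hG.exists_exchangePlan hAB hcard hq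
    exact ⟨(P, R), h⟩
  have hplan : (G.between (A : Set V) (B : Set V)).ExchangePlan A B q (G.exchangePlan A B q).1
      (G.exchangePlan A B q).2 := by
    rw [exchangePlan, dif_pos hex]
    exact hex.choose_spec
  unfold exchangeStage
  set P := (G.exchangePlan A B q).1
  set R := (G.exchangePlan A B q).2
  have memA : ∀ i j, ∀ a ∈ A, a ∈ A \ R i ∪ P j ↔ a ∉ R i := by
    intro i j a ha
    have : a ∉ P j := fun h => Finset.disjoint_left.mp hAB ha (hplan.added_sub j h)
    simp [ha, this]
  have memB : ∀ i j, ∀ b ∈ B, b ∈ A \ R i ∪ P j ↔ b ∈ P j := by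
    intro i j b hb
    have : b ∉ A := fun h => Finset.disjoint_left.mp hAB h hb
    simp [this]
  refine ⟨?_, ?_, fun u => ?_, fun u a ha b hb hab => ?_, fun u hu a ha => ?_,
    fun u hu b hb => ?_, fun u => ?_⟩
  · change A \ R 0 ∪ P 0 = A
    rw [hplan.removed_zero, hplan.added_zero]
    simp
  · rw [show 2 * q / 2 = q by omega, show (2 * q + 1) / 2 = q by omega, hplan.removed_last,
      hplan.added_last]
    simp
  · exact Finset.union_subset_union Finset.sdiff_subset (hplan.added_sub _)
  · rw [memA _ _ a ha, memB _ _ b hb, or_iff_not_imp_left, not_not]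
    intro haR
    exact hplan.mono_added (by omega) (hplan.adj_mem _ a haR b hb ⟨hab, Or.inl ⟨ha, hb⟩⟩)
  · rw [memA _ _ a ha, memA _ _ a ha]
    obtain ⟨i, rfl⟩ := hu
    rw [show (i + i + 1) / 2 = (i + i) / 2 by omega]
  · rw [memB _ _ b hb, memB _ _ b hb]
    obtain ⟨i, rfl⟩ := Nat.not_even_iff_odd.mp hu
    rw [show (2 * i + 1 + 1 + 1) / 2 = (2 * i + 1 + 1) / 2 by omega]
  · have hsub : A \ R (u / 2) ∪ P ((u + 1) / 2) ∪ (A \ R ((u + 1) / 2) ∪ P ((u + 1 + 1) / 2)) ⊆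
        (A \ R (u / 2)) ∪ P (u / 2 + 1) := by
      refine Finset.union_subset (Finset.union_subset_union subset_rfl
        (hplan.mono_added (by omega))) (Finset.union_subset_union
        (Finset.sdiff_subset_sdiff subset_rfl (hplan.mono_removed (by omega)))
        (hplan.mono_added (by omega)))
    have h1 := Finset.card_le_card hsub
    have h2 := Finset.card_union_le (A \ R (u / 2)) (P (u / 2 + 1))
    have h3 := Finset.card_sdiff_add_card_eq_card (hplan.removed_sub (u / 2))
    have h4 := hplan.card_le (u / 2)
    omega

/-- The properties of the states of a class in the schedule. -/
structure IsExchangeHistory (G : SimpleGraph V) (A B : Finset V) (q : ℕ) (S : ℕ → Finset V) :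
    Prop where
  zero : S 0 = A
  one : S 1 = A
  last : S (4 * q + 1) = B
  subset : ∀ t, S t ⊆ A ∪ B
  cover : ∀ t, ∀ a ∈ A, ∀ b ∈ B, G.Adj a b → a ∈ S t ∨ b ∈ S t
  odd : ∀ t, 1 ≤ t → t ≤ 4 * q → ¬ Even t → ∀ a ∈ A, a ∈ S t ↔ a ∈ S (t + 1)
  even : ∀ t, 1 ≤ t → t ≤ 4 * q → Even t → ∀ b ∈ B, b ∈ S t ↔ b ∈ S (t + 1)
  card_le_first : ∀ t, 1 ≤ t → t ≤ 2 * q →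
    (S t ∪ S (t + 1)).card ≤ A.card + 3 + B.card / q
  card_le_second : ∀ t, 2 * q < t → t ≤ 4 * q →
    (S t ∪ S (t + 1)).card ≤ B.card + 3 + A.card / q

/-- Running the opposite plan backwards turns removals of `B` into additions. The offsets are chosen
so that in both halves odd times change only `B` and even times only `A`. -/
theorem isExchangeHistory_exchangeState (hAB : Disjoint A B)
    (hG : (G.between (A : Set V) (B : Set V)).HasCommonDetours) (hq : 0 < q) :
    G.IsExchangeHistory A B q (G.exchangeState A B q) := by
  unfold exchangeState
  split_ifs with hcard
  · have h := isExchange_exchangeStage hAB hG hcard hq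
    set S := G.exchangeStage A B q
    refine ⟨?_, ?_, ?_, fun t => h.subset _, fun t => h.cover _, fun t h1 h2 ht a ha => ?_,
      fun t h1 h2 ht b hb => ?_, fun t h1 h2 => ?_, fun t h1 h2 => ?_⟩
    · simpa using h.zero
    · simpa using h.zero
    · rw [min_eq_right (by omega), h.last]
    · rcases le_or_gt t (2 * q) with h3 | h3
      · rw [min_eq_left (by omega), min_eq_left (by omega),
          show t + 1 - 1 = (t - 1) + 1 by omega]
        exact h.even _ (by rw [Nat.even_sub h1]; simp [ht]) a ha
      · rw [min_eq_right (by omega), min_eq_right (by omega)]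
    · rcases le_or_gt t (2 * q) with h3 | h3
      · rw [min_eq_left (by omega), min_eq_left (by omega),
          show t + 1 - 1 = (t - 1) + 1 by omega]
        exact h.odd _ (by rw [Nat.even_sub h1]; simp [ht]) b hb
      · rw [min_eq_right (by omega), min_eq_right (by omega)]
    · rw [min_eq_left (by omega), min_eq_left (by omega), show t + 1 - 1 = (t - 1) + 1 by omega]
      exact h.card_le _
    · rw [min_eq_right (by omega), min_eq_right (by omega), h.last, Finset.union_self, add_assoc]
      exact Nat.le_add_right _ _
  · have h := isExchange_exchangeStage (G := G) (q := q) hAB.symm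
      (by rwa [between_comm]) (by omega) hq
    set S := G.exchangeStage B A q
    refine ⟨?_, ?_, ?_, fun t => by rw [Finset.union_comm]; exact h.subset _,
      fun t a ha b hb hab => (h.cover _ b hb a ha hab.symm).symm, fun t h1 h2 ht a ha => ?_,
      fun t h1 h2 ht b hb => ?_, fun t h1 h2 => ?_, fun t h1 h2 => ?_⟩
    · rw [min_eq_left (by omega), h.last]
    · rw [min_eq_left (by omega), h.last]
    · simpa using h.zero
    · rcases le_or_gt t (2 * q) with h3 | h3
      · rw [min_eq_left (by omega), min_eq_left (by omega)]
      · rw [min_eq_right (by omega), min_eq_right (by omega),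
          show 4 * q + 1 - t = (4 * q - t) + 1 by omega, show 4 * q + 1 - (t + 1) = 4 * q - t by omega]
        refine (h.odd _ ?_ a ha).symm
        rw [Nat.even_sub h2]
        have : Even (4 * q) := ⟨2 * q, by ring⟩
        simp [ht, this]
    · rcases le_or_gt t (2 * q) with h3 | h3
      · rw [min_eq_left (by omega), min_eq_left (by omega)]
      · rw [min_eq_right (by omega), min_eq_right (by omega),
          show 4 * q + 1 - t = (4 * q - t) + 1 by omega, show 4 * q + 1 - (t + 1) = 4 * q - t by omega]
        refine (h.even _ ?_ b hb).symm
        rw [Nat.even_sub h2]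
        have : Even (4 * q) := ⟨2 * q, by ring⟩
        simp [ht, this]
    · rw [min_eq_left (by omega), min_eq_left (by omega), h.last, Finset.union_self, add_assoc]
      exact Nat.le_add_right _ _
    · rw [min_eq_right (by omega), min_eq_right (by omega),
        show 4 * q + 1 - t = (4 * q - t) + 1 by omega, show 4 * q + 1 - (t + 1) = 4 * q - t by omega,
        Finset.union_comm]
      exact h.card_le _

end Stage

/-! ### The global schedule -/

section Schedule

variable {ι : Type*} [DecidableEq ι]

open Classical in
/-- The vertices that are added in the first batch: those to be added that have a neighbour in
another class that is to be removed. -/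
noncomputable def crossingSet (G : SimpleGraph V) (κ : V → ι) (α β : Finset V) : Finset V :=
  (β \ α).filter fun b => ∃ a ∈ α \ β, G.Adj b a ∧ κ a ≠ κ b

/-- The schedule that exchanges the parts of `α \ β` and `β \ α` in every class of `κ`. -/
noncomputable def classSchedule (G : SimpleGraph V) (κ : V → ι) (α β : Finset V) (q t : ℕ) :
    Finset V :=
  (α ∩ β) ∪ (if t = 0 then ∅ else G.crossingSet κ α β) ∪
    (α ∆ β).filter fun v => v ∈ G.exchangeState ((α \ β).filter fun u => κ u = κ v)
      ((β \ α).filter fun u => κ u = κ v) q t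

/-- All classes change the same side in the same batch, and each side is independent because the
other cover misses it. Edges inside a class are covered by its own plan, edges between classes by
the crossing set, which stays until the last batch. In the first half the classes have total size at
most `(α \ β).card` plus excesses, in the second at most `(β \ α).card` plus excesses. -/
theorem isReconfigurationSchedule_classSchedule {G : SimpleGraph V} {κ : V → ι} {α β : Finset V}
    {q : ℕ} {s : ℝ} (hα : G.IsVertexCover (α : Set V)) (hβ : G.IsVertexCover (β : Set V))
    (hG : (G.between ((α \ β : Finset V) : Set V) ((β \ α : Finset V) : Set V)).HasCommonDetours)
    (hq : 0 < q)
    (hs : (max α.card β.card : ℝ) + (G.crossingSet κ α β).card + 3 * ((α ∆ β).image κ).card +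
      (max α.card β.card : ℝ) / q ≤ s) :
    IsReconfigurationSchedule G α β (4 * q + 1) s (G.classSchedule κ α β q) := by
  classical
  set A : ι → Finset V := fun l => (α \ β).filter fun u => κ u = l with hA
  set B : ι → Finset V := fun l => (β \ α).filter fun u => κ u = l with hB
  obtain ⟨X, hX⟩ : ∃ X, X = G.crossingSet κ α β := ⟨_, rfl⟩
  rw [← hX] at hs
  let st : ι → ℕ → Finset V := fun l => G.exchangeState (A l) (B l) q
  have hXβ : X ⊆ β \ α := hX ▸ Finset.filter_subset _ _
  have hdisj : ∀ l, Disjoint (A l) (B l) := by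
    intro l
    rw [Finset.disjoint_left]
    intro v hv hv'
    exact (Finset.mem_sdiff.mp (Finset.mem_filter.mp hv).1).2
      (Finset.mem_sdiff.mp (Finset.mem_filter.mp hv').1).1
  have hist : ∀ l, G.IsExchangeHistory (A l) (B l) q (st l) := by
    intro l
    refine isExchangeHistory_exchangeState (hdisj l) (hG.mono ?_) hq
    intro u w h
    refine ⟨h.1, h.2.imp (fun h => ⟨?_, ?_⟩) fun h => ⟨?_, ?_⟩⟩
    · exact (Finset.mem_filter.mp h.1).1
    · exact (Finset.mem_filter.mp h.2).1
    · exact (Finset.mem_filter.mp h.1).1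
    · exact (Finset.mem_filter.mp h.2).1
  have memA : ∀ v ∈ α \ β, v ∈ A (κ v) := fun v hv => Finset.mem_filter.mpr ⟨hv, rfl⟩
  have memB : ∀ v ∈ β \ α, v ∈ B (κ v) := fun v hv => Finset.mem_filter.mpr ⟨hv, rfl⟩
  have memS : ∀ t v, v ∈ G.classSchedule κ α β q t ↔
      (v ∈ α ∧ v ∈ β) ∨ (t ≠ 0 ∧ v ∈ X) ∨ (v ∈ α ∆ β ∧ v ∈ st (κ v) t) := by
    intro t v
    rw [classSchedule, Finset.mem_union, Finset.mem_union, Finset.mem_inter, Finset.mem_filter,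
      or_assoc]
    refine or_congr_right (or_congr_left ?_)
    split_ifs with h
    · simp [h]
    · simp [h, hX]
  clear_value st
  have indepA : ∀ u w, u ∉ β → w ∉ β → ¬ G.Adj u w := fun u w hu hw h =>
    (hβ h).elim (fun h => hu h) fun h => hw h
  have indepB : ∀ u w, u ∉ α → w ∉ α → ¬ G.Adj u w := fun u w hu hw h =>
    (hα h).elim (fun h => hu h) fun h => hw h
  have hcover : ∀ t, ∀ u w, G.Adj u w → u ∈ α \ β → w ∈ β \ α →
      u ∈ G.classSchedule κ α β q t ∨ w ∈ G.classSchedule κ α β q t := by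
    intro t u w huw hu hw
    have hu' : u ∈ α ∆ β := by rw [Finset.mem_symmDiff]; exact Or.inl (Finset.mem_sdiff.mp hu)
    have hw' : w ∈ α ∆ β := by rw [Finset.mem_symmDiff]; exact Or.inr (Finset.mem_sdiff.mp hw)
    by_cases ht : t = 0
    · left
      rw [memS]
      refine Or.inr (Or.inr ⟨hu', ?_⟩)
      rw [ht, (hist (κ u)).zero]
      exact memA u hu
    by_cases hκ : κ u = κ w
    · rcases (hist (κ u)).cover t u (memA u hu) w (hκ ▸ memB w hw) huw with h | h
      · exact Or.inl ((memS t u).mpr (Or.inr (Or.inr ⟨hu', h⟩)))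
      · exact Or.inr ((memS t w).mpr (Or.inr (Or.inr ⟨hw', hκ ▸ h⟩)))
    · right
      rw [memS]
      exact Or.inr (Or.inl ⟨ht, hX ▸ Finset.mem_filter.mpr ⟨hw, u, hu, huw.symm, hκ⟩⟩)
  have hzero : G.classSchedule κ α β q 0 = α := by
    ext v
    rw [memS]
    constructor
    · rintro (h | h | ⟨h1, h2⟩)
      · exact h.1
      · exact absurd rfl h.1
      · rw [(hist _).zero] at h2
        exact (Finset.mem_sdiff.mp (Finset.mem_filter.mp h2).1).1
    · intro hv
      by_cases hvβ : v ∈ β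
      · exact Or.inl ⟨hv, hvβ⟩
      · refine Or.inr (Or.inr ⟨by rw [Finset.mem_symmDiff]; exact Or.inl ⟨hv, hvβ⟩, ?_⟩)
        rw [(hist _).zero]
        exact memA v (Finset.mem_sdiff.mpr ⟨hv, hvβ⟩)
  have hone : G.classSchedule κ α β q 1 = α ∪ X := by
    ext v
    have h0 := memS 0 v
    rw [hzero, (hist _).zero] at h0
    rw [memS, Finset.mem_union, (hist _).one]
    constructor
    · rintro (h | h | h)
      · exact Or.inl h.1
      · exact Or.inr h.2
      · exact Or.inl (h0.mpr (Or.inr (Or.inr h)))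
    · rintro (h | h)
      · rcases h0.mp h with h | h | h
        · exact Or.inl h
        · exact absurd rfl h.1
        · exact Or.inr (Or.inr h)
      · exact Or.inr (Or.inl ⟨one_ne_zero, h⟩)
  have hlast : G.classSchedule κ α β q (4 * q + 1) = β := by
    ext v
    rw [memS]
    constructor
    · rintro (h | h | ⟨h1, h2⟩)
      · exact h.2
      · exact (Finset.mem_sdiff.mp (hXβ h.2)).1
      · rw [(hist _).last] at h2
        exact (Finset.mem_sdiff.mp (Finset.mem_filter.mp h2).1).1
    · intro hv
      by_cases hvα : v ∈ α
      · exact Or.inl ⟨hvα, hv⟩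
      · refine Or.inr (Or.inr ⟨by rw [Finset.mem_symmDiff]; exact Or.inr ⟨hv, hvα⟩, ?_⟩)
        rw [(hist _).last]
        exact memB v (Finset.mem_sdiff.mpr ⟨hv, hvα⟩)
  have cardA : ∑ l ∈ (α ∆ β).image κ, (A l).card = (α \ β).card :=
    (Finset.card_eq_sum_card_fiberwise fun v hv => Finset.mem_image_of_mem κ
      (Finset.mem_symmDiff.mpr (Or.inl (Finset.mem_sdiff.mp hv)))).symm
  have cardB : ∑ l ∈ (α ∆ β).image κ, (B l).card = (β \ α).card :=
    (Finset.card_eq_sum_card_fiberwise fun v hv => Finset.mem_image_of_mem κ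
      (Finset.mem_symmDiff.mpr (Or.inr (Finset.mem_sdiff.mp hv)))).symm
  have hdiv : ∀ C : ι → Finset V, (((∑ l ∈ (α ∆ β).image κ, (C l).card / q : ℕ)) : ℝ) ≤
      ((∑ l ∈ (α ∆ β).image κ, (C l).card : ℕ) : ℝ) / q := by
    intro C
    rw [Nat.cast_sum, Nat.cast_sum, Finset.sum_div]
    exact Finset.sum_le_sum fun l _ => Nat.cast_div_le
  have hbound : ∀ t, 1 ≤ t → ∀ C D : ι → Finset V,
      (∀ l, (st l t ∪ st l (t + 1)).card ≤ (C l).card + 3 + (D l).card / q) →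
      ((G.classSchedule κ α β q t ∪ G.classSchedule κ α β q (t + 1)).card : ℝ) ≤
        (α ∩ β).card + X.card + (∑ l ∈ (α ∆ β).image κ, (C l).card : ℕ) +
          3 * ((α ∆ β).image κ).card + (∑ l ∈ (α ∆ β).image κ, (D l).card : ℕ) / q := by
    intro t ht C D h
    have hsub : G.classSchedule κ α β q t ∪ G.classSchedule κ α β q (t + 1) ⊆
        (α ∩ β) ∪ X ∪ ((α ∆ β).image κ).biUnion fun l => st l t ∪ st l (t + 1) := by
      intro v hv
      rw [Finset.mem_union, memS, memS] at hv
      rw [Finset.mem_union, Finset.mem_union, Finset.mem_inter, Finset.mem_biUnion]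
      rcases hv with (h | h | h) | (h | h | h)
      · exact Or.inl (Or.inl h)
      · exact Or.inl (Or.inr h.2)
      · exact Or.inr ⟨_, Finset.mem_image_of_mem κ h.1, Finset.mem_union_left _ h.2⟩
      · exact Or.inl (Or.inl h)
      · exact Or.inl (Or.inr h.2)
      · exact Or.inr ⟨_, Finset.mem_image_of_mem κ h.1, Finset.mem_union_right _ h.2⟩
    have h1 := Finset.card_le_card hsub
    have h2 := Finset.card_union_le (α ∩ β ∪ X)
      (((α ∆ β).image κ).biUnion fun l => st l t ∪ st l (t + 1))
    have h3 := Finset.card_union_le (α ∩ β) X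
    have h4 : (((α ∆ β).image κ).biUnion fun l => st l t ∪ st l (t + 1)).card ≤
        ∑ l ∈ (α ∆ β).image κ, (C l).card + 3 * ((α ∆ β).image κ).card +
          ∑ l ∈ (α ∆ β).image κ, (D l).card / q := by
      refine Finset.card_biUnion_le.trans ((Finset.sum_le_sum fun l _ => h l).trans_eq ?_)
      rw [Finset.sum_add_distrib, Finset.sum_add_distrib, Finset.sum_const, smul_eq_mul,
        mul_comm 3]
    have h5 : (G.classSchedule κ α β q t ∪ G.classSchedule κ α β q (t + 1)).card ≤
        (α ∩ β).card + X.card + ∑ l ∈ (α ∆ β).image κ, (C l).card +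
          3 * ((α ∆ β).image κ).card + ∑ l ∈ (α ∆ β).image κ, (D l).card / q := by omega
    have h6 : ((G.classSchedule κ α β q t ∪ G.classSchedule κ α β q (t + 1)).card : ℝ) ≤
        (α ∩ β).card + X.card + (∑ l ∈ (α ∆ β).image κ, (C l).card : ℕ) +
          3 * ((α ∆ β).image κ).card + (∑ l ∈ (α ∆ β).image κ, (D l).card / q : ℕ) := by
      exact_mod_cast h5
    have := hdiv D
    linarith
  have hqpos : (0 : ℝ) < q := by exact_mod_cast hq
  have hα' : ((α ∩ β).card : ℝ) + (α \ β).card = α.card := by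
    exact_mod_cast Finset.card_inter_add_card_sdiff α β
  have hβ' : ((α ∩ β).card : ℝ) + (β \ α).card = β.card := by
    rw [Finset.inter_comm]
    exact_mod_cast Finset.card_inter_add_card_sdiff β α
  have hmaxα : (α.card : ℝ) ≤ max (α.card : ℝ) β.card := le_max_left _ _
  have hmaxβ : (β.card : ℝ) ≤ max (α.card : ℝ) β.card := le_max_right _ _
  refine ⟨fun t _ u w huw => ?_, hzero, hlast, fun t ht => ?_, fun t ht u hu w hw _ huw => ?_⟩
  · have h1 := hα huw
    have h2 := hβ huw
    simp only [Finset.mem_coe] at h1 h2 ⊢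
    by_cases hu : u ∈ α ∧ u ∈ β
    · exact Or.inl ((memS t u).mpr (Or.inl hu))
    by_cases hw : w ∈ α ∧ w ∈ β
    · exact Or.inr ((memS t w).mpr (Or.inl hw))
    by_cases huα : u ∈ α
    · have huβ : u ∉ β := fun h => hu ⟨huα, h⟩
      have hwβ := h2.resolve_left huβ
      exact hcover t u w huw (Finset.mem_sdiff.mpr ⟨huα, huβ⟩)
        (Finset.mem_sdiff.mpr ⟨hwβ, fun h => hw ⟨h, hwβ⟩⟩)
    · have hwα := h1.resolve_left huα
      have hwβ : w ∉ β := fun h => hw ⟨hwα, h⟩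
      exact (hcover t w u huw.symm (Finset.mem_sdiff.mpr ⟨hwα, hwβ⟩)
        (Finset.mem_sdiff.mpr ⟨h2.resolve_right hwβ, huα⟩)).symm
  · refine le_trans ?_ hs
    have hnn : 0 ≤ max (α.card : ℝ) β.card / q := by positivity
    rcases Nat.eq_zero_or_pos t with rfl | ht0
    · rw [hzero, hone]
      have h1 : (α ∪ (α ∪ X)).card ≤ α.card + X.card := by
        rw [← Finset.union_assoc, Finset.union_self]
        exact Finset.card_union_le _ _
      have h2 : ((α ∪ (α ∪ X)).card : ℝ) ≤ α.card + X.card := by exact_mod_cast h1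
      have h3 : (0 : ℝ) ≤ 3 * ((α ∆ β).image κ).card := by positivity
      linarith
    · rcases le_or_gt t (2 * q) with h | h
      · have := hbound t ht0 A B fun l => (hist l).card_le_first t ht0 h
        rw [cardA, cardB] at this
        have h2 : ((β \ α).card : ℝ) / q ≤ max (α.card : ℝ) β.card / q := by
          gcongr
          have : (0 : ℝ) ≤ (α ∩ β).card := by positivity
          linarith
        linarith
      · have := hbound t ht0 B A fun l => (hist l).card_le_second t h (by omega)
        rw [cardA, cardB] at this
        have h2 : ((α \ β).card : ℝ) / q ≤ max (α.card : ℝ) β.card / q := by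
          gcongr
          have : (0 : ℝ) ≤ (α ∩ β).card := by positivity
          linarith
        linarith
  · simp only [Finset.mem_coe, Finset.mem_symmDiff] at hu hw
    have hcases : (∀ v, ¬ (v ∈ G.classSchedule κ α β q t ↔ v ∈ G.classSchedule κ α β q (t + 1)) →
        v ∉ α) ∨ (∀ v, ¬ (v ∈ G.classSchedule κ α β q t ↔
          v ∈ G.classSchedule κ α β q (t + 1)) → v ∉ β) := by
      rcases Nat.eq_zero_or_pos t with rfl | ht0
      · left
        intro v hv hvα
        apply hv
        rw [hzero, hone, Finset.mem_union]
        exact ⟨fun _ => Or.inl hvα, fun _ => hvα⟩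
      · have hchange : ∀ v, ¬ (v ∈ G.classSchedule κ α β q t ↔
            v ∈ G.classSchedule κ α β q (t + 1)) →
            v ∈ α ∆ β ∧ ¬ (v ∈ st (κ v) t ↔ v ∈ st (κ v) (t + 1)) := by
          intro v hv
          rw [memS, memS] at hv
          have e : (t ≠ 0 ∧ v ∈ X) ↔ (t + 1 ≠ 0 ∧ v ∈ X) := and_congr_left fun _ => by omega
          refine ⟨?_, fun h2 => hv (by rw [e, h2])⟩
          by_contra h1
          exact hv (by simp only [e, h1, false_and])
        by_cases hev : Even t
        · right
          intro v hv hvβ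
          obtain ⟨h1, h2⟩ := hchange v hv
          rcases Finset.mem_symmDiff.mp h1 with h3 | h3
          · exact h3.2 hvβ
          · exact h2 ((hist _).even t ht0 (by omega) hev v (memB v (Finset.mem_sdiff.mpr h3)))
        · left
          intro v hv hvα
          obtain ⟨h1, h2⟩ := hchange v hv
          rcases Finset.mem_symmDiff.mp h1 with h3 | h3
          · exact h2 ((hist _).odd t ht0 (by omega) hev v (memA v (Finset.mem_sdiff.mpr h3)))
          · exact h3.2 hvα
    have hne : ∀ {p r : Prop}, (p ∧ ¬ r) ∨ (r ∧ ¬ p) → ¬ (p ↔ r) := fun h e =>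
      h.elim (fun h => h.2 (e.mp h.1)) fun h => h.2 (e.mpr h.1)
    rcases hcases with h | h
    · exact indepB u w (h u (hne hu)) (h w (hne hw)) huw
    · exact indepA u w (h u (hne hu)) (h w (hne hw)) huw

end Schedule

end SimpleGraph

/-! ### Classes of an instance and their number -/

/-- `L` clusters every graph of vertices less than `N` into clusters that have at least `s` vertices
or are components, with all leaders within distance `ρ`, and it is determined by the ball of
radius `T`. -/
structure IsLocalClustering (N s ρ T : ℕ) (L : SimpleGraph ℕ → ℕ → ℕ) : Prop where
  isClustering : ∀ Γ : SimpleGraph ℕ, (∀ u w, Γ.Adj u w → u < N) → Γ.IsClustering (L Γ)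
  large : ∀ Γ : SimpleGraph ℕ, (∀ u w, Γ.Adj u w → u < N) → ∀ v,
    (s : ℕ∞) ≤ {u | L Γ u = L Γ v}.encard ∨ ∀ u w, L Γ u = L Γ v → Γ.Adj u w → L Γ w = L Γ v
  mem_walkBall : ∀ Γ : SimpleGraph ℕ, (∀ u w, Γ.Adj u w → u < N) → ∀ v, L Γ v ∈ Γ.walkBall v ρ
  eq_of_agreeOn : ∀ Γ Γ' : SimpleGraph ℕ, (∀ u w, Γ.Adj u w → u < N) →
    (∀ u w, Γ'.Adj u w → u < N) → ∀ v, Γ.AgreeOn Γ' v T → L Γ v = L Γ' v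

namespace CoverInstance

/-- The graph induced by the vertices that belong to exactly one of the two covers. -/
def diffGraph (Γ : SimpleGraph ℕ) (x : ℕ → Bool × Bool) : SimpleGraph ℕ where
  Adj u w := Γ.Adj u w ∧ (x u).1 ≠ (x u).2 ∧ (x w).1 ≠ (x w).2
  symm := ⟨fun _ _ h => ⟨h.1.symm, h.2.2, h.2.1⟩⟩
  loopless := ⟨fun _ h => Γ.loopless.irrefl _ h.1⟩

/-- The vertex belongs to one of the two covers. -/
def Covered (x : ℕ → Bool × Bool) (v : ℕ) : Prop := (x v).1 = true ∨ (x v).2 = true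

/-- The graph that joins vertices of the covers at distance at most two. -/
def nearGraph (Γ : SimpleGraph ℕ) (x : ℕ → Bool × Bool) : SimpleGraph ℕ where
  Adj u w := u ≠ w ∧ Covered x u ∧ Covered x w ∧ (Γ.Adj u w ∨ ∃ z, Γ.Adj u z ∧ Γ.Adj z w)
  symm := ⟨fun _ _ h => ⟨h.1.symm, h.2.2.1, h.2.1,
    h.2.2.2.imp (fun h => h.symm) fun ⟨z, h, h'⟩ => ⟨z, h'.symm, h.symm⟩⟩⟩
  loopless := ⟨fun _ h => h.1 rfl⟩

/-- The vertices less than `N` that `f` marks. -/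
def marked (N : ℕ) (f : ℕ → Bool) : Finset ℕ := (Finset.range N).filter fun v => f v = true

/-- Two vertex covers of a connected graph of vertices less than `N` whose difference induces a
graph with common detours. -/
structure IsInstance (N : ℕ) (Γ : SimpleGraph ℕ) (x : ℕ → Bool × Bool) : Prop where
  covered_lt : ∀ v, Covered x v → v < N
  adj_lt : ∀ u w, Γ.Adj u w → u < N
  cover_fst : ∀ u w, Γ.Adj u w → (x u).1 = true ∨ (x w).1 = true
  cover_snd : ∀ u w, Γ.Adj u w → (x u).2 = true ∨ (x w).2 = true
  reachable : ∀ u w, Covered x u → Covered x w → Γ.Reachable u w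
  detours : (diffGraph Γ x).HasCommonDetours

open Classical in
/-- The class of a vertex: its cluster in the difference graph if that is large, and otherwise the
cluster of its component in the near graph. -/
noncomputable def label (L : SimpleGraph ℕ → ℕ → ℕ) (s : ℕ) (Γ : SimpleGraph ℕ)
    (x : ℕ → Bool × Bool) (v : ℕ) : Bool × ℕ :=
  if (s : ℕ∞) ≤ {u | L (diffGraph Γ x) u = L (diffGraph Γ x) v}.encard then
    (true, L (diffGraph Γ x) v)
  else (false, L (nearGraph Γ x) (L (diffGraph Γ x) v))

section Counting

variable {N s ρ T : ℕ} {L : SimpleGraph ℕ → ℕ → ℕ} {Γ : SimpleGraph ℕ} {x : ℕ → Bool × Bool}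

theorem diffGraph_adj_lt (hΓ : ∀ u w, Γ.Adj u w → u < N) :
    ∀ u w, (diffGraph Γ x).Adj u w → u < N := fun u w h => hΓ u w h.1

theorem nearGraph_adj_lt (hΓ : ∀ u w, Γ.Adj u w → u < N) :
    ∀ u w, (nearGraph Γ x).Adj u w → u < N := by
  rintro u w ⟨-, -, -, h | ⟨z, h, -⟩⟩
  · exact hΓ _ _ h
  · exact hΓ _ _ h

theorem mem_marked_fst (h : IsInstance N Γ x) {v : ℕ} :
    v ∈ marked N (fun v => (x v).1) ↔ (x v).1 = true := by
  rw [marked, Finset.mem_filter, Finset.mem_range]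
  exact ⟨fun h => h.2, fun hv => ⟨h.covered_lt v (Or.inl hv), hv⟩⟩

theorem mem_marked_snd (h : IsInstance N Γ x) {v : ℕ} :
    v ∈ marked N (fun v => (x v).2) ↔ (x v).2 = true := by
  rw [marked, Finset.mem_filter, Finset.mem_range]
  exact ⟨fun h => h.2, fun hv => ⟨h.covered_lt v (Or.inr hv), hv⟩⟩

theorem mem_symmDiff_marked (h : IsInstance N Γ x) {v : ℕ} :
    v ∈ marked N (fun v => (x v).1) ∆ marked N (fun v => (x v).2) ↔ (x v).1 ≠ (x v).2 := by
  rw [Finset.mem_symmDiff, mem_marked_fst h, mem_marked_snd h]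
  cases (x v).1 <;> cases (x v).2 <;> simp

/-- An uncovered vertex has only covered neighbours, so a walk never visits two uncovered vertices
in a row. At an uncovered vertex the induction keeps its predecessor. -/
theorem nearGraph_reachable (h : IsInstance N Γ x) {u w : ℕ} (hu : Covered x u)
    (hw : Covered x w) : (nearGraph Γ x).Reachable u w := by
  obtain ⟨p⟩ := h.reachable u w hu hw
  suffices ∀ a, Γ.Walk a w → (Covered x a → (nearGraph Γ x).Reachable a w) ∧
      (¬ Covered x a → ∀ u, Γ.Adj u a → Covered x u → (nearGraph Γ x).Reachable u w) from
    (this u p).1 hu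
  clear p
  intro a p
  induction p with
  | nil => exact ⟨fun _ => SimpleGraph.Reachable.refl _, fun h => absurd hw h⟩
  | @cons a b _ hab _ ih =>
    obtain ⟨ih1, ih2⟩ := ih hw
    refine ⟨fun ha => ?_, fun ha u hua hu => ?_⟩
    · by_cases hb : Covered x b
      · have : (nearGraph Γ x).Adj a b := ⟨hab.ne, ha, hb, Or.inl hab⟩
        exact this.reachable.trans (ih1 hb)
      · exact ih2 hb a hab ha
    · have hb : Covered x b := Or.inl ((h.cover_fst a b hab).resolve_left fun h => ha (Or.inl h))
      by_cases hub : u = b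
      · exact hub ▸ ih1 hb
      · have : (nearGraph Γ x).Adj u b := ⟨hub, hu, hb, Or.inr ⟨a, hua, hab⟩⟩
        exact this.reachable.trans (ih1 hb)

theorem of_reachable {H : SimpleGraph ℕ} {p : ℕ → Prop} (hp : ∀ u w, H.Adj u w → p u) {u w : ℕ}
    (h : H.Reachable u w) (hw : p w) : p u := by
  obtain ⟨q⟩ := h
  cases q with
  | nil => exact hw
  | cons h _ => exact hp _ _ h

theorem label_eq_of_eq {u w : ℕ} (h : L (diffGraph Γ x) u = L (diffGraph Γ x) w) :
    label L s Γ x u = label L s Γ x w := by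
  simp only [label, h]

/-- Clusters that consist of at least `s` elements of `W` are few. -/
theorem mul_card_image_le {f : ℕ → ℕ} {W : Finset ℕ}
    (hW : ∀ v ∈ W, ∀ u, f u = f v → u ∈ W) (hlarge : ∀ v ∈ W, (s : ℕ∞) ≤ {u | f u = f v}.encard) :
    s * (W.image f).card ≤ W.card := by
  refine Finset.mul_card_image_le_card W s fun y hy => ?_
  obtain ⟨v, hv, rfl⟩ := Finset.mem_image.mp hy
  have h : {u | f u = f v} ⊆ ((W.filter fun u => f u = f v : Finset ℕ) : Set ℕ) := by
    intro u hu
    rw [Finset.mem_coe, Finset.mem_filter]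
    exact ⟨hW v hv u hu, hu⟩
  have := (hlarge v hv).trans (Set.encard_le_encard h)
  rw [Set.encard_coe_eq_coe_finsetCard] at this
  exact_mod_cast this

/-- An edge between classes joins two large clusters of the difference graph, since a small one is a
component; hence at most `2 * N₀` crossing vertices and at most `N₀ + N₁` classes. Large clusters
number at most |α ∪ β| / s, and the near graph contributes at most as many or a single cluster. -/
theorem card_crossingSet_add_le (hL : IsLocalClustering N s ρ T L) (h : IsInstance N Γ x)
    (α β : Finset ℕ) (hα : α = marked N fun v => (x v).1) (hβ : β = marked N fun v => (x v).2) :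
    s * ((Γ.crossingSet (label L s Γ x) α β).card +
      3 * ((α ∆ β).image (label L s Γ x)).card) ≤ 16 * max α.card β.card + 3 * s := by
  classical
  have memα : ∀ v, v ∈ α ↔ (x v).1 = true := fun v => hα ▸ mem_marked_fst h
  have memβ : ∀ v, v ∈ β ↔ (x v).2 = true := fun v => hβ ▸ mem_marked_snd h
  have memW : ∀ v, v ∈ α ∆ β ↔ (x v).1 ≠ (x v).2 := fun v => by
    rw [hα, hβ]
    exact mem_symmDiff_marked h
  have memC : ∀ v, v ∈ α ∪ β ↔ Covered x v := fun v => by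
    rw [Finset.mem_union, memα, memβ, Covered]
  have hH := diffGraph_adj_lt (x := x) h.adj_lt
  have hK := nearGraph_adj_lt (x := x) h.adj_lt
  have hclH := hL.isClustering _ hH
  have hclK := hL.isClustering _ hK
  have hlargeH := hL.large _ hH
  have hlargeK := hL.large _ hK
  set H := diffGraph Γ x
  set K := nearGraph Γ x
  set W₀ := (α ∆ β).filter fun v => (s : ℕ∞) ≤ {u | L H u = L H v}.encard with hW₀
  have h0 : s * (W₀.image (L H)).card ≤ W₀.card := by
    refine mul_card_image_le (fun v hv u hu => ?_) fun v hv => (Finset.mem_filter.mp hv).2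
    obtain ⟨hv1, hv2⟩ := Finset.mem_filter.mp hv
    refine Finset.mem_filter.mpr ⟨(memW u).mpr ?_, by rw [hu]; exact hv2⟩
    exact of_reachable (H := H) (p := fun u => (x u).1 ≠ (x u).2) (fun _ _ h => h.2.1)
      ((hclH.reachable hu).mono (H.intra_le _)) ((memW v).mp hv1)
  have h0' : W₀.card ≤ 2 * max α.card β.card := by
    have h1 : W₀ ⊆ α ∪ β := by
      intro v hv
      have := (memW v).mp (Finset.mem_filter.mp hv).1
      rw [memC, Covered]
      revert this
      cases (x v).1 <;> cases (x v).2 <;> simp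
    have h2 := Finset.card_le_card h1
    have h3 := Finset.card_union_le α β
    omega
  have h1 : s * ((α ∪ β).image (L K)).card ≤ 2 * max α.card β.card ∨
      ((α ∪ β).image (L K)).card ≤ 1 := by
    by_cases hall : ∀ v ∈ α ∪ β, (s : ℕ∞) ≤ {u | L K u = L K v}.encard
    · left
      have h2 : s * ((α ∪ β).image (L K)).card ≤ (α ∪ β).card := by
        refine mul_card_image_le (fun v hv u hu => (memC u).mpr ?_) hall
        exact of_reachable (H := K) (p := Covered x) (fun _ _ h => h.2.1)
          ((hclK.reachable hu).mono (K.intra_le _)) ((memC v).mp hv)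
      have h3 := Finset.card_union_le α β
      omega
    · right
      push Not at hall
      obtain ⟨v, hv, hlt⟩ := hall
      have hclosed := (hlargeK v).resolve_left (not_le.mpr hlt)
      have hr : ∀ a b, K.Reachable a b → L K a = L K v → L K b = L K v := by
        rintro a b ⟨p⟩
        induction p with
        | nil => exact id
        | cons h _ ih => exact fun ha => ih (hclosed _ _ ha h)
      rw [Finset.card_le_one]
      intro a ha b hb
      obtain ⟨a, ha', rfl⟩ := Finset.mem_image.mp ha
      obtain ⟨b, hb', rfl⟩ := Finset.mem_image.mp hb
      rw [hr v a (nearGraph_reachable h ((memC v).mp hv) ((memC a).mp ha')) rfl,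
        hr v b (nearGraph_reachable h ((memC v).mp hv) ((memC b).mp hb')) rfl]
  have h2 : ((α ∆ β).image (label L s Γ x)).card ≤
      (W₀.image (L H)).card + ((α ∪ β).image (L K)).card := by
    have hsub : (α ∆ β).image (label L s Γ x) ⊆ (W₀.image (L H)).image (Prod.mk true) ∪
        ((α ∪ β).image (L K)).image (Prod.mk false) := by
      intro y hy
      obtain ⟨v, hv, rfl⟩ := Finset.mem_image.mp hy
      rw [label]
      split_ifs with hbig
      · exact Finset.mem_union_left _ (Finset.mem_image_of_mem _ (Finset.mem_image_of_mem _
          (Finset.mem_filter.mpr ⟨hv, hbig⟩)))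
      · refine Finset.mem_union_right _ (Finset.mem_image_of_mem _ (Finset.mem_image_of_mem _ ?_))
        rw [memC]
        have h3 : (x (L H v)).1 ≠ (x (L H v)).2 :=
          of_reachable (H := H) (p := fun u => (x u).1 ≠ (x u).2) (fun _ _ h => h.2.1)
            ((hclH.reach v).mono (H.intra_le _)).symm ((memW v).mp hv)
        rw [Covered]
        revert h3
        cases (x (L H v)).1 <;> cases (x (L H v)).2 <;> simp
    refine (Finset.card_le_card hsub).trans ((Finset.card_union_le _ _).trans ?_)
    exact add_le_add Finset.card_image_le Finset.card_image_le
  have h3 : (Γ.crossingSet (label L s Γ x) α β).card ≤ 2 * (W₀.image (L H)).card := by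
    have hg : ∀ b, ∃ a, b ∈ Γ.crossingSet (label L s Γ x) α β → a ∈ α \ β ∧ Γ.Adj b a ∧
        label L s Γ x a ≠ label L s Γ x b := by
      intro b
      by_cases hb : b ∈ Γ.crossingSet (label L s Γ x) α β
      · obtain ⟨a, ha⟩ := (Finset.mem_filter.mp hb).2
        exact ⟨a, fun _ => ha⟩
      · exact ⟨0, fun h => absurd h hb⟩
    choose g hg using hg
    refine h.detours.card_le_of_crossing g (W₀.image (L H)) (L H)
      (fun u w huw => hclH.reachable huw) _ fun b hb => ?_
    obtain ⟨ha, hab, hne⟩ := hg b hb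
    have hb' := (Finset.mem_filter.mp hb).1
    have hbW : b ∈ α ∆ β := Finset.mem_symmDiff.mpr (Or.inr (Finset.mem_sdiff.mp hb'))
    have haW : g b ∈ α ∆ β := Finset.mem_symmDiff.mpr (Or.inl (Finset.mem_sdiff.mp ha))
    have hadj : H.Adj b (g b) := ⟨hab, (memW b).mp hbW, (memW _).mp haW⟩
    have hLne : L H b ≠ L H (g b) := fun heq => hne (label_eq_of_eq heq).symm
    refine ⟨hadj, fun hX => ?_, hLne, ?_, ?_⟩
    · exact (Finset.mem_sdiff.mp (Finset.mem_filter.mp hX).1).2 (Finset.mem_sdiff.mp ha).1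
    · refine Finset.mem_image_of_mem _ (Finset.mem_filter.mpr ⟨hbW, ?_⟩)
      exact (hlargeH b).resolve_right fun hc => hLne (hc b (g b) rfl hadj).symm
    · refine Finset.mem_image_of_mem _ (Finset.mem_filter.mpr ⟨haW, ?_⟩)
      exact (hlargeH (g b)).resolve_right fun hc => hLne (hc (g b) b rfl hadj.symm)
  set N₀ := (W₀.image (L H)).card
  set N₁ := ((α ∪ β).image (L K)).card
  -- Here 5 = 2 + 3 for the large clusters and 3 for the groups. Multiplied by `s` they give 10 and
  -- 6 times the larger cover; a single group gives `3 * s` instead of the latter.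
  have h4 : s * ((Γ.crossingSet (label L s Γ x) α β).card +
      3 * ((α ∆ β).image (label L s Γ x)).card) ≤ s * (5 * N₀ + 3 * N₁) :=
    Nat.mul_le_mul_left _ (by omega)
  refine h4.trans ?_
  rw [mul_add, mul_left_comm, mul_left_comm s 3]
  rcases h1 with h1 | h1
  · omega
  · have : s * N₁ ≤ s * 1 := by gcongr
    omega

/-- The schedule computed from an instance. -/
noncomputable def schedule (L : SimpleGraph ℕ → ℕ → ℕ) (s q N : ℕ) (Γ : SimpleGraph ℕ)
    (x : ℕ → Bool × Bool) (t : ℕ) : Finset ℕ :=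
  Γ.classSchedule (label L s Γ x) (marked N fun v => (x v).1) (marked N fun v => (x v).2) q t

/-- Half of `ε` pays for classes and crossing vertices through `s`, the other half for the block
lengths through `q`. -/
theorem isApproxSchedule_schedule (hL : IsLocalClustering N s ρ T L) (h : IsInstance N Γ x)
    {ε : ℝ} {q : ℕ} (hq : 2 ≤ ε * q) (hs : 32 ≤ ε * s) (hs0 : 0 < s) (hq0 : 0 < q) :
    IsApproxSchedule Γ (marked N fun v => (x v).1) (marked N fun v => (x v).2) (4 * q + 1)
      (1 + ε) 3 (schedule L s q N Γ x) := by
  have hcount := card_crossingSet_add_le hL h _ _ rfl rfl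
  set α := marked N fun v => (x v).1 with hα
  set β := marked N fun v => (x v).2 with hβ
  have memα : ∀ v, v ∈ α ↔ (x v).1 = true := fun v => mem_marked_fst h
  have memβ : ∀ v, v ∈ β ↔ (x v).2 = true := fun v => mem_marked_snd h
  refine SimpleGraph.isReconfigurationSchedule_classSchedule ?_ ?_ ?_ hq0 ?_
  · intro u w huw
    simp only [Finset.mem_coe, memα]
    exact h.cover_fst u w huw
  · intro u w huw
    simp only [Finset.mem_coe, memβ]
    exact h.cover_snd u w huw
  · refine h.detours.mono fun u w huw => ⟨huw.1, ?_⟩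
    have mem : ∀ v, v ∈ α \ β ∨ v ∈ β \ α → (x v).1 ≠ (x v).2 := by
      intro v hv
      rw [Finset.mem_sdiff, Finset.mem_sdiff, memα, memβ] at hv
      revert hv
      cases (x v).1 <;> cases (x v).2 <;> simp
    rcases huw.2 with ⟨h1, h2⟩ | ⟨h1, h2⟩
    · exact ⟨mem u (Or.inl h1), mem w (Or.inr h2)⟩
    · exact ⟨mem u (Or.inr h1), mem w (Or.inl h2)⟩
  · have hs' : (0 : ℝ) < s := by exact_mod_cast hs0
    have hq' : (0 : ℝ) < q := by exact_mod_cast hq0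
    rw [Nat.cast_max]
    set M : ℝ := max (α.card : ℝ) β.card with hM
    have hM0 : 0 ≤ M := le_max_of_le_left (Nat.cast_nonneg _)
    have h1 : (s : ℝ) * ((Γ.crossingSet (label L s Γ x) α β).card +
        3 * ((α ∆ β).image (label L s Γ x)).card) ≤ 16 * M + 3 * s := by
      rw [hM, ← Nat.cast_max]
      exact_mod_cast hcount
    have h2 : 16 * M ≤ s * (ε / 2 * M) := by nlinarith
    have h3 : ((Γ.crossingSet (label L s Γ x) α β).card : ℝ) +
        3 * ((α ∆ β).image (label L s Γ x)).card ≤ ε / 2 * M + 3 := by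
      refine le_of_mul_le_mul_left ?_ hs'
      linarith
    have h4 : M / q ≤ ε / 2 * M := by
      rw [div_le_iff₀ hq']
      nlinarith
    linarith

end Counting

/-! ### Locality of the schedule -/

section Locality

variable {N s ρ T : ℕ} {L : SimpleGraph ℕ → ℕ → ℕ} {Γ Γ' : SimpleGraph ℕ}
  {x x' : ℕ → Bool × Bool}

/-- The two instances agree on the ball of radius `r` around `v`. -/
def Agree (Γ : SimpleGraph ℕ) (x : ℕ → Bool × Bool) (Γ' : SimpleGraph ℕ) (x' : ℕ → Bool × Bool)
    (v r : ℕ) : Prop :=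
  Γ.AgreeOn Γ' v r ∧ ∀ u ∈ Γ.walkBall v r, x u = x' u

theorem Agree.shift {u v d r t : ℕ} (h : Agree Γ x Γ' x' v t) (hu : u ∈ Γ.walkBall v d)
    (ht : d + r ≤ t) : Agree Γ x Γ' x' u r :=
  ⟨h.1.shift hu ht, fun w hw => h.2 w
    (SimpleGraph.walkBall_mono ht (SimpleGraph.mem_walkBall_trans hu hw))⟩

theorem Agree.mono {v r t : ℕ} (h : Agree Γ x Γ' x' v t) (ht : r ≤ t) : Agree Γ x Γ' x' v r :=
  h.shift (SimpleGraph.self_mem_walkBall v 0) (by omega)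

theorem mem_walkBall_of_diffGraph {u v r : ℕ} (h : u ∈ (diffGraph Γ x).walkBall v r) :
    u ∈ Γ.walkBall v (2 * r) :=
  SimpleGraph.mem_walkBall_mul (H := diffGraph Γ x) (fun _ _ h =>
    SimpleGraph.walkBall_mono one_le_two h.1.mem_walkBall_one) h

theorem mem_walkBall_of_nearGraph {u v r : ℕ} (h : u ∈ (nearGraph Γ x).walkBall v r) :
    u ∈ Γ.walkBall v (2 * r) := by
  refine SimpleGraph.mem_walkBall_mul (fun u w h => ?_) h
  rcases h.2.2.2 with h | ⟨z, h, h'⟩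
  · exact SimpleGraph.walkBall_mono (by omega) h.mem_walkBall_one
  · exact SimpleGraph.mem_walkBall_trans h.mem_walkBall_one h'.mem_walkBall_one

theorem Agree.diffGraph {v r : ℕ} (h : Agree Γ x Γ' x' v (2 * r + 2)) :
    (diffGraph Γ x).AgreeOn (diffGraph Γ' x') v r := by
  intro u hu w
  have hu' := mem_walkBall_of_diffGraph hu
  have h1 := h.shift (r := 1) hu' (by omega)
  have h2 := h1.1 u (SimpleGraph.self_mem_walkBall _ _) w
  change (Γ.Adj u w ∧ _ ∧ _) ↔ (Γ'.Adj u w ∧ _ ∧ _)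
  rw [← h2, ← h1.2 u (SimpleGraph.self_mem_walkBall _ _)]
  refine and_congr_right fun huw => ?_
  rw [← h1.2 w huw.mem_walkBall_one]

theorem Agree.nearGraph {v r : ℕ} (h : Agree Γ x Γ' x' v (2 * r + 2)) :
    (nearGraph Γ x).AgreeOn (nearGraph Γ' x') v r := by
  intro u hu w
  have hu' := mem_walkBall_of_nearGraph hu
  have h1 := h.shift (r := 2) hu' (by omega)
  have h2 := h1.1 u (SimpleGraph.self_mem_walkBall _ _)
  have hadj : (Γ.Adj u w ∨ ∃ z, Γ.Adj u z ∧ Γ.Adj z w) ↔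
      (Γ'.Adj u w ∨ ∃ z, Γ'.Adj u z ∧ Γ'.Adj z w) := by
    rw [h2 w]
    refine or_congr_right (exists_congr fun z => ?_)
    rw [h2 z]
    refine and_congr_right fun huz => ?_
    exact h1.1 z (SimpleGraph.walkBall_mono (by omega) ((h2 z).mpr huz).mem_walkBall_one) w
  change (_ ∧ Covered x u ∧ Covered x w ∧ _) ↔ (_ ∧ Covered x' u ∧ Covered x' w ∧ _)
  rw [← hadj, Covered, Covered, Covered, Covered, ← h1.2 u (SimpleGraph.self_mem_walkBall _ _)]
  refine and_congr_right fun _ => and_congr_right fun _ => ?_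
  by_cases hw : Γ.Adj u w ∨ ∃ z, Γ.Adj u z ∧ Γ.Adj z w
  · have : w ∈ Γ.walkBall u 2 := by
      rcases hw with h | ⟨z, h, h'⟩
      · exact SimpleGraph.walkBall_mono (by omega) h.mem_walkBall_one
      · exact SimpleGraph.mem_walkBall_trans h.mem_walkBall_one h'.mem_walkBall_one
    rw [← h1.2 w this]
  · simp only [hw, and_false]

/-- Functions with bounded fibers that agree on a ball have the same fiber there. -/
theorem fiber_congr {ι : Type*} {f f' : ℕ → ι} {v R r : ℕ} (h : Agree Γ x Γ' x' v r) (hr : R ≤ r)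
    (hf : ∀ u, f u = f v → u ∈ Γ.walkBall v R) (hf' : ∀ u, f' u = f' v → u ∈ Γ'.walkBall v R)
    (heq : ∀ u ∈ Γ.walkBall v R, f u = f' u) (u : ℕ) : f u = f v ↔ f' u = f' v := by
  have hv := heq v (SimpleGraph.self_mem_walkBall _ _)
  constructor
  · intro hu
    rw [← heq u (hf u hu), hu, hv]
  · intro hu
    rw [heq u ((h.1.mem_walkBall_iff (by omega)).mpr (hf' u hu)), hu, hv]

variable (hL : IsLocalClustering N s ρ T L)

include hL

theorem leader_mem_walkBall (hΓ : ∀ u w, Γ.Adj u w → u < N) (v : ℕ) :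
    L (diffGraph Γ x) v ∈ Γ.walkBall v (2 * ρ) ∧ L (nearGraph Γ x) v ∈ Γ.walkBall v (2 * ρ) :=
  ⟨mem_walkBall_of_diffGraph (hL.mem_walkBall _ (diffGraph_adj_lt hΓ) v),
    mem_walkBall_of_nearGraph (hL.mem_walkBall _ (nearGraph_adj_lt hΓ) v)⟩

theorem mem_walkBall_of_leader_eq (hΓ : ∀ u w, Γ.Adj u w → u < N) {u v : ℕ}
    (h : L (diffGraph Γ x) u = L (diffGraph Γ x) v) : u ∈ Γ.walkBall v (4 * ρ) := by
  have h1 := (leader_mem_walkBall (x := x) hL hΓ v).1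
  have h2 := (leader_mem_walkBall (x := x) hL hΓ u).1
  rw [h] at h2
  exact SimpleGraph.walkBall_mono (by omega)
    (SimpleGraph.mem_walkBall_trans h1 (SimpleGraph.mem_walkBall_symm h2))

/-- The label of a vertex names a leader at most two leader steps away, each of length `2 * ρ`, as
an edge of the near graph spans at most two edges of `Γ`. -/
theorem mem_walkBall_of_label_eq (hΓ : ∀ u w, Γ.Adj u w → u < N) {u v : ℕ}
    (h : label L s Γ x u = label L s Γ x v) : u ∈ Γ.walkBall v (8 * ρ) := by
  rw [label, label] at h
  split_ifs at h with h1 h2 h2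
  · exact SimpleGraph.walkBall_mono (by omega)
      (mem_walkBall_of_leader_eq hL hΓ (Prod.mk.inj h).2)
  · exact absurd (Prod.mk.inj h).1 (by simp)
  · exact absurd (Prod.mk.inj h).1 (by simp)
  · have h3 := (Prod.mk.inj h).2
    have key : ∀ w, L (nearGraph Γ x) (L (diffGraph Γ x) w) ∈ Γ.walkBall w (2 * ρ + 2 * ρ) :=
      fun w => SimpleGraph.mem_walkBall_trans (leader_mem_walkBall (x := x) hL hΓ w).1
        (leader_mem_walkBall (x := x) hL hΓ _).2
    have h4 := key u
    rw [h3] at h4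
    exact SimpleGraph.walkBall_mono (by omega)
      (SimpleGraph.mem_walkBall_trans (key v) (SimpleGraph.mem_walkBall_symm h4))

variable (hΓ : ∀ u w, Γ.Adj u w → u < N) (hΓ' : ∀ u w, Γ'.Adj u w → u < N)

include hΓ hΓ'

theorem label_eq_of_agree {v : ℕ} (h : Agree Γ x Γ' x' v (4 * ρ + (2 * T + 2))) :
    label L s Γ x v = label L s Γ' x' v := by
  have hH : ∀ u, Agree Γ x Γ' x' u (2 * T + 2) →
      L (diffGraph Γ x) u = L (diffGraph Γ' x') u := fun u hu =>
    hL.eq_of_agreeOn _ _ (diffGraph_adj_lt hΓ) (diffGraph_adj_lt hΓ') u hu.diffGraph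
  have hK : ∀ u, Agree Γ x Γ' x' u (2 * T + 2) →
      L (nearGraph Γ x) u = L (nearGraph Γ' x') u := fun u hu =>
    hL.eq_of_agreeOn _ _ (nearGraph_adj_lt hΓ) (nearGraph_adj_lt hΓ') u hu.nearGraph
  have hv := hH v (h.mono (by omega))
  have hfib := fiber_congr (f := L (diffGraph Γ x)) (f' := L (diffGraph Γ' x')) (R := 4 * ρ) h
    (by omega) (fun u hu => mem_walkBall_of_leader_eq hL hΓ hu)
    (fun u hu => mem_walkBall_of_leader_eq hL hΓ' hu) fun u hu => hH u (h.shift hu le_rfl)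
  have hset : {u | L (diffGraph Γ x) u = L (diffGraph Γ x) v} =
      {u | L (diffGraph Γ' x') u = L (diffGraph Γ' x') v} := Set.ext hfib
  rw [label, label, hset, ← hv,
    hK _ (h.shift (leader_mem_walkBall (x := x) hL hΓ v).1 (by omega))]

/-- The class of `v` lies within `8 * ρ`, and each label in it depends on a further `4 * ρ + 2 * T +
2`. One more step reaches the neighbours that decide about the crossing set. -/
theorem mem_schedule_iff_of_agree {q t v : ℕ}
    (h : Agree Γ x Γ' x' v (12 * ρ + (2 * T + 3))) :
    v ∈ schedule L s q N Γ x t ↔ v ∈ schedule L s q N Γ' x' t := by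
  classical
  have hlab : ∀ u, Agree Γ x Γ' x' u (4 * ρ + (2 * T + 2)) →
      label L s Γ x u = label L s Γ' x' u := fun u hu => label_eq_of_agree hL hΓ hΓ' hu
  have hlabv := hlab v (h.mono (by omega))
  have hfib := fiber_congr (f := label L s Γ x) (f' := label L s Γ' x') (R := 8 * ρ) h
    (by omega) (fun u hu => mem_walkBall_of_label_eq hL hΓ hu)
    (fun u hu => mem_walkBall_of_label_eq hL hΓ' hu) fun u hu => hlab u (h.shift hu (by omega))
  have hxv := h.2 v (SimpleGraph.self_mem_walkBall _ _)
  have hball : ∀ u, label L s Γ x u = label L s Γ x v → u ∈ Γ.walkBall v (8 * ρ) := fun u hu =>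
    mem_walkBall_of_label_eq hL hΓ hu
  have hx : ∀ u ∈ Γ.walkBall v (12 * ρ + (2 * T + 3)),
      (u ∈ marked N (fun v => (x v).1) ↔ u ∈ marked N (fun v => (x' v).1)) ∧
      (u ∈ marked N (fun v => (x v).2) ↔ u ∈ marked N (fun v => (x' v).2)) := by
    intro u hu
    simp only [marked, Finset.mem_filter, h.2 u hu, and_self]
  rw [schedule, schedule]
  set α := marked N fun v => (x v).1
  set β := marked N fun v => (x v).2
  set α' := marked N fun v => (x' v).1
  set β' := marked N fun v => (x' v).2
  have hxself := hx v (SimpleGraph.self_mem_walkBall _ _)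
  have hA : (α \ β).filter (fun u => label L s Γ x u = label L s Γ x v) =
      (α' \ β').filter fun u => label L s Γ' x' u = label L s Γ' x' v := by
    ext u
    rw [Finset.mem_filter, Finset.mem_filter, ← hfib u]
    refine and_congr_left fun hu => ?_
    have := hx u (SimpleGraph.walkBall_mono (by omega) (hball u hu))
    rw [Finset.mem_sdiff, Finset.mem_sdiff, this.1, this.2]
  have hB : (β \ α).filter (fun u => label L s Γ x u = label L s Γ x v) =
      (β' \ α').filter fun u => label L s Γ' x' u = label L s Γ' x' v := by
    ext u
    rw [Finset.mem_filter, Finset.mem_filter, ← hfib u]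
    refine and_congr_left fun hu => ?_
    have := hx u (SimpleGraph.walkBall_mono (by omega) (hball u hu))
    rw [Finset.mem_sdiff, Finset.mem_sdiff, this.1, this.2]
  have hstate : Γ.exchangeState ((α \ β).filter fun u => label L s Γ x u = label L s Γ x v)
        ((β \ α).filter fun u => label L s Γ x u = label L s Γ x v) q t =
      Γ'.exchangeState ((α' \ β').filter fun u => label L s Γ' x' u = label L s Γ' x' v)
        ((β' \ α').filter fun u => label L s Γ' x' u = label L s Γ' x' v) q t := by
    rw [← hA, ← hB]
    have hadj : ∀ u, label L s Γ x u = label L s Γ x v → ∀ w, Γ.Adj u w ↔ Γ'.Adj u w :=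
      fun u hu w => h.1 u (SimpleGraph.walkBall_mono (by omega) (hball u hu)) w
    generalize hA' : (α \ β).filter (fun u => label L s Γ x u = label L s Γ x v) = A
    generalize hB' : (β \ α).filter (fun u => label L s Γ x u = label L s Γ x v) = B
    -- The plan is a fixed choice that depends only on the edges between the two sets, so equal
    -- views select the same plan.
    have hbetween : ∀ C D : Finset ℕ, (∀ u ∈ C, ∀ w, Γ.Adj u w ↔ Γ'.Adj u w) →
        (∀ u ∈ D, ∀ w, Γ.Adj u w ↔ Γ'.Adj u w) →
        Γ.exchangePlan C D q = Γ'.exchangePlan C D q := by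
      intro C D hC hD
      have : Γ.between (C : Set ℕ) (D : Set ℕ) = Γ'.between (C : Set ℕ) (D : Set ℕ) := by
        ext u w
        refine and_congr_left fun h => ?_
        rcases h with h | h
        · exact hC u h.1 w
        · exact hD u h.1 w
      simp only [SimpleGraph.exchangePlan, this]
    have hadjA : ∀ u ∈ A, ∀ w, Γ.Adj u w ↔ Γ'.Adj u w := fun u hu =>
      hadj u (by rw [← hA'] at hu; exact (Finset.mem_filter.mp hu).2)
    have hadjB : ∀ u ∈ B, ∀ w, Γ.Adj u w ↔ Γ'.Adj u w := fun u hu =>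
      hadj u (by rw [← hB'] at hu; exact (Finset.mem_filter.mp hu).2)
    simp only [SimpleGraph.exchangeState, SimpleGraph.exchangeStage, hbetween A B hadjA hadjB,
      hbetween B A hadjB hadjA]
  have hcross : v ∈ Γ.crossingSet (label L s Γ x) α β ↔
      v ∈ Γ'.crossingSet (label L s Γ' x') α' β' := by
    rw [SimpleGraph.crossingSet, SimpleGraph.crossingSet, Finset.mem_filter, Finset.mem_filter,
      Finset.mem_sdiff, Finset.mem_sdiff, hxself.1, hxself.2]
    refine and_congr_right fun _ => exists_congr fun a => ?_
    by_cases hva : Γ.Adj v a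
    · have ha := hva.mem_walkBall_one
      have hxa := hx a (SimpleGraph.walkBall_mono (by omega) ha)
      rw [Finset.mem_sdiff, Finset.mem_sdiff, hxa.1, hxa.2, hlabv,
        hlab a (h.shift ha (by omega)), h.1 v (SimpleGraph.self_mem_walkBall _ _) a]
    · have hva' := (h.1 v (SimpleGraph.self_mem_walkBall _ _) a).not.mp hva
      simp only [hva, hva', false_and, and_false]
  rw [SimpleGraph.classSchedule, SimpleGraph.classSchedule]
  simp only [Finset.mem_union, Finset.mem_inter, Finset.mem_filter, Finset.mem_symmDiff,
    hstate, hxself.1, hxself.2]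
  refine or_congr_left (or_congr_right ?_)
  split_ifs
  · rfl
  · exact hcross

end Locality

end CoverInstance

theorem exists_isLocalClustering (k : ℕ) : ∃ C : ℕ, ∀ n, 2 ≤ n → ∀ i : ℕ,
    ∃ L, IsLocalClustering (n ^ k) (2 ^ i) (C * 2 ^ i) (C * 2 ^ i * logStar n) L := by
  obtain ⟨C, hC⟩ := exists_local_clustering k
  refine ⟨C, fun n hn i => ?_⟩
  obtain ⟨L, h1, h2⟩ := hC n hn i
  exact ⟨L, fun Γ hΓ => (h1 Γ hΓ).1, fun Γ hΓ => (h1 Γ hΓ).2.1, fun Γ hΓ => (h1 Γ hΓ).2.2, h2⟩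

/-! ### From identifiers back to nodes, and the algorithm -/

namespace IsReconfigurationSchedule

theorem of_map {V W : Type*} [DecidableEq V] [DecidableEq W] {G : SimpleGraph V} (f : V ↪ W)
    {α β : Finset V} {ℓ : ℕ} {s : ℝ} {S : ℕ → Finset V} {S' : ℕ → Finset W}
    (h : IsReconfigurationSchedule (G.map f) (α.map f) (β.map f) ℓ s S')
    (hS : ∀ i ≤ ℓ, ∀ v, v ∈ S i ↔ f v ∈ S' i) : IsReconfigurationSchedule G α β ℓ s S := by
  have hadj : ∀ u w, G.Adj u w → (G.map f).Adj (f u) (f w) := fun u w huw =>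
    (SimpleGraph.map_adj f G _ _).mpr ⟨u, w, huw, rfl, rfl⟩
  refine ⟨fun i hi u w huw => ?_, ?_, ?_, fun i hi => ?_, fun i hi u hu w hw hne huw => ?_⟩
  · have := h.isVertexCover i hi (hadj u w huw)
    simpa only [Finset.mem_coe, hS i hi] using this
  · ext v
    rw [hS 0 (Nat.zero_le _), h.first, Finset.mem_map' f]
  · ext v
    rw [hS ℓ le_rfl, h.last, Finset.mem_map' f]
  · refine le_trans ?_ (h.card_le i hi)
    have hsub : (S i ∪ S (i + 1)).map f ⊆ S' i ∪ S' (i + 1) := by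
      intro w hw
      obtain ⟨v, hv, rfl⟩ := Finset.mem_map.mp hw
      rwa [Finset.mem_union, hS i hi.le, hS (i + 1) hi, ← Finset.mem_union] at hv
    have := Finset.card_le_card hsub
    rw [Finset.card_map] at this
    exact_mod_cast this
  · have key : ∀ v ∈ S i ∆ S (i + 1), f v ∈ S' i ∆ S' (i + 1) := by
      intro v hv
      rw [Finset.mem_symmDiff] at hv ⊢
      rwa [← hS i hi.le, ← hS (i + 1) hi]
    exact h.isIndepSet i hi (Finset.mem_coe.mpr (key u hu)) (Finset.mem_coe.mpr (key w hw))
      (f.injective.ne hne) (hadj u w huw)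

/-- Adding everything and then removing everything takes two batches. -/
theorem add_then_remove {V : Type*} [DecidableEq V] {G : SimpleGraph V} {α β : Finset V} {s : ℝ}
    (hα : G.IsVertexCover (α : Set V)) (hβ : G.IsVertexCover (β : Set V))
    (hs : ((α ∪ β).card : ℝ) ≤ s) {S : ℕ → Finset V} (h0 : S 0 = α) (h1 : S 1 = α ∪ β)
    (h2 : S 2 = β) : IsReconfigurationSchedule G α β 2 s S := by
  refine ⟨fun i hi u w huw => ?_, h0, h2, fun i hi => ?_, fun i hi u hu w hw _ huw => ?_⟩
  · interval_cases i
    · rw [h0]; exact hα huw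
    · rw [h1]
      simp only [Finset.coe_union]
      exact (hα huw).imp Or.inl Or.inl
    · rw [h2]; exact hβ huw
  · interval_cases i
    · rwa [h0, h1, ← Finset.union_assoc, Finset.union_self]
    · rwa [h1, h2, Finset.union_assoc, Finset.union_self]
  · simp only [Finset.mem_coe, Finset.mem_symmDiff] at hu hw
    interval_cases i
    · simp only [h0, h1, Nat.zero_add, Finset.mem_union] at hu hw
      have := hα huw
      simp only [Finset.mem_coe] at this
      tauto
    · simp only [h1, h2, Nat.reduceAdd, Finset.mem_union] at hu hw
      have := hβ huw
      simp only [Finset.mem_coe] at this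
      tauto

end IsReconfigurationSchedule

namespace CoverInstance

variable {V : Type*} [DecidableEq V]

/-- The local inputs as a function of the identifiers. -/
noncomputable def inputOf (f : V ↪ ℕ) (α β : Finset V) : ℕ → Bool × Bool :=
  Function.extend f (coverInput α β) fun _ => (false, false)

theorem inputOf_apply (f : V ↪ ℕ) (α β : Finset V) (v : V) :
    inputOf f α β (f v) = coverInput α β v := f.injective.extend_apply _ _ _

theorem exists_of_covered {f : V ↪ ℕ} {α β : Finset V} {w : ℕ} (h : Covered (inputOf f α β) w) :
    ∃ v, f v = w := by
  by_contra hw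
  rw [Covered, inputOf, Function.extend_apply' _ _ _ hw] at h
  simp at h

theorem isInstance_map {G : SimpleGraph V} {f : V ↪ ℕ} {α β : Finset V} {N : ℕ}
    (hG : G.Connected) (hf : ∀ v, f v < N) (hα : G.IsVertexCover (α : Set V))
    (hβ : G.IsVertexCover (β : Set V))
    (hc : (G.induce ((α ∆ β : Finset V) : Set V)).IsCactus) :
    IsInstance N (G.map f) (inputOf f α β) := by
  refine ⟨fun w hw => ?_, fun u w huw => ?_, fun u w huw => ?_, fun u w huw => ?_,
    fun u w hu hw => ?_, ?_⟩
  · obtain ⟨v, rfl⟩ := exists_of_covered hw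
    exact hf v
  · obtain ⟨a, b, -, rfl, -⟩ := (SimpleGraph.map_adj f G _ _).mp huw
    exact hf a
  · obtain ⟨a, b, hab, rfl, rfl⟩ := (SimpleGraph.map_adj f G _ _).mp huw
    simpa [inputOf_apply, coverInput] using hα hab
  · obtain ⟨a, b, hab, rfl, rfl⟩ := (SimpleGraph.map_adj f G _ _).mp huw
    simpa [inputOf_apply, coverInput] using hβ hab
  · obtain ⟨a, rfl⟩ := exists_of_covered hu
    obtain ⟨b, rfl⟩ := exists_of_covered hw
    exact (hG.preconnected a b).map (SimpleGraph.Embedding.map f G).toHom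
  · refine (hc.hasCommonDetours.map ((Function.Embedding.subtype _).trans f)).mono ?_
    rintro u w ⟨huw, hu, hw⟩
    obtain ⟨a, b, hab, rfl, rfl⟩ := (SimpleGraph.map_adj f G _ _).mp huw
    have key : ∀ v, (inputOf f α β (f v)).1 ≠ (inputOf f α β (f v)).2 → v ∈ α ∆ β := by
      intro v hv
      rw [inputOf_apply, coverInput] at hv
      rw [Finset.mem_symmDiff]
      by_cases h1 : v ∈ α <;> by_cases h2 : v ∈ β <;> simp_all
    exact (SimpleGraph.map_adj _ _ _ _).mpr
      ⟨⟨a, Finset.mem_coe.mpr (key a hu)⟩, ⟨b, Finset.mem_coe.mpr (key b hw)⟩, hab, rfl, rfl⟩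

theorem marked_fst_inputOf {f : V ↪ ℕ} {α β : Finset V} {N : ℕ} (hf : ∀ v, f v < N) :
    marked N (fun w => (inputOf f α β w).1) = α.map f := by
  ext w
  rw [marked, Finset.mem_filter, Finset.mem_range, Finset.mem_map]
  constructor
  · rintro ⟨-, h⟩
    obtain ⟨v, rfl⟩ := exists_of_covered (Or.inl h)
    exact ⟨v, by simpa [inputOf_apply, coverInput] using h, rfl⟩
  · rintro ⟨v, hv, rfl⟩
    exact ⟨hf v, by simpa [inputOf_apply, coverInput] using hv⟩

theorem marked_snd_inputOf {f : V ↪ ℕ} {α β : Finset V} {N : ℕ} (hf : ∀ v, f v < N) :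
    marked N (fun w => (inputOf f α β w).2) = β.map f := by
  ext w
  rw [marked, Finset.mem_filter, Finset.mem_range, Finset.mem_map]
  constructor
  · rintro ⟨-, h⟩
    obtain ⟨v, rfl⟩ := exists_of_covered (Or.inr h)
    exact ⟨v, by simpa [inputOf_apply, coverInput] using h, rfl⟩
  · rintro ⟨v, hv, rfl⟩
    exact ⟨hf v, by simpa [inputOf_apply, coverInput] using hv⟩

theorem agree_of_known_eq {Γ Γ' : SimpleGraph ℕ} {x x' : ℕ → Bool × Bool} {v r : ℕ}
    (hx : knownInputs Γ x v (r + 1) = knownInputs Γ' x' v (r + 1))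
    (he : knownEdges Γ v (r + 1) = knownEdges Γ' v (r + 1)) : Agree Γ x Γ' x' v r :=
  ⟨agreeOn_of_knownEdges_eq he, fun u hu =>
    input_eq_of_knownInputs_eq hx u (SimpleGraph.walkBall_mono (by omega) hu)⟩

end CoverInstance

namespace LocalAlgorithm

/-- The algorithm without communication that adds everything and then removes everything if `P`
holds for the number of nodes, and evaluates the schedules `S` within `r` rounds otherwise. -/
noncomputable def reconfigure (P : ℕ → Prop) [DecidablePred P] (k ℓ : ℕ) (r : ℕ → ℕ)
    (S : ℕ → SimpleGraph ℕ → (ℕ → Bool × Bool) → ℕ → Finset ℕ) :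
    LocalAlgorithm (Bool × Bool) (List Bool) :=
  ofLocal (fun n => if P n then 0 else r n)
    (fun n Γ x => CoverInstance.IsInstance (n ^ k) Γ x)
    (fun n Γ x v => if P n then [(x v).1, (x v).1 || (x v).2, (x v).2]
      else (List.range (ℓ + 1)).map fun t => decide (v ∈ S n Γ x t))

variable {P : ℕ → Prop} [DecidablePred P] {k ℓ : ℕ} {r : ℕ → ℕ}
  {S : ℕ → SimpleGraph ℕ → (ℕ → Bool × Bool) → ℕ → Finset ℕ} {V : Type*} [Fintype V]
  [DecidableEq V] {G : SimpleGraph V} {f : V ↪ ℕ} {α β : Finset V}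

theorem run_reconfigure
    (hS : ¬ P (Fintype.card V) → ∀ Γ x Γ' x' v,
      CoverInstance.IsInstance (Fintype.card V ^ k) Γ x →
      CoverInstance.IsInstance (Fintype.card V ^ k) Γ' x' →
      knownInputs Γ x v (r (Fintype.card V)) = knownInputs Γ' x' v (r (Fintype.card V)) →
      knownEdges Γ v (r (Fintype.card V)) = knownEdges Γ' v (r (Fintype.card V)) →
      ∀ t, v ∈ S (Fintype.card V) Γ x t ↔ v ∈ S (Fintype.card V) Γ' x' t)
    (hG : CoverInstance.IsInstance (Fintype.card V ^ k) (G.map f) (CoverInstance.inputOf f α β))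
    (v : V) :
    (reconfigure P k ℓ r S).run G f (coverInput α β) v =
      if P (Fintype.card V) then [decide (v ∈ α), decide (v ∈ α) || decide (v ∈ β), decide (v ∈ β)]
      else (List.range (ℓ + 1)).map fun t =>
        decide (f v ∈ S (Fintype.card V) (G.map f) (CoverInstance.inputOf f α β) t) := by
  have hinput : coverInput α β = fun v => CoverInstance.inputOf f α β (f v) :=
    funext fun v => (CoverInstance.inputOf_apply f α β v).symm
  rw [hinput, reconfigure, run_ofLocal ?_ G f _ hG, CoverInstance.inputOf_apply]
  · rfl
  · intro Γ x Γ' x' v h h' hx he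
    split_ifs at hx he ⊢ with hP
    · have := input_eq_of_knownInputs_eq hx v (SimpleGraph.self_mem_walkBall _ _)
      rw [this]
    · simp only [hS hP Γ x Γ' x' v h h' hx he]

theorem computesSchedule_of_trivial {ident : V → ℕ} {A : LocalAlgorithm (Bool × Bool) (List Bool)}
    {η c : ℝ}
    (hrun : ∀ v, A.run G ident (coverInput α β) v =
      [decide (v ∈ α), decide (v ∈ α) || decide (v ∈ β), decide (v ∈ β)])
    (hα : G.IsVertexCover (α : Set V)) (hβ : G.IsVertexCover (β : Set V))
    (hs : ((α ∪ β).card : ℝ) ≤ η * (max α.card β.card : ℕ) + c) :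
    A.ComputesSchedule G ident α β 2 η c := by
  refine ⟨fun v => by rw [hrun]; rfl, IsReconfigurationSchedule.add_then_remove hα hβ hs
    ?_ ?_ ?_⟩ <;> ext v <;> simp [outputSets, hrun]

theorem computesSchedule_of_map {A : LocalAlgorithm (Bool × Bool) (List Bool)} {η c : ℝ}
    {T : ℕ → Finset ℕ}
    (hrun : ∀ v, A.run G f (coverInput α β) v =
      (List.range (ℓ + 1)).map fun t => decide (f v ∈ T t))
    (hT : IsApproxSchedule (G.map f) (α.map f) (β.map f) ℓ η c T) :
    A.ComputesSchedule G f α β ℓ η c := by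
  refine ⟨fun v => by rw [hrun]; simp, ?_⟩
  rw [IsApproxSchedule, Finset.card_map, Finset.card_map] at hT
  refine hT.of_map f fun i hi v => ?_
  have : i < ℓ + 1 := by omega
  simp [outputSets, hrun, this]

end LocalAlgorithm

theorem theorem4 :
    ∃ B : ℕ, ∀ k : ℕ, ∃ C : ℝ, ∀ ε : ℝ, 0 < ε →
      ∃ A : LocalAlgorithm (Bool × Bool) (List Bool),
        (∀ n : ℕ, (A.rounds n : ℝ) ≤ C * logStar n / ε) ∧
        ∀ (V : Type*) [Fintype V] [DecidableEq V] (G : SimpleGraph V) (ident : V → ℕ)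
          (α β : Finset V),
          G.Connected →
          Function.Injective ident →
          (∀ v, ident v < Fintype.card V ^ k) →
          G.IsVertexCover (α : Set V) →
          G.IsVertexCover (β : Set V) →
          (G.induce ((α ∆ β : Finset V) : Set V)).IsCactus →
          ∃ ℓ : ℕ, ℓ ≤ B * ⌈1 / ε⌉₊ ∧ A.ComputesSchedule G ident α β ℓ (1 + ε) 3 := by
  classical
  -- With `q = 2 * m` the schedule has `8 * m + 1 ≤ 9 * m` batches.
  refine ⟨9, fun k => ?_⟩
  obtain ⟨C, hC⟩ := exists_isLocalClustering k
  -- The first factor bounds the rounds in units of `2 ^ i * logStar n`; the second comes from `2 ^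
  -- i ≤ 64 * m ≤ 128 / ε` for `ε < 1`.
  refine ⟨(14 * C + 4) * 128, fun ε hε => ?_⟩
  set m := ⌈1 / ε⌉₊ with hm
  have hm1 : 1 ≤ m := Nat.one_le_ceil_iff.mpr (by positivity)
  have hmε : 1 ≤ ε * m := by
    have := Nat.le_ceil (1 / ε)
    rwa [div_le_iff₀ hε, mul_comm] at this
  set i := Nat.clog 2 (32 * m) with hi
  have hs1 : 32 * m ≤ 2 ^ i := Nat.le_pow_clog (by norm_num) _
  have hs2 : 2 ^ i ≤ 64 * m := by
    have := Nat.pow_pred_clog_lt_self (b := 2) (by norm_num) (x := 32 * m) (by omega)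
    have hpos : 0 < i := Nat.clog_pos (by norm_num) (by omega)
    obtain ⟨j, hj⟩ : ∃ j, i = j + 1 := ⟨i - 1, by omega⟩
    rw [← hi, hj, Nat.pred_succ] at this
    rw [hj, pow_succ]
    omega
  choose! L hL using fun n hn => hC n hn i
  -- The final `+ 1` is the round needed to learn the edges at the boundary of the ball.
  set r : ℕ → ℕ := fun n => 12 * (C * 2 ^ i) + (2 * (C * 2 ^ i * logStar n) + 3) + 1 with hr
  -- For `n ≤ 1` the bound allows no rounds, and for large `ε` it may be below one. In both cases
  -- adding all of `α ∪ β` is affordable.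
  set A := LocalAlgorithm.reconfigure (fun n => n ≤ 1 ∨ 1 ≤ ε) k (4 * (2 * m) + 1) r
    (fun n => CoverInstance.schedule (L n) (2 ^ i) (2 * m) (n ^ k)) with hA
  refine ⟨A, fun n => ?_, fun V _ _ G ident α β hG hinj hid hα hβ hc => ?_⟩
  · change ((if n ≤ 1 ∨ 1 ≤ ε then 0 else r n : ℕ) : ℝ) ≤ _
    split_ifs with hn
    · simp only [Nat.cast_zero]
      positivity
    · push Not at hn
      have hlog : 1 ≤ logStar n := by
        rw [logStar, dif_neg (by omega)]
        omega
      have h1 : r n ≤ (14 * C + 4) * (2 ^ i * logStar n) := by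
        have h2 : 1 ≤ 2 ^ i * logStar n := Nat.mul_pos (by positivity) hlog
        have h3 : C * 2 ^ i ≤ C * (2 ^ i * logStar n) := by
          rw [← mul_assoc]
          exact Nat.le_mul_of_pos_right _ hlog
        simp only [hr]
        rw [mul_assoc]
        linarith
      have h2 : (2 : ℝ) ^ i ≤ 128 / ε := by
        have h3 : (m : ℝ) < 1 / ε + 1 := Nat.ceil_lt_add_one (by positivity)
        have h4 : (1 : ℝ) ≤ 1 / ε := by rw [le_div_iff₀ hε]; linarith [hn.2]
        have h5 : (2 : ℝ) ^ i ≤ 64 * m := by exact_mod_cast hs2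
        calc (2 : ℝ) ^ i ≤ 64 * m := h5
          _ ≤ 64 * (2 * (1 / ε)) := by linarith
          _ = 128 / ε := by ring
      have h3 : (r n : ℝ) ≤ (14 * C + 4) * (2 ^ i * logStar n) := by exact_mod_cast h1
      calc (r n : ℝ) ≤ (14 * C + 4) * (2 ^ i * logStar n) := h3
        _ ≤ (14 * C + 4) * (128 / ε * logStar n) := by gcongr
        _ = _ := by ring
  · let f : V ↪ ℕ := ⟨ident, hinj⟩
    have hinst : CoverInstance.IsInstance (Fintype.card V ^ k) (G.map f)
        (CoverInstance.inputOf f α β) := CoverInstance.isInstance_map hG hid hα hβ hc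
    have hrun := LocalAlgorithm.run_reconfigure (P := fun n => n ≤ 1 ∨ 1 ≤ ε) (k := k)
      (ℓ := 4 * (2 * m) + 1) (r := r)
      (S := fun n => CoverInstance.schedule (L n) (2 ^ i) (2 * m) (n ^ k)) (G := G) (f := f)
      (α := α) (β := β) (fun hP Γ x Γ' x' v h h' hx he t =>
        CoverInstance.mem_schedule_iff_of_agree (hL _ (by omega)) h.adj_lt h'.adj_lt
          (CoverInstance.agree_of_known_eq hx he)) hinst
    by_cases hP : Fintype.card V ≤ 1 ∨ 1 ≤ ε
    · refine ⟨2, by omega, LocalAlgorithm.computesSchedule_of_trivial (fun v => ?_) hα hβ ?_⟩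
      · exact (hrun v).trans (if_pos hP)
      · have hnn : (0 : ℝ) ≤ (max α.card β.card : ℕ) := Nat.cast_nonneg _
        rcases hP with hP | hP
        · have h1 : ((α ∪ β).card : ℝ) ≤ 1 := by exact_mod_cast (Finset.card_le_univ _).trans hP
          nlinarith
        · have h1 : (α ∪ β).card ≤ 2 * max α.card β.card := by
            have := Finset.card_union_le α β
            omega
          have h2 : ((α ∪ β).card : ℝ) ≤ 2 * (max α.card β.card : ℕ) := by exact_mod_cast h1
          nlinarith
    · refine ⟨4 * (2 * m) + 1, by omega,
        LocalAlgorithm.computesSchedule_of_map (f := f) (fun v => (hrun v).trans (if_neg hP)) ?_⟩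
      have hmain := CoverInstance.isApproxSchedule_schedule (hL (Fintype.card V) (by omega)) hinst
        (ε := ε) (q := 2 * m) (by push_cast; linarith)
        (by
          have : (32 * m : ℝ) ≤ (2 ^ i : ℕ) := by exact_mod_cast hs1
          nlinarith)
        (by positivity) (by omega)
      rwa [CoverInstance.marked_fst_inputOf hid, CoverInstance.marked_snd_inputOf hid] at hmain
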